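/- **Conventions.** Let $1\le L_0\le\infty$; $\mathbb R/2L_0\mathbb Z$ means $\mathbb R$ when $L_0=\infty$. $H^1(\mathbb R/2L_0\mathbb Z;\mathbb K)$ ($\mathbb K=\mathbb R$ or $\mathbb C$) is the space of $2L_0$-periodic (no condition if $L_0=\infty$), locally absolutely continuous $f:\mathbb R\to\mathbb K$ with $\|f\|_{H^1}^2=\int_{-L_0}^{L_0}|f'|^2+4|f|^2\,dx<\infty$, and $H^{-1}(\mathbb R/2L_0\mathbb Z;\mathbb K)$ is its dual with respect to the pairing $\int_{-L_0}^{L_0} q\varphi\,dx$. For $q\in H^{-1}(\mathbb R/2L_0\mathbb Z;\mathbb R)$ let $H_q=-\partial_x^2+q$ be the Schrödinger operator acting on the whole line, with (periodic, if $L_0<\infty$) potential $q$, defined through its quadratic form $\int_{\mathbb R}|\psi'|^2+q|\psi|^2\,dx$, $\psi\in H^1(\mathbb R)$. Let $R(k)=(H_q+k^2)^{-1}:H^{-1}(\mathbb R;\mathbb C)\to H^1(\mathbb R;\mathbb C)$ be its resolvent and $g(x)=g(x;q,k)=\langle\delta_x,R(k)\delta_x\rangle$ its diagonal Green's function. Given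 a constant $C\ge1$, a complex number $k\neq0$ is called strictly admissible if $0\le\arg k<\frac\pi4$, $\operatorname{Im}(k^2)\ge C$ and $|\frac\pi8-\arg k|<\frac\pi{16}$. Submanifolds and smoothness are understood over $\mathbb R$. **Lemma 2.12 (Global diffeomorphism property).** Let $C\ge1$, let $k$ be strictly admissible and let $1\le L_0\le\infty$. Then for every $q\in H^{-1}(\mathbb R/2L_0\mathbb Z;\mathbb R)$ the resolvent $R(k)$ exists, $g(x;q,k)\ne0$ for all $x$, and each of the two mappings $$q\mapsto g(k)-\tfrac1{2k}\qquad\text{and}\qquad q\mapsto k-\tfrac1{2g(k)}$$ takes values in $H^1(\mathbb R/2L_0\mathbb Z;\mathbb C)$ and is a diffeomorphism from $H^{-1}(\mathbb R/2L_0\mathbb Z;\mathbb R)$ onto its range, which is a smoothly embedded submanifold of $H^1(\mathbb R/2L_0\mathbb Z;\mathbb C)$. Moreover, $q$ is recovered from $g$ via the identity $$q=\Bigl[\tfrac{g'(k)}{2g(k)}\Bigr]'+\Bigl[\tfrac{g'(k)}{2g(k)}\Bigr]^2+\Bigl[\tfrac1{4g(k)^2}-k^2\Bigr]$$ of distributions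 in $H^{-1}(\mathbb R/2L_0\mathbb Z;\mathbb C)$. -/

import Mathlib

open MeasureTheory Set Filter
open scoped Topology ContDiff Manifold

set_option linter.unusedSectionVars false

noncomputable section

namespace DiagonalGreen

/-- A period cell of the circle `ℝ / 2Lℤ`: the interval `(-L, L)`, which is all of `ℝ` for
`L = ⊤`. -/
def cell (L : ENNReal) : Set ℝ := {x | ENNReal.ofReal |x| < L}

/-- `f` belongs to `H¹(ℝ / 2Lℤ; 𝕜)` (to `H¹(ℝ; 𝕜)` if `L = ⊤`): it is `2L`-periodic (no condition if
`L = ⊤`), locally absolutely continuous (it is the primitive of its locally integrable a.e.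
derivative), and `f` and its derivative are square integrable over a period cell. -/
structure MemH1 {𝕜 : Type} [RCLike 𝕜] (L : ENNReal) (f : ℝ → 𝕜) : Prop where
  periodic : L ≠ ⊤ → Function.Periodic f (2 * L.toReal)
  memLp : MemLp f 2 (volume.restrict (cell L))
  memLp_deriv : MemLp (deriv f) 2 (volume.restrict (cell L))
  intervalIntegrable_deriv : ∀ a b : ℝ, IntervalIntegrable (deriv f) volume a b
  integral_deriv : ∀ a b : ℝ, ∫ x in a..b, deriv f x = f b - f a

theorem cell_top : cell ⊤ = univ := by
  ext x; simp [cell]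

theorem cell_of_ne_top {L : ENNReal} (h : L ≠ ⊤) : cell L = Ioo (-L.toReal) L.toReal := by
  ext x
  rw [cell, Set.mem_ofPred_eq, ENNReal.ofReal_lt_iff_lt_toReal (abs_nonneg x) h, abs_lt, mem_Ioo]

theorem measurableSet_cell (L : ENNReal) : MeasurableSet (cell L) := by
  by_cases h : L = ⊤
  · rw [h, cell_top]; exact MeasurableSet.univ
  · rw [cell_of_ne_top h]; exact measurableSet_Ioo

section

variable {𝕜 : Type} [RCLike 𝕜] {L : ENNReal} {f g : ℝ → 𝕜}

theorem ae_hasDerivAt_of_primitive {h : ℝ → 𝕜} {R : ℝ}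
    (hi : IntervalIntegrable h volume (-R) R)
    (hf : ∀ a ∈ Ioo (-R) R, ∀ b ∈ Ioo (-R) R, ∫ x in a..b, h x = f b - f a) :
    ∀ᵐ x, x ∈ Ioo (-R) R → HasDerivAt f (h x) x := by
  filter_upwards [hi.ae_hasDerivAt_integral] with x hx hxR
  have hR : 0 < R := by have := hxR.1.trans hxR.2; linarith
  have h0 : (0 : ℝ) ∈ Ioo (-R) R := ⟨by linarith, hR⟩
  have hs : uIcc (-R) R = Icc (-R) R := uIcc_of_le (by linarith)
  have h1 := hx (hs ▸ Ioo_subset_Icc_self hxR) 0 (hs ▸ Ioo_subset_Icc_self h0)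
  have h2 := h1.add_const (f 0)
  refine h2.congr_of_eventuallyEq ?_
  filter_upwards [isOpen_Ioo.mem_nhds hxR] with y hy
  rw [hf 0 h0 y hy]; ring

theorem ae_of_forall_nat {p : ℝ → Prop} (h : ∀ n : ℕ, ∀ᵐ x : ℝ, x ∈ Ioo (-(n : ℝ)) n → p x) :
    ∀ᵐ x : ℝ, p x := by
  filter_upwards [ae_all_iff.2 h] with x hx
  obtain ⟨n, hn⟩ := exists_nat_gt |x|
  exact hx n (abs_lt.1 hn)

theorem MemH1.ae_hasDerivAt (hf : MemH1 L f) : ∀ᵐ x, HasDerivAt f (deriv f x) x :=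
  ae_of_forall_nat fun _ => ae_hasDerivAt_of_primitive (hf.intervalIntegrable_deriv _ _)
    fun a _ b _ => hf.integral_deriv a b

theorem MemH1.of_primitive (h : ℝ → 𝕜) (hp : L ≠ ⊤ → Function.Periodic f (2 * L.toReal))
    (hf : MemLp f 2 (volume.restrict (cell L))) (hh : MemLp h 2 (volume.restrict (cell L)))
    (hi : ∀ a b : ℝ, IntervalIntegrable h volume a b)
    (hfh : ∀ a b : ℝ, ∫ x in a..b, h x = f b - f a) : MemH1 L f := by
  have hd : ∀ᵐ x, h x = deriv f x := by
    refine (ae_of_forall_nat fun n => ae_hasDerivAt_of_primitive (hi _ _)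
      fun a _ b _ => hfh a b).mono fun x hx => hx.deriv.symm
  refine ⟨hp, hf, (memLp_congr_ae (ae_restrict_of_ae hd)).1 hh,
    fun a b => (hi a b).congr_ae (ae_restrict_of_ae hd), fun a b => ?_⟩
  rw [← hfh a b]
  exact intervalIntegral.integral_congr_ae (hd.mono fun x hx _ => hx.symm)

theorem MemH1.continuous (hf : MemH1 L f) : Continuous f := by
  have h : f = fun x => (∫ t in (0 : ℝ)..x, deriv f t) + f 0 := by
    ext x; rw [hf.integral_deriv]; ring
  rw [h]
  exact (intervalIntegral.continuous_primitive hf.intervalIntegrable_deriv 0).add_const _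

theorem MemH1.zero : MemH1 L (0 : ℝ → 𝕜) :=
  .of_primitive 0 (fun _ _ => rfl) MemLp.zero MemLp.zero
    (fun _ _ => intervalIntegrable_const) (by simp)

theorem MemH1.add (hf : MemH1 L f) (hg : MemH1 L g) : MemH1 L (f + g) :=
  .of_primitive (deriv f + deriv g) (fun h => (hf.periodic h).add (hg.periodic h))
    (hf.memLp.add hg.memLp) (hf.memLp_deriv.add hg.memLp_deriv)
    (fun a b => (hf.intervalIntegrable_deriv a b).add (hg.intervalIntegrable_deriv a b))
    (fun a b => by
      simp only [Pi.add_apply]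
      rw [intervalIntegral.integral_add (hf.intervalIntegrable_deriv a b)
        (hg.intervalIntegrable_deriv a b), hf.integral_deriv, hg.integral_deriv]; ring)

theorem MemH1.smul (c : 𝕜) (hf : MemH1 L f) : MemH1 L (c • f) :=
  .of_primitive (c • deriv f) (fun h => (hf.periodic h).smul c)
    (hf.memLp.const_smul c) (hf.memLp_deriv.const_smul c)
    (fun a b => (hf.intervalIntegrable_deriv a b).smul c)
    (fun a b => by
      simp only [Pi.smul_apply]
      rw [intervalIntegral.integral_smul, hf.integral_deriv, smul_sub])

theorem deriv_add_ae (hf : MemH1 L f) (hg : MemH1 L g) :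
    ∀ᵐ x, deriv (f + g) x = deriv f x + deriv g x := by
  filter_upwards [hf.ae_hasDerivAt, hg.ae_hasDerivAt] with x h1 h2
  exact (h1.add h2).deriv

theorem deriv_smul_ae (c : 𝕜) (hf : MemH1 L f) :
    ∀ᵐ x, deriv (c • f) x = c • deriv f x := by
  filter_upwards [hf.ae_hasDerivAt] with x h1
  exact (h1.const_smul c).deriv

end

/-- The functions of class `H¹`, as a linear space of functions on the line. -/
def h1Submodule (𝕜 : Type) [RCLike 𝕜] (L : ENNReal) : Submodule 𝕜 (ℝ → 𝕜) where
  carrier := {f | MemH1 L f}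
  add_mem' := MemH1.add
  zero_mem' := MemH1.zero
  smul_mem' c _ hf := hf.smul c

/-- The Sobolev space `H¹(ℝ / 2Lℤ; 𝕜)` for `L < ⊤`, and `H¹(ℝ; 𝕜)` for `L = ⊤`. Its elements are
continuous functions on the line. -/
def H1 (𝕜 : Type) [RCLike 𝕜] (L : ENNReal) : Type := h1Submodule 𝕜 L

section

variable {𝕜 : Type} [RCLike 𝕜] {L : ENNReal}

instance : AddCommGroup (H1 𝕜 L) := inferInstanceAs (AddCommGroup (h1Submodule 𝕜 L))

instance : Module 𝕜 (H1 𝕜 L) := inferInstanceAs (Module 𝕜 (h1Submodule 𝕜 L))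

instance : CoeFun (H1 𝕜 L) (fun _ => ℝ → 𝕜) := ⟨fun f => f.1⟩

theorem H1.mem (f : H1 𝕜 L) : MemH1 L (f : ℝ → 𝕜) := f.2

theorem H1.ext {f g : H1 𝕜 L} (h : ∀ x, f x = g x) : f = g := Subtype.ext (funext h)

theorem H1.coe_add (f g : H1 𝕜 L) : ((f + g : H1 𝕜 L) : ℝ → 𝕜) = (f : ℝ → 𝕜) + g := rfl

theorem H1.coe_smul (c : 𝕜) (f : H1 𝕜 L) : ((c • f : H1 𝕜 L) : ℝ → 𝕜) = c • (f : ℝ → 𝕜) := rfl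

theorem H1.coe_sub (f g : H1 𝕜 L) : ((f - g : H1 𝕜 L) : ℝ → 𝕜) = (f : ℝ → 𝕜) - g := rfl

theorem integrable_inner_of_memLp {μ : Measure ℝ} {u v : ℝ → 𝕜} (hu : MemLp u 2 μ)
    (hv : MemLp v 2 μ) : Integrable (fun x => inner 𝕜 (u x) (v x)) μ := by
  refine ((hu.norm.integrable_mul hv.norm)).mono (hu.1.inner hv.1) (.of_forall fun x => ?_)
  simpa using norm_inner_le_norm (𝕜 := 𝕜) (u x) (v x)

theorem H1.integrable_inner (f g : H1 𝕜 L) :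
    Integrable (fun x => inner 𝕜 (deriv f x) (deriv g x) + 4 * inner 𝕜 (f x) (g x))
      (volume.restrict (cell L)) :=
  (integrable_inner_of_memLp f.mem.memLp_deriv g.mem.memLp_deriv).add
    ((integrable_inner_of_memLp f.mem.memLp g.mem.memLp).const_mul 4)

theorem H1.eq_zero_of_integral [Fact (1 ≤ L)] (f : H1 𝕜 L)
    (h : ∫ x in cell L, (‖deriv f x‖ ^ 2 + 4 * ‖f x‖ ^ 2) = 0) : f = 0 := by
  have hint : Integrable (fun x => ‖deriv f x‖ ^ 2 + 4 * ‖f x‖ ^ 2) (volume.restrict (cell L)) :=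
    (f.mem.memLp_deriv.integrable_norm_pow (by norm_num)).add
      ((f.mem.memLp.integrable_norm_pow (by norm_num)).const_mul 4)
  have h0 := (integral_eq_zero_iff_of_nonneg (fun x => by positivity) hint).1 h
  have h1 : (f : ℝ → 𝕜) =ᵐ[volume.restrict (cell L)] (fun _ => 0) := by
    filter_upwards [h0] with x hx
    have h2 : ‖f x‖ ^ 2 = 0 := by
      have hx' : ‖deriv f x‖ ^ 2 + 4 * ‖f x‖ ^ 2 = 0 := hx
      nlinarith [sq_nonneg ‖deriv f x‖, sq_nonneg ‖f x‖]
    simpa using h2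
  have hc := f.mem.continuous
  have hL : (1 : ENNReal) ≤ L := Fact.out
  apply H1.ext
  intro x
  change f x = 0
  by_cases hT : L = ⊤
  · subst hT
    rw [cell_top, Measure.restrict_univ] at h1
    exact congrFun ((Continuous.ae_eq_iff_eq volume hc continuous_const).1 h1) x
  · rw [cell_of_ne_top hT] at h1
    have hl : 1 ≤ L.toReal := by
      rw [← ENNReal.toReal_one]; exact ENNReal.toReal_mono hT hL
    have h3 : EqOn (f : ℝ → 𝕜) (fun _ => 0) (Ioo (-L.toReal) L.toReal) :=
      Measure.eqOn_open_of_ae_eq h1 isOpen_Ioo hc.continuousOn continuousOn_const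
    have h4 : EqOn (f : ℝ → 𝕜) (fun _ => 0) (Icc (-L.toReal) L.toReal) := by
      have := h3.closure hc continuous_const
      rwa [closure_Ioo (by linarith)] at this
    obtain ⟨y, hy, hxy⟩ := (f.mem.periodic hT).exists_mem_Ico (by linarith) x (-L.toReal)
    rw [hxy]
    exact h4 ⟨hy.1, by linarith [hy.2]⟩

theorem integral_re_inner_self (f : H1 𝕜 L) :
    RCLike.re (∫ x in cell L, (inner 𝕜 (deriv f x) (deriv f x) + 4 * inner 𝕜 (f x) (f x)))
      = ∫ x in cell L, (‖deriv f x‖ ^ 2 + 4 * ‖f x‖ ^ 2) := by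
  rw [← integral_re (H1.integrable_inner f f)]
  refine integral_congr_ae (.of_forall fun x => ?_)
  simp only [inner_self_eq_norm_sq_to_K]
  norm_cast

/-- The inner product `∫ f' g' + 4 f g` over a period cell (conjugation on `f`), whose norm squared
is `∫ |f'|² + 4 |f|²`. -/
@[reducible] def H1.core (𝕜 : Type) [RCLike 𝕜] (L : ENNReal) [Fact (1 ≤ L)] :
    InnerProductSpace.Core 𝕜 (H1 𝕜 L) where
  inner f g := ∫ x in cell L, (inner 𝕜 (deriv f x) (deriv g x) + 4 * inner 𝕜 (f x) (g x))
  conj_inner_symm f g := by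
    rw [← integral_conj]
    refine integral_congr_ae (.of_forall fun x => ?_)
    simp only [map_add, map_mul, inner_conj_symm, map_ofNat]
  re_inner_nonneg f := by
    rw [integral_re_inner_self]
    exact integral_nonneg fun x => by positivity
  add_left f g h := by
    rw [← integral_add (H1.integrable_inner f h) (H1.integrable_inner g h)]
    refine integral_congr_ae (ae_restrict_of_ae ?_)
    filter_upwards [deriv_add_ae f.mem g.mem] with x hx
    rw [H1.coe_add, hx, Pi.add_apply, inner_add_left, inner_add_left]
    ring
  smul_left f g c := by
    rw [← integral_const_mul]
    refine integral_congr_ae (ae_restrict_of_ae ?_)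
    filter_upwards [deriv_smul_ae c f.mem] with x hx
    rw [H1.coe_smul, hx, Pi.smul_apply, inner_smul_left, inner_smul_left]
    ring
  definite f hf := by
    apply H1.eq_zero_of_integral
    rw [← integral_re_inner_self, hf, map_zero]

variable [Fact (1 ≤ L)]

instance : NormedAddCommGroup (H1 𝕜 L) := (H1.core 𝕜 L).toNormedAddCommGroup

instance : InnerProductSpace 𝕜 (H1 𝕜 L) := InnerProductSpace.ofCore (H1.core 𝕜 L).toCore

theorem H1.inner_def (f g : H1 𝕜 L) : inner 𝕜 f g =
    ∫ x in cell L, (inner 𝕜 (deriv f x) (deriv g x) + 4 * inner 𝕜 (f x) (g x)) := rfl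

theorem H1.norm_sq (f : H1 𝕜 L) :
    ‖f‖ ^ 2 = ∫ x in cell L, (‖deriv f x‖ ^ 2 + 4 * ‖f x‖ ^ 2) := by
  rw [← inner_self_eq_norm_sq (𝕜 := 𝕜) f, H1.inner_def, integral_re_inner_self]

theorem H1.integrable_energy (f : H1 𝕜 L) :
    Integrable (fun x => ‖deriv f x‖ ^ 2 + 4 * ‖f x‖ ^ 2) (volume.restrict (cell L)) :=
  (f.mem.memLp_deriv.integrable_norm_pow (by norm_num)).add
    ((f.mem.memLp.integrable_norm_pow (by norm_num)).const_mul 4)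

theorem one_le_toReal (hT : L ≠ ⊤) : 1 ≤ L.toReal := by
  rw [← ENNReal.toReal_one]; exact ENNReal.toReal_mono hT Fact.out

theorem H1.deriv_periodic (f : H1 𝕜 L) (hT : L ≠ ⊤) :
    Function.Periodic (deriv f) (2 * L.toReal) := by
  intro x
  rw [← deriv_comp_add_const]
  congr 1
  exact funext (f.mem.periodic hT)

theorem H1.energy_periodic (f : H1 𝕜 L) (hT : L ≠ ⊤) :
    Function.Periodic (fun x => ‖deriv f x‖ ^ 2 + 4 * ‖f x‖ ^ 2) (2 * L.toReal) := by
  intro x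
  simp only [H1.deriv_periodic f hT x, f.mem.periodic hT x]

theorem H1.intervalIntegrable_energy (f : H1 𝕜 L) (a b : ℝ) :
    IntervalIntegrable (fun x => ‖deriv f x‖ ^ 2 + 4 * ‖f x‖ ^ 2) volume a b := by
  have h := f.integrable_energy
  by_cases hT : L = ⊤
  · subst hT
    rw [cell_top, Measure.restrict_univ] at h
    exact h.intervalIntegrable
  · have hl := one_le_toReal (L := L) hT
    refine (f.energy_periodic hT).intervalIntegrable (t := -L.toReal) (by linarith) ?_ a b
    rw [cell_of_ne_top hT] at h
    have h1 : -L.toReal + 2 * L.toReal = L.toReal := by ring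
    rw [h1, intervalIntegrable_iff_integrableOn_Ioo_of_le (by linarith)]
    exact h

theorem H1.integral_unit_le (f : H1 𝕜 L) (y : ℝ) :
    ∫ x in y..(y + 1), (‖deriv f x‖ ^ 2 + 4 * ‖f x‖ ^ 2) ≤ ‖f‖ ^ 2 := by
  rw [H1.norm_sq]
  by_cases hT : L = ⊤
  · subst hT
    rw [intervalIntegral.integral_of_le (by linarith)]
    have h := f.integrable_energy
    rw [cell_top] at h ⊢
    exact setIntegral_mono_set h (.of_forall fun x => by positivity)
      (.of_forall fun x _ => mem_univ x)
  · have hl := one_le_toReal (L := L) hT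
    have h1 : ∫ x in cell L, (‖deriv f x‖ ^ 2 + 4 * ‖f x‖ ^ 2)
        = ∫ x in y..(y + 2 * L.toReal), (‖deriv f x‖ ^ 2 + 4 * ‖f x‖ ^ 2) := by
      rw [cell_of_ne_top hT, ← integral_Ioc_eq_integral_Ioo,
        ← intervalIntegral.integral_of_le (by linarith),
        (f.energy_periodic hT).intervalIntegral_add_eq y (-L.toReal)]
      congr 1; ring
    rw [h1]
    exact intervalIntegral.integral_mono_interval le_rfl (by linarith) (by linarith)
      (.of_forall fun x => by positivity) (f.intervalIntegrable_energy _ _)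

theorem H1.intervalIntegrable_deriv_sq (f : H1 𝕜 L) (a b : ℝ) :
    IntervalIntegrable (fun x => ‖deriv f x‖ ^ 2) volume a b := by
  have h := (f.intervalIntegrable_energy a b).sub
    ((f.mem.continuous.norm.pow 2).const_mul 4 |>.intervalIntegrable a b)
  refine h.congr_ae (.of_forall fun x => ?_)
  simp

theorem H1.norm_apply_le (f : H1 𝕜 L) (x : ℝ) : ‖f x‖ ≤ 2 * ‖f‖ := by
  set D : ℝ := ∫ t in x..(x + 1), ‖deriv f t‖ with hD
  have hdi : IntervalIntegrable (fun t => ‖deriv f t‖) volume x (x + 1) :=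
    (f.mem.intervalIntegrable_deriv x (x + 1)).norm
  have hd2 := f.intervalIntegrable_deriv_sq x (x + 1)
  have hD2 : D ^ 2 ≤ ∫ t in x..(x + 1), ‖deriv f t‖ ^ 2 := by
    have h0 : 0 ≤ ∫ t in x..(x + 1), (‖deriv f t‖ - D) ^ 2 :=
      intervalIntegral.integral_nonneg (by linarith) fun t _ => sq_nonneg _
    have h1 : ∫ t in x..(x + 1), (‖deriv f t‖ - D) ^ 2
        = (∫ t in x..(x + 1), ‖deriv f t‖ ^ 2) - D ^ 2 := by
      have h2 : (fun t => (‖deriv f t‖ - D) ^ 2)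
          = fun t => (‖deriv f t‖ ^ 2 - (2 * D) * ‖deriv f t‖) + D ^ 2 := by
        ext t; ring
      rw [h2, intervalIntegral.integral_add (hd2.sub (hdi.const_mul _)) intervalIntegrable_const,
        intervalIntegral.integral_sub hd2 (hdi.const_mul _), intervalIntegral.integral_const_mul,
        intervalIntegral.integral_const, ← hD]
      simp only [add_sub_cancel_left, smul_eq_mul]
      ring
    linarith
  have hpt : ∀ y ∈ Icc x (x + 1), ‖f x‖ ^ 2 ≤ 2 * ‖f y‖ ^ 2 + 2 * D ^ 2 := by
    intro y hy
    have h1 : ‖f y - f x‖ ≤ D := by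
      rw [← f.mem.integral_deriv x y]
      refine (intervalIntegral.norm_integral_le_integral_norm hy.1).trans ?_
      exact intervalIntegral.integral_mono_interval le_rfl hy.1 hy.2
        (.of_forall fun t => norm_nonneg _) hdi
    have h2 : ‖f x‖ ≤ ‖f y‖ + D := by
      have h3 := norm_sub_norm_le (f x) (f y)
      rw [norm_sub_rev] at h3
      linarith
    have h4 := norm_nonneg (f x)
    nlinarith [sq_nonneg (‖f y‖ - D)]
  have hc : Continuous fun y => 2 * ‖f y‖ ^ 2 + 2 * D ^ 2 :=
    ((f.mem.continuous.norm.pow 2).const_mul 2).add_const _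
  have hm : ∫ _ in x..(x + 1), ‖f x‖ ^ 2 ≤ ∫ y in x..(x + 1), (2 * ‖f y‖ ^ 2 + 2 * D ^ 2) :=
    intervalIntegral.integral_mono_on (by linarith) intervalIntegrable_const
      (hc.intervalIntegrable _ _) hpt
  have hf2 : IntervalIntegrable (fun y => ‖f y‖ ^ 2) volume x (x + 1) :=
    (f.mem.continuous.norm.pow 2).intervalIntegrable _ _
  rw [intervalIntegral.integral_add (hf2.const_mul 2) intervalIntegrable_const,
    intervalIntegral.integral_const_mul, intervalIntegral.integral_const,
    intervalIntegral.integral_const] at hm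
  simp only [add_sub_cancel_left, one_smul] at hm
  have hu := f.integral_unit_le x
  rw [intervalIntegral.integral_add hd2 (hf2.const_mul 4),
    intervalIntegral.integral_const_mul] at hu
  have hnn : 0 ≤ ∫ y in x..(x + 1), ‖f y‖ ^ 2 :=
    intervalIntegral.integral_nonneg (by linarith) fun t _ => sq_nonneg _
  have hfin : ‖f x‖ ^ 2 ≤ (2 * ‖f‖) ^ 2 := by nlinarith [sq_nonneg ‖f‖]
  exact le_of_sq_le_sq hfin (by positivity)

theorem H1.exists_integral_le (L : ENNReal) [Fact (1 ≤ L)] (N : ℕ) (f : H1 𝕜 L) :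
    ∫ x in (-(N : ℝ))..N, ‖deriv f x‖ ^ 2 ≤ (2 * N) * ‖f‖ ^ 2 := by
  have h1 : ∫ x in (-(N : ℝ))..N, ‖deriv f x‖ ^ 2
      ≤ ∫ x in (-(N : ℝ))..N, (‖deriv f x‖ ^ 2 + 4 * ‖f x‖ ^ 2) :=
    intervalIntegral.integral_mono_on (by have : (0 : ℝ) ≤ N := Nat.cast_nonneg N
                                          linarith)
      (f.intervalIntegrable_deriv_sq _ _) (f.intervalIntegrable_energy _ _)
      fun x _ => by have := sq_nonneg ‖f x‖; linarith
  have h2 := intervalIntegral.sum_integral_adjacent_intervals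
    (f := fun x => ‖deriv f x‖ ^ 2 + 4 * ‖f x‖ ^ 2) (μ := volume)
    (a := fun j : ℕ => -(N : ℝ) + j) (n := 2 * N)
    (fun j _ => f.intervalIntegrable_energy _ _)
  have h3 : -(N : ℝ) + ((2 * N : ℕ) : ℝ) = N := by push_cast; ring
  simp only [Nat.cast_zero, add_zero, h3] at h2
  rw [← h2] at h1
  refine h1.trans ((Finset.sum_le_card_nsmul _ _ (‖f‖ ^ 2) fun j _ => ?_).trans ?_)
  · have := f.integral_unit_le (-(N : ℝ) + j)
    push_cast
    rwa [← add_assoc]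
  · simp

theorem norm_toLp_sq {μ : Measure ℝ} {v : ℝ → 𝕜} (hv : MemLp v 2 μ) :
    ‖hv.toLp v‖ ^ 2 = ∫ x, ‖v x‖ ^ 2 ∂μ := by
  rw [← inner_self_eq_norm_sq (𝕜 := 𝕜), L2.inner_def, ← integral_re (L2.integrable_inner _ _)]
  refine integral_congr_ae ?_
  filter_upwards [hv.coeFn_toLp] with x hx
  rw [hx, inner_self_eq_norm_sq]

theorem exists_limit_of_bound {μ : Measure ℝ} (T : H1 𝕜 L → ℝ → 𝕜)
    (hT : ∀ f, MemLp (T f) 2 μ) (hsub : ∀ f g, T (f - g) =ᵐ[μ] T f - T g) (K : ℝ) (hK0 : 0 ≤ K)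
    (hK : ∀ f, ∫ x, ‖T f x‖ ^ 2 ∂μ ≤ K ^ 2 * ‖f‖ ^ 2) {u : ℕ → H1 𝕜 L} (hu : CauchySeq u) :
    ∃ H : Lp 𝕜 2 μ, Tendsto (fun n => (hT (u n)).toLp (T (u n))) atTop (𝓝 H) := by
  have hl : LipschitzWith K.toNNReal (fun f => (hT f).toLp (T f)) := by
    refine LipschitzWith.of_dist_le_mul fun f g => ?_
    rw [Real.coe_toNNReal _ hK0, dist_eq_norm, dist_eq_norm, ← MemLp.toLp_sub]
    have h1 : ((hT f).sub (hT g)).toLp (T f - T g) = (hT (f - g)).toLp (T (f - g)) :=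
      MemLp.toLp_congr _ _ (hsub f g).symm
    rw [h1]
    refine le_of_sq_le_sq ?_ (by positivity)
    rw [norm_toLp_sq, mul_pow]
    exact hK _
  exact cauchySeq_tendsto_of_complete (hl.uniformContinuous.comp_cauchySeq hu)

theorem H1.deriv_sub_ae (f g : H1 𝕜 L) :
    ∀ᵐ x, deriv (f - g : H1 𝕜 L) x = deriv f x - deriv g x := by
  filter_upwards [f.mem.ae_hasDerivAt, g.mem.ae_hasDerivAt] with x h1 h2
  exact (h1.sub h2).deriv

theorem exists_deriv_limit {S : Set ℝ}
    (hmem : ∀ f : H1 𝕜 L, MemLp (deriv f) 2 (volume.restrict S)) (K : ℝ) (hK0 : 0 ≤ K)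
    (hK : ∀ f : H1 𝕜 L, ∫ x in S, ‖deriv f x‖ ^ 2 ≤ K ^ 2 * ‖f‖ ^ 2)
    {u : ℕ → H1 𝕜 L} (hu : CauchySeq u) {f : ℝ → 𝕜}
    (hf : ∀ x, Tendsto (fun n => u n x) atTop (𝓝 (f x))) :
    ∃ H : Lp 𝕜 2 (volume.restrict S),
      Tendsto (fun n => (hmem (u n)).toLp (deriv (u n))) atTop (𝓝 H) ∧
      ∀ a b, a ≤ b → Ioc a b ⊆ S → ∫ x in a..b, H x = f b - f a := by
  obtain ⟨H, hH⟩ := exists_limit_of_bound (fun f : H1 𝕜 L => deriv f) hmem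
    (fun f g => ae_restrict_of_ae (H1.deriv_sub_ae f g)) K hK0 hK hu
  refine ⟨H, hH, fun a b hab hs => ?_⟩
  have hμ : (volume.restrict S) (Ioc a b) ≠ ⊤ := by
    refine ((Measure.restrict_apply_le _ _).trans_lt ?_).ne
    simp
  have hset : ∀ v : Lp 𝕜 2 (volume.restrict S),
      inner 𝕜 (indicatorConstLp 2 (measurableSet_Ioc (a := a) (b := b)) hμ (1 : 𝕜)) v
        = ∫ x in a..b, v x := by
    intro v
    rw [L2.inner_indicatorConstLp_one, Measure.restrict_restrict measurableSet_Ioc,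
      inter_eq_left.2 hs, intervalIntegral.integral_of_le hab]
  have h1 : Tendsto (fun n => inner 𝕜
      (indicatorConstLp 2 (measurableSet_Ioc (a := a) (b := b)) hμ (1 : 𝕜))
      ((hmem (u n)).toLp (deriv (u n)))) atTop (𝓝 (∫ x in a..b, H x)) := by
    rw [← hset]
    exact tendsto_const_nhds.inner hH
  have h2 : ∀ n, inner 𝕜
      (indicatorConstLp 2 (measurableSet_Ioc (a := a) (b := b)) hμ (1 : 𝕜))
      ((hmem (u n)).toLp (deriv (u n))) = u n b - u n a := by
    intro n
    rw [hset, ← (u n).mem.integral_deriv a b, intervalIntegral.integral_of_le hab,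
      intervalIntegral.integral_of_le hab]
    refine integral_congr_ae ?_
    exact ae_restrict_of_ae_restrict_of_subset hs (hmem (u n)).coeFn_toLp
  simp only [h2] at h1
  exact tendsto_nhds_unique h1 ((hf b).sub (hf a))

theorem H1.memLp_deriv_Ioo (N : ℕ) (f : H1 𝕜 L) :
    MemLp (deriv f) 2 (volume.restrict (Ioo (-(N : ℝ)) N)) := by
  have hN : (0 : ℝ) ≤ N := Nat.cast_nonneg N
  have h1 := f.mem.intervalIntegrable_deriv (-(N : ℝ)) N
  have h2 := f.intervalIntegrable_deriv_sq (-(N : ℝ)) N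
  rw [intervalIntegrable_iff_integrableOn_Ioo_of_le (by linarith)] at h1 h2
  exact (memLp_two_iff_integrable_sq_norm h1.1).2 h2

theorem H1.exists_limit {u : ℕ → H1 𝕜 L} (hu : CauchySeq u) :
    ∃ f : H1 𝕜 L, Tendsto u atTop (𝓝 f) := by
  have hpc : ∀ x, ∃ y, Tendsto (fun n => u n x) atTop (𝓝 y) := by
    intro x
    have hl : LipschitzWith 2 (fun f : H1 𝕜 L => f x) := by
      refine LipschitzWith.of_dist_le_mul fun f g => ?_
      rw [dist_eq_norm, dist_eq_norm]
      exact H1.norm_apply_le (f - g) x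
    exact cauchySeq_tendsto_of_complete (hl.uniformContinuous.comp_cauchySeq hu)
  choose f hf using hpc
  have hper : L ≠ ⊤ → Function.Periodic f (2 * L.toReal) := fun hT x =>
    tendsto_nhds_unique (hf _) ((hf x).congr fun n => ((u n).mem.periodic hT x).symm)
  have hloc : ∀ N : ℕ, MemLp (deriv f) 2 (volume.restrict (Ioo (-(N : ℝ)) N)) ∧
      ∀ a ∈ Ioo (-(N : ℝ)) N, ∀ b ∈ Ioo (-(N : ℝ)) N, ∫ x in a..b, deriv f x = f b - f a := by
    intro N
    have hN : (0 : ℝ) ≤ N := Nat.cast_nonneg N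
    obtain ⟨H, -, hH⟩ := exists_deriv_limit (S := Ioo (-(N : ℝ)) N)
      (H1.memLp_deriv_Ioo N) (Real.sqrt (2 * N)) (Real.sqrt_nonneg _) (fun f => by
        rw [Real.sq_sqrt (by linarith), ← integral_Ioc_eq_integral_Ioo,
          ← intervalIntegral.integral_of_le (by linarith)]
        exact H1.exists_integral_le L N f) hu hf
    have hHab : ∀ a ∈ Ioo (-(N : ℝ)) N, ∀ b ∈ Ioo (-(N : ℝ)) N,
        ∫ x in a..b, H x = f b - f a := by
      intro a ha b hb
      rcases le_total a b with hab | hab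
      · exact hH a b hab fun x hx => ⟨ha.1.trans hx.1, hx.2.trans_lt hb.2⟩
      · rw [intervalIntegral.integral_symm,
          hH b a hab fun x hx => ⟨hb.1.trans hx.1, hx.2.trans_lt ha.2⟩]
        ring
    have hHi : IntervalIntegrable H volume (-(N : ℝ)) N := by
      rw [intervalIntegrable_iff_integrableOn_Ioo_of_le (by linarith)]
      exact (Lp.memLp H).integrable one_le_two
    have hd := ae_hasDerivAt_of_primitive hHi hHab
    have hd' : (H : ℝ → 𝕜) =ᵐ[volume.restrict (Ioo (-(N : ℝ)) N)] deriv f := by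
      rw [Filter.EventuallyEq, ae_restrict_iff' measurableSet_Ioo]
      filter_upwards [hd] with x hx hxN
      exact (hx hxN).deriv.symm
    refine ⟨(memLp_congr_ae hd').1 (Lp.memLp H), fun a ha b hb => ?_⟩
    rw [← hHab a ha b hb]
    refine intervalIntegral.integral_congr_ae ?_
    filter_upwards [hd] with x hx hxab
    refine (hx ?_).deriv
    have := uIoc_subset_uIcc hxab
    exact (ordConnected_Ioo.uIcc_subset ha hb) this
  have hbig : ∀ a b : ℝ, ∃ N : ℕ, a ∈ Ioo (-(N : ℝ)) N ∧ b ∈ Ioo (-(N : ℝ)) N := by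
    intro a b
    obtain ⟨N, hN⟩ := exists_nat_gt (max |a| |b|)
    exact ⟨N, abs_lt.1 ((le_max_left _ _).trans_lt hN), abs_lt.1 ((le_max_right _ _).trans_lt hN)⟩
  have hint : ∀ a b : ℝ, IntervalIntegrable (deriv f) volume a b := by
    intro a b
    obtain ⟨N, ha, hb⟩ := hbig a b
    have h1 : IntegrableOn (deriv f) (Ioo (-(N : ℝ)) N) := (hloc N).1.integrable one_le_two
    rw [intervalIntegrable_iff]
    exact h1.mono_set (uIoc_subset_uIcc.trans (ordConnected_Ioo.uIcc_subset ha hb))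
  have hprim : ∀ a b : ℝ, ∫ x in a..b, deriv f x = f b - f a := by
    intro a b
    obtain ⟨N, ha, hb⟩ := hbig a b
    exact (hloc N).2 a ha b hb
  obtain ⟨H, hHt, hH⟩ := exists_deriv_limit
    (fun f : H1 𝕜 L => f.mem.memLp_deriv) 1 zero_le_one (fun f => by
      rw [one_pow, one_mul, H1.norm_sq]
      exact integral_mono (f.mem.memLp_deriv.integrable_norm_pow (by norm_num)) f.integrable_energy
        fun x => by have := sq_nonneg ‖f x‖; simp only; linarith) hu hf
  have hHloc : ∀ R : ℝ, 0 < R → Ioo (-R) R ⊆ cell L →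
      ∀ᵐ x, x ∈ Ioo (-R) R → H x = deriv f x := by
    intro R hR hs
    have hi : IntervalIntegrable H volume (-R) R := by
      rw [intervalIntegrable_iff_integrableOn_Ioo_of_le (by linarith)]
      have : MemLp H 2 (volume.restrict (Ioo (-R) R)) :=
        (Lp.memLp H).mono_measure (Measure.restrict_mono hs le_rfl)
      exact this.integrable one_le_two
    have hab : ∀ a ∈ Ioo (-R) R, ∀ b ∈ Ioo (-R) R, ∫ x in a..b, H x = f b - f a := by
      intro a ha b hb
      rcases le_total a b with hab | hab
      · exact hH a b hab fun x hx => hs ⟨ha.1.trans hx.1, hx.2.trans_lt hb.2⟩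
      · rw [intervalIntegral.integral_symm,
          hH b a hab fun x hx => hs ⟨hb.1.trans hx.1, hx.2.trans_lt ha.2⟩]
        ring
    filter_upwards [ae_hasDerivAt_of_primitive hi hab] with x hx hxR
    exact (hx hxR).deriv.symm
  have hHd : (H : ℝ → 𝕜) =ᵐ[volume.restrict (cell L)] deriv f := by
    rw [Filter.EventuallyEq, ae_restrict_iff' (measurableSet_cell L)]
    by_cases hT : L = ⊤
    · refine (ae_of_forall_nat fun n => ?_ : ∀ᵐ x, H x = deriv f x).mono fun x hx _ => hx
      rcases Nat.eq_zero_or_pos n with rfl | hn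
      · simp
      · exact hHloc n (by exact_mod_cast hn) (by rw [hT, cell_top]; exact subset_univ _)
    · have hl := one_le_toReal (L := L) hT
      filter_upwards [hHloc _ (by linarith) (cell_of_ne_top hT).ge] with x hx hxL
      exact hx (cell_of_ne_top hT ▸ hxL)
  have hdmem : MemLp (deriv f) 2 (volume.restrict (cell L)) := (memLp_congr_ae hHd).1 (Lp.memLp H)
  obtain ⟨F, hF⟩ := exists_limit_of_bound (μ := volume.restrict (cell L))
    (fun f : H1 𝕜 L => f) (fun f => f.mem.memLp) (fun f g => .rfl) 1 zero_le_one (fun f => by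
      rw [one_pow, one_mul, H1.norm_sq]
      exact integral_mono (f.mem.memLp.integrable_norm_pow (by norm_num)) f.integrable_energy
        fun x => by
          have h1 := sq_nonneg ‖f x‖
          have h2 := sq_nonneg ‖deriv f x‖
          simp only
          linarith) hu
  have hFf : (F : ℝ → 𝕜) =ᵐ[volume.restrict (cell L)] f := by
    obtain ⟨ns, hns, hae⟩ := (tendstoInMeasure_of_tendsto_Lp hF).exists_seq_tendsto_ae
    have hall : ∀ᵐ x ∂(volume.restrict (cell L)), ∀ n,
        ((u n).mem.memLp.toLp (u n) : ℝ → 𝕜) x = u n x :=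
      ae_all_iff.2 fun n => (u n).mem.memLp.coeFn_toLp
    filter_upwards [hae, hall] with x hx hxn
    refine tendsto_nhds_unique hx ?_
    simp only [hxn]
    exact (hf x).comp hns.tendsto_atTop
  have hfmem : MemLp f 2 (volume.restrict (cell L)) := (memLp_congr_ae hFf).1 (Lp.memLp F)
  have hfH : MemH1 L f := ⟨hper, hfmem, hdmem, hint, hprim⟩
  let f' : H1 𝕜 L := ⟨f, hfH⟩
  refine ⟨f', tendsto_iff_norm_sub_tendsto_zero.2 ?_⟩
  have hHe : H = f'.mem.memLp_deriv.toLp (deriv f') :=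
    Lp.ext (hHd.trans (MemLp.coeFn_toLp f'.mem.memLp_deriv).symm)
  have hFe : F = f'.mem.memLp.toLp f' :=
    Lp.ext (hFf.trans (MemLp.coeFn_toLp f'.mem.memLp).symm)
  have hsq : ∀ n, ‖u n - f'‖ ^ 2
      = ‖(u n).mem.memLp_deriv.toLp (deriv (u n)) - H‖ ^ 2
        + 4 * ‖(u n).mem.memLp.toLp (u n) - F‖ ^ 2 := by
    intro n
    rw [hHe, hFe, ← MemLp.toLp_sub, ← MemLp.toLp_sub, norm_toLp_sq, norm_toLp_sq, H1.norm_sq,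
      ← integral_const_mul, ← integral_add]
    · refine integral_congr_ae (ae_restrict_of_ae ?_)
      filter_upwards [H1.deriv_sub_ae (u n) f'] with x hx
      rw [hx]; rfl
    · exact ((u n).mem.memLp_deriv.sub f'.mem.memLp_deriv).integrable_norm_pow (by norm_num)
    · exact (((u n).mem.memLp.sub f'.mem.memLp).integrable_norm_pow (by norm_num)).const_mul 4
  have h0 : Tendsto (fun n => ‖u n - f'‖ ^ 2) atTop (𝓝 0) := by
    simp only [hsq]
    have h1 := (tendsto_iff_norm_sub_tendsto_zero.1 hHt).pow 2
    have h2 := ((tendsto_iff_norm_sub_tendsto_zero.1 hF).pow 2).const_mul 4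
    simpa using h1.add h2
  have h3 := h0.sqrt
  simpa using h3

instance : CompleteSpace (H1 𝕜 L) :=
  Metric.complete_of_cauchySeq_tendsto fun _ hu => H1.exists_limit hu

end

/-- `H⁻¹(ℝ / 2Lℤ; ℝ)` (`H⁻¹(ℝ; ℝ)` if `L = ⊤`): the dual of `H¹` with its dual norm, with respect to
the `L²` pairing. -/
abbrev Hneg1 (L : ENNReal) [Fact (1 ≤ L)] : Type := StrongDual ℝ (H1 ℝ L)

/-- The Riesz representative `w ∈ H¹` of `q ∈ H⁻¹`, so that `q φ = ∫ w' φ' + 4 w φ` over a period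
cell, that is, `q = 4 w - w''` as a distribution. -/
def rieszRep {L : ENNReal} [Fact (1 ≤ L)] (q : Hneg1 L) : H1 ℝ L :=
  (InnerProductSpace.toDual ℝ (H1 ℝ L)).symm q

/-- The integral `∫ q F dx` over the whole line, for the (periodic) distribution `q = 4 w - w''`. -/
def lineIntegral {L : ENNReal} [Fact (1 ≤ L)] (q : Hneg1 L) (F : ℝ → ℂ) : ℂ :=
  ∫ x : ℝ, (4 * ((rieszRep q x : ℝ) : ℂ) * F x + ((deriv (rieszRep q) x : ℝ) : ℂ) * deriv F x)

/-- The (bilinear) form `∫ u' φ' + q u φ` on `H¹(ℝ; ℂ)` of the Schrödinger operator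
`H_q = -∂² + q` on the line (whose form domain is `H¹(ℝ; ℂ)`), i.e. the pairing of `H_q u` with
`φ`. For `φ = conj ψ` it is the Hermitian form `⟨ψ, H_q u⟩`. -/
def schrodingerForm {L : ENNReal} [Fact (1 ≤ L)] (q : Hneg1 L) (u φ : H1 ℂ ⊤) : ℂ :=
  (∫ x : ℝ, deriv u x * deriv φ x) + lineIntegral q (fun x => u x * φ x)

/-- `(H_q + k²) u = T`, for `u ∈ H¹(ℝ; ℂ)` and `T ∈ H⁻¹(ℝ; ℂ)`. -/
def IsResolventSolution {L : ENNReal} [Fact (1 ≤ L)] (q : Hneg1 L) (k : ℂ)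
    (T : StrongDual ℂ (H1 ℂ ⊤)) (u : H1 ℂ ⊤) : Prop :=
  ∀ φ : H1 ℂ ⊤, schrodingerForm q u φ + k ^ 2 * ∫ x : ℝ, u x * φ x = T φ

/-- The resolvent `R(k) = (H_q + k²)⁻¹ : H⁻¹(ℝ; ℂ) → H¹(ℝ; ℂ)`: it maps `T` to the
solution of `(H_q + k²) u = T` (meaningful where this solution exists and is unique). -/
def greenResolvent {L : ENNReal} [Fact (1 ≤ L)] (q : Hneg1 L) (k : ℂ)
    (T : StrongDual ℂ (H1 ℂ ⊤)) : H1 ℂ ⊤ :=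
  Classical.epsilon fun u => IsResolventSolution q k T u

/-- The point mass `δ_x ∈ H⁻¹(ℝ; ℂ)`. -/
def pointMass (x : ℝ) : StrongDual ℂ (H1 ℂ ⊤) :=
  LinearMap.mkContinuous
    { toFun := fun f => f x
      map_add' := fun _ _ => rfl
      map_smul' := fun _ _ => rfl } 2 fun f => H1.norm_apply_le f x

/-- The diagonal Green's function `g(x; q, k) = ⟨δ_x, R(k) δ_x⟩`. -/
def diagGreen {L : ENNReal} [Fact (1 ≤ L)] (q : Hneg1 L) (k : ℂ) (x : ℝ) : ℂ :=
  pointMass x (greenResolvent q k (pointMass x))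

/-- Admissible spectral parameters: `k ≠ 0` and `0 ≤ arg k < π/4`. -/
def Admissible (k : ℂ) : Prop :=
  k ≠ 0 ∧ 0 ≤ k.arg ∧ k.arg < Real.pi / 4

/-- Strictly admissible spectral parameters, relative to the constant `C ≥ 1`: `k` is
admissible, `Im (k²) ≥ C` and `|π/8 - arg k| < π/16`. -/
def StrictlyAdmissible (C : ℝ) (k : ℂ) : Prop :=
  Admissible k ∧ C ≤ (k ^ 2).im ∧ |Real.pi / 8 - k.arg| < Real.pi / 16

/-- The distribution on `ℝ / 2Lℤ` (on `ℝ` if `L = ⊤`) given by the function `h`, tested on `φ`. -/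
def funDist (L : ENNReal) [Fact (1 ≤ L)] (h : ℝ → ℂ) (φ : H1 ℝ L) : ℂ :=
  ∫ x in cell L, h x * ((φ x : ℝ) : ℂ)

/-- The distributional derivative `h'` of the function `h`, tested on `φ`. -/
def distDeriv (L : ENNReal) [Fact (1 ≤ L)] (h : ℝ → ℂ) (φ : H1 ℝ L) : ℂ :=
  -∫ x in cell L, h x * ((deriv φ x : ℝ) : ℂ)

/-- `S` is a smoothly embedded (split) submanifold of the normed space `F`: near each of its points,
some smooth local diffeomorphism of `F` straightens `S` to a closed complemented subspace. -/
def IsEmbeddedSubmanifold {F : Type} [NormedAddCommGroup F] [NormedSpace ℝ F] (S : Set F) : Prop :=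
  ∀ p ∈ S, ∃ (M : Submodule ℝ F) (ψ : OpenPartialHomeomorph F F),
    IsClosed (M : Set F) ∧ M.ClosedComplemented ∧ p ∈ ψ.source ∧
    ContDiffOn ℝ ∞ ψ ψ.source ∧ ContDiffOn ℝ ∞ ψ.symm ψ.target ∧
    ψ '' (S ∩ ψ.source) = (M : Set F) ∩ ψ.target

/-- `Φ` is a diffeomorphism from `E` onto its range, which is a smoothly embedded submanifold
of `F`. -/
structure IsDiffeoOntoSubmanifold {E F : Type} [NormedAddCommGroup E] [NormedSpace ℝ E]
    [NormedAddCommGroup F] [NormedSpace ℝ F] (Φ : E → F) : Prop where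
  /-- `Φ` is smooth. -/
  contDiff : ContDiff ℝ ∞ Φ
  /-- The range of `Φ` is a smoothly embedded submanifold. -/
  submanifold : IsEmbeddedSubmanifold (range Φ)
  /-- `Φ` is injective and its inverse is smooth on the range, i.e. near each point of the range it
  is the restriction of a smooth map defined on an open subset of `F`. -/
  injective : Function.Injective Φ
  smooth_inverse : ∀ p ∈ range Φ, ∃ (U : Set F) (G : F → E), IsOpen U ∧ p ∈ U ∧
    ContDiffOn ℝ ∞ G U ∧ ∀ q, Φ q ∈ U → G (Φ q) = q
  /-- `Φ` is a smooth embedding: a topological embedding and an immersion. -/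
  isSmoothEmbedding : Manifold.IsSmoothEmbedding 𝓘(ℝ, E) 𝓘(ℝ, F) ∞ Φ

end DiagonalGreen

end

open DiagonalGreen

/-! Write `q = 4 w - w''` with `w` the Riesz representative of `q`, so that only `w` and `w'` enter.
The argument runs on `Im k² > 0` and `Re k > 0`.

Resolvent. The potential is form bounded with relative bound zero (`lintegral_deriv_mul_le`). For
real `q` the potential term is real on `(u, conj u)`, so the imaginary part of the form of `H_q +
k²` controls `u` in `L²` and the real part then controls `u'`. This coercivity (`exists_coercive`)
makes `H_q + k²` invertible from `H¹` to `H⁻¹`, with inverse smooth in `w`. Applied to `u = G(x, ·)`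
it also bounds `|g(x)|` below uniformly in `x` (`exists_greenFun_lower_bound`).

Equation for `g`. Uniqueness on half lines yields `G(a,y) G(x,x) = G(a,x) G(x,y)` for `a ≤ x ≤ y`:
on the right of `x` all Green functions are multiples of one Weyl solution `ψ`. Its quasi-derivative
`P = ψ'/ψ + w'` is absolutely continuous and solves the Riccati equation `P' = k² + 4 w - (P - w')²`
(`hasPrim_weylQuot`), while the Wronskian gives `g' = 2 g (P - w') + 1` (`hasPrim_diag`). Hence
`g'/(2 g) + w' = P + 1/(2 g)`, and differentiating this gives the formula for `q`
(`inner_eq_of_diag`).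

Smoothness into `H¹`. Testing the equation of `G(x, ·)` with `exp(-k |· - x|)` expresses `g - 1/(2
k)` and `g'` through quantities bilinear in `(w, R(k))`. Exponential decay bounds them in `L²` over
a period cell, even for an arbitrary bounded operator in place of `R(k)`, so `q ↦ g - 1/(2 k)` is
smooth (`contDiff_diagShift`).

Embedding. The real part of the recovery formula makes sense, and is smooth, on the open set of `h`
for which `1/(2 k) + h` is bounded away from zero. It is thus a smooth left inverse of the first map
on a neighbourhood of its range, and a map with such a left inverse is a diffeomorphism onto an
embedded submanifold (`isDiffeoOntoSubmanifold_of_leftInverse`). The second map is a Möbius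
transform of the first, with an explicit smooth inverse. -/

noncomputable section

namespace DiagonalGreen

/-! ### Smooth maps with a smooth left inverse near their range -/

section LeftInverse

variable {E F : Type} [NormedAddCommGroup E] [NormedSpace ℝ E] [CompleteSpace E]
  [NormedAddCommGroup F] [NormedSpace ℝ F] [CompleteSpace F]

/-- A map which is smooth on an open set and whose derivative at a point is the identity restricts
to a smooth open partial homeomorphism around this point. -/
theorem exists_smooth_openPartialHomeomorph {f : F → F} {U : Set F} (hU : IsOpen U)
    (hf : ContDiffOn ℝ ∞ f U) {p : F} (hp : p ∈ U)
    (hd : HasFDerivAt f (ContinuousLinearMap.id ℝ F) p) :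
    ∃ ψ : OpenPartialHomeomorph F F, (ψ : F → F) = f ∧ p ∈ ψ.source ∧ ψ.source ⊆ U ∧
      ContDiffOn ℝ ∞ ψ ψ.source ∧ ContDiffOn ℝ ∞ ψ.symm ψ.target := by
  have hat : ∀ z ∈ U, ContDiffAt ℝ ∞ f z := fun z hz => hf.contDiffAt (hU.mem_nhds hz)
  have hd' : HasFDerivAt f ((ContinuousLinearEquiv.refl ℝ F : F ≃L[ℝ] F) : F →L[ℝ] F) p := hd
  have hcf : ContinuousOn (fderiv ℝ f) U := hf.continuousOn_fderiv_of_isOpen hU (by simp)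
  -- The inverse function theorem gives smoothness of the inverse at one point only. Restricting to
  -- the open set where the derivative is invertible makes the inverse smooth on the whole target.
  set O : Set F := U ∩ fderiv ℝ f ⁻¹' (range ((↑) : (F ≃L[ℝ] F) → F →L[ℝ] F)) with hO
  have hOo : IsOpen O := hcf.isOpen_inter_preimage hU ContinuousLinearEquiv.isOpen
  have hpO : p ∈ O := ⟨hp, by rw [mem_preimage, hd'.fderiv]; exact mem_range_self _⟩
  let ψ₀ := (hat p hp).toOpenPartialHomeomorph f hd' (by simp)
  let ψ := ψ₀.restrOpen O hOo
  have hsrc : ψ.source = ψ₀.source ∩ O := rfl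
  have hψ : (ψ : F → F) = f := rfl
  refine ⟨ψ, rfl, ⟨(hat p hp).mem_toOpenPartialHomeomorph_source hd' (by simp), hpO⟩,
    fun z hz => hz.2.1, fun z hz => (hat z hz.2.1).contDiffWithinAt, fun z hz => ?_⟩
  have hzs := ψ.map_target hz
  obtain ⟨e, he⟩ := hzs.2.2
  refine (ψ.contDiffAt_symm hz (f₀' := e) ?_ (hat _ hzs.2.1)).contDiffWithinAt
  rw [he]
  exact ((hat _ hzs.2.1).differentiableAt (by simp)).hasFDerivAt

theorem mem_maximalAtlas_of_smooth (ψ : OpenPartialHomeomorph F F)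
    (h1 : ContDiffOn ℝ ∞ ψ ψ.source) (h2 : ContDiffOn ℝ ∞ ψ.symm ψ.target) :
    ψ ∈ IsManifold.maximalAtlas 𝓘(ℝ, F) ∞ F := by
  rw [IsManifold.mem_maximalAtlas_iff, _root_.mem_maximalAtlas_iff]
  intro e he
  rw [chartedSpaceSelf_atlas] at he
  subst he
  have h : ∀ χ : OpenPartialHomeomorph F F, ContDiffOn ℝ ∞ χ χ.source →
      ContDiffOn ℝ ∞ χ.symm χ.target → χ ∈ contDiffGroupoid ∞ 𝓘(ℝ, F) := by
    intro χ h1 h2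
    rw [contDiffGroupoid, mem_groupoid_of_pregroupoid]
    simpa [contDiffPregroupoid] using ⟨h1, h2⟩
  constructor
  · rw [OpenPartialHomeomorph.trans_refl]
    exact h _ h2 h1
  · rw [OpenPartialHomeomorph.refl_symm, OpenPartialHomeomorph.refl_trans]
    exact h _ h1 h2

/-- If `S₁ s` and `S₂ s` are invertible then the kernels of `S₁` and `S₂` are both complements of
the range of `s`, hence are isomorphic. -/
def kerEquiv (S₁ S₂ : F →L[ℝ] E) (s : E →L[ℝ] F) (T : E →L[ℝ] E) (h1 : ∀ e, S₁ (s e) = e)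
    (h2 : ∀ e, T (S₂ (s e)) = e) (h3 : ∀ e, S₂ (s (T e)) = e) : S₂.ker ≃L[ℝ] S₁.ker :=
  ContinuousLinearEquiv.equivOfInverse
    ((((ContinuousLinearMap.id ℝ F) - s.comp S₁).comp S₂.ker.subtypeL).codRestrict S₁.ker
      fun z => by simp [h1])
    ((((ContinuousLinearMap.id ℝ F) - (s.comp T).comp S₂).comp S₁.ker.subtypeL).codRestrict S₂.ker
      fun z => by simp [h3])
    (fun z => by
      ext
      have hz : S₂ (z : F) = 0 := z.2
      simp [hz, h2])
    (fun z => by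
      ext
      have hz : S₁ (z : F) = 0 := z.2
      simp [hz, h1])

variable {Φ : E → F} {G : F → E} {U : Set F}

theorem leftInverse_fderiv_apply (hΦ : ContDiff ℝ ∞ Φ) (hU : IsOpen U) (hG : ContDiffOn ℝ ∞ G U)
    (hΦU : ∀ q, Φ q ∈ U) (hGΦ : ∀ q, G (Φ q) = q) (q e : E) :
    fderiv ℝ G (Φ q) (fderiv ℝ Φ q e) = e := by
  have h1 : HasFDerivAt G (fderiv ℝ G (Φ q)) (Φ q) :=
    ((hG.contDiffAt (hU.mem_nhds (hΦU q))).differentiableAt (by simp)).hasFDerivAt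
  have h2 : HasFDerivAt Φ (fderiv ℝ Φ q) q :=
    (hΦ.differentiable (by simp) q).hasFDerivAt
  have h3 := h1.comp q h2
  have h4 : G ∘ Φ = id := funext hGΦ
  rw [h4] at h3
  have := h3.unique (hasFDerivAt_id q)
  exact congrArg (fun l : E →L[ℝ] E => l e) this

/-- The chart straightening the range of a map with a smooth left inverse. -/
theorem exists_straightening (hΦ : ContDiff ℝ ∞ Φ) (hU : IsOpen U) (hG : ContDiffOn ℝ ∞ G U)
    (hΦU : ∀ q, Φ q ∈ U) (hGΦ : ∀ q, G (Φ q) = q) (q : E) :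
    ∃ ψ : OpenPartialHomeomorph F F, Φ q ∈ ψ.source ∧
      ContDiffOn ℝ ∞ ψ ψ.source ∧ ContDiffOn ℝ ∞ ψ.symm ψ.target ∧
      (∀ z ∈ ψ.source, Φ (G z) ∈ ψ.source) ∧
      ∀ z, ψ z = fderiv ℝ Φ q (G z) + ((z - Φ (G z))
        - fderiv ℝ Φ q (fderiv ℝ G (Φ q) (z - Φ (G z)))) := by
  set A := fderiv ℝ Φ q with hA
  set S := fderiv ℝ G (Φ q) with hS
  have hSA : ∀ e, S (A e) = e := leftInverse_fderiv_apply hΦ hU hG hΦU hGΦ q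
  -- The term `A (G z)` records the position along the range, the rest is the deviation `z - Φ (G
  -- z)` projected onto the kernel of `S`. As `A S` is a projection, the derivative at `Φ q` is `A S
  -- + (1 - A S)² = 1`.
  set f : F → F := fun z => A (G z) + ((z - Φ (G z)) - A (S (z - Φ (G z)))) with hf
  have hΦG : ContDiffOn ℝ ∞ (fun z => Φ (G z)) U := hΦ.comp_contDiffOn hG
  have hfU : ContDiffOn ℝ ∞ f U := by
    have h1 : ContDiffOn ℝ ∞ (fun z => z - Φ (G z)) U := contDiffOn_id.sub hΦG
    exact (A.contDiff.comp_contDiffOn hG).add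
      (h1.sub (A.contDiff.comp_contDiffOn (S.contDiff.comp_contDiffOn h1)))
  have hd : HasFDerivAt f (ContinuousLinearMap.id ℝ F) (Φ q) := by
    have h1 : HasFDerivAt G S (Φ q) :=
      ((hG.contDiffAt (hU.mem_nhds (hΦU q))).differentiableAt (by simp)).hasFDerivAt
    have h2 : HasFDerivAt Φ A (G (Φ q)) := by
      rw [hGΦ]; exact (hΦ.differentiable (by simp) q).hasFDerivAt
    have h3 : HasFDerivAt (fun z => z - Φ (G z)) (ContinuousLinearMap.id ℝ F - A.comp S) (Φ q) :=
      (hasFDerivAt_id _).sub (h2.comp _ h1)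
    have h4 := (A.hasFDerivAt.comp _ h1).add
      (h3.sub (A.hasFDerivAt.comp _ (S.hasFDerivAt.comp _ h3)))
    refine h4.congr_fderiv ?_
    ext z
    simp [hSA]
  obtain ⟨ψ, hψ, hp, hsU, hs1, hs2⟩ := exists_smooth_openPartialHomeomorph hU hfU (hΦU q) hd
  -- The source is shrunk so that it is stable under `z ↦ Φ (G z)`; injectivity of the chart can
  -- then be used to compare `z` with `Φ (G z)`.
  set O : Set F := U ∩ (fun z => Φ (G z)) ⁻¹' ψ.source with hO
  have hOo : IsOpen O := hΦG.continuousOn.isOpen_inter_preimage hU ψ.open_source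
  refine ⟨ψ.restrOpen O hOo, ⟨hp, hΦU q, ?_⟩, hs1.mono inter_subset_left,
    hs2.mono ?_, fun z hz => ⟨hz.2.2, hΦU _, ?_⟩, fun z => congrFun hψ z⟩
  · rw [mem_preimage, hGΦ]; exact hp
  · intro z hz
    exact hz.1
  · rw [mem_preimage, hGΦ]; exact hz.2.2

/-- The model subspace is the range of `A = DΦ(q)`. It is the fixed space of the projection `A S`,
hence closed and complemented. -/
theorem isEmbeddedSubmanifold_range (hΦ : ContDiff ℝ ∞ Φ) (hU : IsOpen U)
    (hG : ContDiffOn ℝ ∞ G U) (hΦU : ∀ q, Φ q ∈ U) (hGΦ : ∀ q, G (Φ q) = q) :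
    IsEmbeddedSubmanifold (range Φ) := by
  rintro _ ⟨q, rfl⟩
  obtain ⟨ψ, hp, h1, h2, hr, hψ⟩ := exists_straightening hΦ hU hG hΦU hGΦ q
  set A := fderiv ℝ Φ q with hA
  set S := fderiv ℝ G (Φ q) with hS
  have hSA : ∀ e, S (A e) = e := leftInverse_fderiv_apply hΦ hU hG hΦU hGΦ q
  have hM : ∀ y, y ∈ A.range ↔ A (S y) = y := by
    intro y
    constructor
    · rintro ⟨e, rfl⟩
      exact congrArg A (hSA e)
    · intro h
      exact ⟨S y, h⟩
  refine ⟨A.range, ψ, ?_, ?_, hp, h1, h2, ?_⟩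
  · have : ((A.range : Submodule ℝ F) : Set F) = {y | A (S y) = y} := by
      ext y; exact hM y
    rw [this]
    exact isClosed_eq (by fun_prop) continuous_id
  · refine ⟨(A.comp S).codRestrict A.range fun y => ⟨S y, rfl⟩, fun y => ?_⟩
    ext
    exact (hM y).1 y.2
  · ext y
    constructor
    · rintro ⟨_, ⟨⟨q', rfl⟩, hz⟩, rfl⟩
      refine ⟨?_, ψ.map_source hz⟩
      rw [hψ, hGΦ, sub_self, map_zero, map_zero, sub_self, add_zero]
      exact ⟨q', rfl⟩
    · rintro ⟨hy, hyt⟩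
      refine ⟨ψ.symm y, ⟨?_, ψ.map_target hyt⟩, ψ.right_inv hyt⟩
      set z := ψ.symm y with hz
      have hzs : z ∈ ψ.source := ψ.map_target hyt
      have hzy : ψ z = y := ψ.right_inv hyt
      -- Always `S (ψ z) = G z`, so a value `ψ z` in the range of `A` equals `A (G z)`, which is
      -- also `ψ (Φ (G z))`. Injectivity of `ψ` then puts `z` on the range of `Φ`.
      have h3 : ψ (Φ (G z)) = ψ z := by
        have h4 : A (S (ψ z)) = ψ z := by rw [hzy]; exact (hM y).1 hy
        rw [← h4, hψ (Φ (G z)), hGΦ, sub_self, map_zero, map_zero, sub_self, add_zero, hψ z]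
        simp only [map_add, map_sub, hSA]
        abel
      exact ⟨G z, ψ.injOn (hr z hzs) hzs h3⟩

theorem isEmbedding_of_leftInverse (hΦ : Continuous Φ) (hU : IsOpen U)
    (hG : ContinuousOn G U) (hΦU : ∀ q, Φ q ∈ U) (hGΦ : ∀ q, G (Φ q) = q) :
    Topology.IsEmbedding Φ := by
  refine ⟨⟨?_⟩, Function.LeftInverse.injective hGΦ⟩
  refine le_antisymm hΦ.le_induced ?_
  refine le_of_nhds_le_nhds fun q => ?_
  rw [nhds_induced]
  have h1 : Tendsto G (𝓝 (Φ q)) (𝓝 q) := by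
    have := (hG.continuousAt (hU.mem_nhds (hΦU q))).tendsto
    rwa [hGΦ] at this
  have h2 : Tendsto (G ∘ Φ) (comap Φ (𝓝 (Φ q))) (𝓝 q) := h1.comp tendsto_comap
  rwa [show G ∘ Φ = id from funext hGΦ, tendsto_id'] at h2

/-- An immersion asks for one complement that serves at all points, whereas the natural one, the
kernel of `DG(Φ q)`, varies with `q`. For `q₁` near `q₀` both kernels are complements of the range
of `DΦ(q₀)`, so the isomorphism class is locally constant, and `E` is connected. -/
theorem nonempty_ker_equiv (hΦ : ContDiff ℝ ∞ Φ) (hU : IsOpen U)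
    (hG : ContDiffOn ℝ ∞ G U) (hΦU : ∀ q, Φ q ∈ U) (hGΦ : ∀ q, G (Φ q) = q) (q q' : E) :
    Nonempty ((fderiv ℝ G (Φ q)).ker ≃L[ℝ] (fderiv ℝ G (Φ q')).ker) := by
  have hc : Continuous fun q => fderiv ℝ G (Φ q) := by
    rw [continuous_iff_continuousAt]
    intro q
    have h1 : ContinuousAt (fderiv ℝ G) (Φ q) :=
      (hG.continuousOn_fderiv_of_isOpen hU (by simp)).continuousAt (hU.mem_nhds (hΦU q))
    exact ContinuousAt.comp (f := Φ) h1 hΦ.continuous.continuousAt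
  let P : E → Prop := fun q' => Nonempty ((fderiv ℝ G (Φ q)).ker ≃L[ℝ] (fderiv ℝ G (Φ q')).ker)
  have hloc : ∀ q₀, ∀ᶠ q₁ in 𝓝 q₀,
      Nonempty ((fderiv ℝ G (Φ q₁)).ker ≃L[ℝ] (fderiv ℝ G (Φ q₀)).ker) := by
    intro q₀
    set s := fderiv ℝ Φ q₀
    have h1 := leftInverse_fderiv_apply hΦ hU hG hΦU hGΦ q₀
    have hc' : Continuous fun q => (fderiv ℝ G (Φ q)).comp s := hc.clm_comp_const s
    -- The composition is the identity at `q₀`, and invertible operators form an open set.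
    have h2 : ∀ᶠ q₁ in 𝓝 q₀, (fderiv ℝ G (Φ q₁)).comp s ∈
        range ((↑) : (E ≃L[ℝ] E) → E →L[ℝ] E) := by
      refine hc'.continuousAt.eventually_mem ?_
      refine ContinuousLinearEquiv.isOpen.mem_nhds ⟨ContinuousLinearEquiv.refl ℝ E, ?_⟩
      ext e
      simp [s, h1]
    filter_upwards [h2] with q₁ ⟨e, he⟩
    have he' : ∀ x, fderiv ℝ G (Φ q₁) (s x) = e x := fun x =>
      (congrArg (fun l : E →L[ℝ] E => l x) he).symm
    exact ⟨kerEquiv _ _ s (e.symm : E →L[ℝ] E) h1 (fun x => by simp [he'])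
      (fun x => by simp [he'])⟩
  have hlc : IsLocallyConstant P := by
    rw [IsLocallyConstant.iff_eventually_eq]
    intro q₀
    filter_upwards [hloc q₀] with q₁ ⟨e⟩
    exact propext ⟨fun ⟨d⟩ => ⟨d.trans e⟩, fun ⟨d⟩ => ⟨d.trans e.symm⟩⟩
  have h := hlc.apply_eq_of_preconnectedSpace q q'
  have h0 : P q := ⟨ContinuousLinearEquiv.refl ℝ _⟩
  rw [h] at h0
  exact h0

theorem isImmersion_of_leftInverse (hΦ : ContDiff ℝ ∞ Φ) (hU : IsOpen U)
    (hG : ContDiffOn ℝ ∞ G U) (hΦU : ∀ q, Φ q ∈ U) (hGΦ : ∀ q, G (Φ q) = q) :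
    Manifold.IsImmersion 𝓘(ℝ, E) 𝓘(ℝ, F) ∞ Φ := by
  refine ⟨(fderiv ℝ G (Φ 0)).ker, inferInstance, inferInstance, fun q => ?_⟩
  obtain ⟨e⟩ := nonempty_ker_equiv hΦ hU hG hΦU hGΦ q 0
  refine Manifold.IsImmersionAtOfComplement.trans_F ?_ e
  obtain ⟨ψ, hp, h1, h2, hr, hψ⟩ := exists_straightening hΦ hU hG hΦU hGΦ q
  set A := fderiv ℝ Φ q with hA
  set S := fderiv ℝ G (Φ q) with hS
  have hSA : ∀ e, S (A e) = e := leftInverse_fderiv_apply hΦ hU hG hΦU hGΦ q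
  -- The splitting `F = A E ⊕ ker S`. In the straightening chart `Φ` becomes the linear map `e ↦ A e
  -- = eqv (e, 0)`.
  let eqv : (E × S.ker) ≃L[ℝ] F := ContinuousLinearEquiv.equivOfInverse
    (A.coprod S.ker.subtypeL)
    (S.prod ((ContinuousLinearMap.id ℝ F - A.comp S).codRestrict S.ker fun z => by simp [hSA]))
    (fun z => by
      have hz : S (z.2 : F) = 0 := z.2.2
      ext <;> simp [hSA, hz])
    (fun z => by simp)
  refine Manifold.IsImmersionAtOfComplement.mk_of_continuousAt hΦ.continuous.continuousAt eqv
    (OpenPartialHomeomorph.refl E) ψ (mem_univ _) hp ?_ (mem_maximalAtlas_of_smooth ψ h1 h2) ?_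
  · exact mem_maximalAtlas_of_smooth _ contDiffOn_id contDiffOn_id
  · intro x _
    simp [hψ, hGΦ, eqv]

/-- A smooth map with a smooth left inverse defined near its range is a diffeomorphism onto its
range, which is an embedded submanifold. -/
theorem isDiffeoOntoSubmanifold_of_leftInverse (hΦ : ContDiff ℝ ∞ Φ) (hU : IsOpen U)
    (hG : ContDiffOn ℝ ∞ G U) (hΦU : ∀ q, Φ q ∈ U) (hGΦ : ∀ q, G (Φ q) = q) :
    IsDiffeoOntoSubmanifold Φ where
  contDiff := hΦ
  submanifold := isEmbeddedSubmanifold_range hΦ hU hG hΦU hGΦ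
  injective := Function.LeftInverse.injective hGΦ
  smooth_inverse := by
    rintro _ ⟨q, rfl⟩
    exact ⟨U, G, hU, hΦU q, hG, fun q' _ => hGΦ q'⟩
  isSmoothEmbedding := ⟨isImmersion_of_leftInverse hΦ hU hG hΦU hGΦ,
    isEmbedding_of_leftInverse hΦ.continuous hU hG.continuousOn hΦU hGΦ⟩

end LeftInverse

end DiagonalGreen

namespace DiagonalGreen

/-! ### Calculus of absolutely continuous complex functions -/

section Primitives

/-- `f` is a primitive on `s` of the locally integrable function `h`. -/
def HasPrim (s : Set ℝ) (f h : ℝ → ℂ) : Prop :=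
  ∀ a ∈ s, ∀ b ∈ s, IntervalIntegrable h volume a b ∧ ∫ x in a..b, h x = f b - f a

variable {s t : Set ℝ} {f g h e : ℝ → ℂ}

theorem HasPrim.mono (hf : HasPrim s f h) (hst : t ⊆ s) : HasPrim t f h :=
  fun a ha b hb => hf a (hst ha) b (hst hb)

theorem absolutelyContinuousOnInterval_integral {a b : ℝ} (hh : IntervalIntegrable h volume a b) :
    AbsolutelyContinuousOnInterval (fun x => ∫ t in a..x, h t) a b := by
  have hre : IntervalIntegrable (fun x => (h x).re) volume a b := ⟨hh.1.re, hh.2.re⟩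
  have him : IntervalIntegrable (fun x => (h x).im) volume a b := ⟨hh.1.im, hh.2.im⟩
  have h1 := hre.absolutelyContinuousOnInterval_intervalIntegral (c := a) (by simp)
  have h2 := him.absolutelyContinuousOnInterval_intervalIntegral (c := a) (by simp)
  have hc : ∀ z : ℂ, AbsolutelyContinuousOnInterval (fun _ : ℝ => z) a b := fun z =>
    (LipschitzWith.const z).lipschitzOnWith.absolutelyContinuousOnInterval
  have h3 := (h1.fun_smul (hc 1)).fun_add (h2.fun_smul (hc Complex.I))
  have key : ∀ x ∈ uIcc a b, (∫ t in a..x, h t)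
      = (∫ t in a..x, (h t).re) • (1 : ℂ) + (∫ t in a..x, (h t).im) • Complex.I := by
    intro x hx
    have hs : uIcc a x ⊆ uIcc a b := uIcc_subset_uIcc_left hx
    have hr : IntervalIntegrable (fun x => ((h x).re : ℂ)) volume a x :=
      ⟨(hre.mono_set hs).1.ofReal, (hre.mono_set hs).2.ofReal⟩
    have hi : IntervalIntegrable (fun x => ((h x).im : ℂ)) volume a x :=
      ⟨(him.mono_set hs).1.ofReal, (him.mono_set hs).2.ofReal⟩
    simp only [Complex.real_smul, mul_one]
    rw [← intervalIntegral.integral_ofReal, ← intervalIntegral.integral_ofReal,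
      ← intervalIntegral.integral_mul_const, ← intervalIntegral.integral_add hr (hi.mul_const _)]
    exact intervalIntegral.integral_congr fun t _ => (Complex.re_add_im (h t)).symm
  refine (h3.congr' ?_ : _)
  rw [EventuallyEq, eventually_inf_principal]
  filter_upwards with E hE
  refine Finset.sum_congr rfl fun i hi => ?_
  have := hE.1 i hi
  rw [key _ this.1, key _ this.2]

theorem HasPrim.ac [hs : s.OrdConnected] (hf : HasPrim s f h) {a b : ℝ} (ha : a ∈ s) (hb : b ∈ s) :
    AbsolutelyContinuousOnInterval f a b := by
  have h1 := absolutelyContinuousOnInterval_integral (hf a ha b hb).1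
  have h2 : AbsolutelyContinuousOnInterval (fun _ : ℝ => f a) a b :=
    (LipschitzWith.const (f a)).lipschitzOnWith.absolutelyContinuousOnInterval
  refine ((h1.fun_add h2).congr' ?_ : _)
  rw [EventuallyEq, eventually_inf_principal]
  filter_upwards with E hE
  refine Finset.sum_congr rfl fun i hi => ?_
  have := hE.1 i hi
  rw [(hf a ha _ (hs.uIcc_subset ha hb this.1)).2, (hf a ha _ (hs.uIcc_subset ha hb this.2)).2,
    sub_add_cancel, sub_add_cancel]

theorem HasPrim.ae_hasDerivAt_uIcc [hs : s.OrdConnected] (hf : HasPrim s f h) {a b : ℝ}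
    (ha : a ∈ s) (hb : b ∈ s) : ∀ᵐ x, x ∈ uIcc a b → HasDerivAt f (h x) x := by
  have hae : ∀ c : ℝ, ∀ᵐ x : ℝ, x ≠ c := fun c => by
    simp [ae_iff]
  filter_upwards [(hf a ha b hb).1.ae_hasDerivAt_integral, hae a, hae b] with x hx hxa hxb hxab
  have h1 := (hx hxab a left_mem_uIcc).add_const (f a)
  refine h1.congr_of_eventuallyEq ?_
  have hmem : uIcc a b ∈ 𝓝 x := by
    refine Icc_mem_nhds (lt_of_le_of_ne hxab.1 ?_) (lt_of_le_of_ne hxab.2 ?_)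
    · rcases min_choice a b with h | h <;> rw [h] <;> [exact hxa.symm; exact hxb.symm]
    · rcases max_choice a b with h | h <;> rw [h] <;> [exact hxa; exact hxb]
  filter_upwards [hmem] with y hy
  rw [(hf a ha y (hs.uIcc_subset ha hb hy)).2]
  ring

/-- A property which holds almost everywhere on every compact interval with end points in `s` holds
almost everywhere on `s`. -/
theorem ae_of_forall_uIcc {p : ℝ → Prop}
    (h : ∀ a ∈ s, ∀ b ∈ s, ∀ᵐ x, x ∈ uIcc a b → p x) : ∀ᵐ x, x ∈ s → p x := by
  rw [ae_iff]
  have hset : {x | ¬(x ∈ s → p x)} = {x | x ∈ s ∧ ¬p x} := by ext x; simp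
  rw [hset]
  refine measure_null_of_locally_null _ fun x hx => ?_
  -- A left end point `a` such that the points of `s` near `x` are at least `a`. If `s` has no point
  -- on the left of `x`, then `x` itself serves.
  have ha : ∃ a ∈ s, a ≤ x ∧ ∀ᶠ y in 𝓝[s] x, a ≤ y := by
    by_cases hL : ∃ a ∈ s, a < x
    · obtain ⟨a, has, hax⟩ := hL
      exact ⟨a, has, hax.le, nhdsWithin_le_nhds (eventually_ge_nhds hax)⟩
    · push Not at hL
      exact ⟨x, hx.1, le_rfl, eventually_mem_nhdsWithin.mono hL⟩
  have hb : ∃ b ∈ s, x ≤ b ∧ ∀ᶠ y in 𝓝[s] x, y ≤ b := by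
    by_cases hL : ∃ b ∈ s, x < b
    · obtain ⟨b, hbs, hxb⟩ := hL
      exact ⟨b, hbs, hxb.le, nhdsWithin_le_nhds (eventually_le_nhds hxb)⟩
    · push Not at hL
      exact ⟨x, hx.1, le_rfl, eventually_mem_nhdsWithin.mono hL⟩
  obtain ⟨a, has, hax, ha⟩ := ha
  obtain ⟨b, hbs, hxb, hb⟩ := hb
  refine ⟨{y | ¬(y ∈ uIcc a b → p y)}, ?_, h a has b hbs⟩
  have hsub : {x | x ∈ s ∧ ¬p x} ⊆ s := fun y hy => hy.1
  filter_upwards [nhdsWithin_mono x hsub ha, nhdsWithin_mono x hsub hb, self_mem_nhdsWithin]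
    with y h1 h2 h3
  rw [uIcc_of_le (hax.trans hxb)]
  exact fun h4 => h3.2 (h4 ⟨h1, h2⟩)

theorem HasPrim.ae_hasDerivAt [hs : s.OrdConnected] (hf : HasPrim s f h) :
    ∀ᵐ x, x ∈ s → HasDerivAt f (h x) x :=
  ae_of_forall_uIcc fun _ ha _ hb => hf.ae_hasDerivAt_uIcc ha hb

/-- The difference of `f` and the integral of `h` is absolutely continuous with derivative zero
almost everywhere, hence constant. The product and reciprocal rules reduce to this: absolute
continuity is stable, and the derivative is computed pointwise. -/
theorem HasPrim.of_ac [hs : s.OrdConnected]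
    (hac : ∀ a ∈ s, ∀ b ∈ s, AbsolutelyContinuousOnInterval f a b)
    (hi : ∀ a ∈ s, ∀ b ∈ s, IntervalIntegrable h volume a b)
    (hd : ∀ᵐ x, x ∈ s → HasDerivAt f (h x) x) : HasPrim s f h := by
  intro a ha b hb
  refine ⟨hi a ha b hb, ?_⟩
  have h1 := (hac a ha b hb).fun_sub (absolutelyContinuousOnInterval_integral (hi a ha b hb))
  have h2 : HasPrim (uIcc a b) (fun x => ∫ t in a..x, h t) h := by
    intro c hc d hd
    have hc' := hs.uIcc_subset ha hb hc
    have hd' := hs.uIcc_subset ha hb hd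
    exact ⟨hi c hc' d hd', (intervalIntegral.integral_interval_sub_left (hi a ha d hd')
      (hi a ha c hc')).symm⟩
  have h3 : ∀ᵐ x, x ∈ uIcc a b → HasDerivAt (fun x => f x - ∫ t in a..x, h t) 0 x := by
    filter_upwards [hd, h2.ae_hasDerivAt] with x hx1 hx2 hx
    simpa using (hx1 (hs.uIcc_subset ha hb hx)).fun_sub (hx2 hx)
  obtain ⟨C, hC⟩ := h1.const_of_ae_hasDerivAt_zero h3
  have h4 := hC a left_mem_uIcc
  have h5 := hC b right_mem_uIcc
  simp only [intervalIntegral.integral_same, sub_zero] at h4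
  rw [h4, ← h5]
  ring

theorem HasPrim.congr [hs : s.OrdConnected] (hf : HasPrim s f h) (hfg : EqOn g f s)
    (hhe : ∀ᵐ x, x ∈ s → e x = h x) : HasPrim s g e := by
  intro a ha b hb
  have h1 : ∀ᵐ x, x ∈ uIoc a b → h x = e x := by
    filter_upwards [hhe] with x hx hxab
    exact (hx (hs.uIcc_subset ha hb (uIoc_subset_uIcc hxab))).symm
  refine ⟨(hf a ha b hb).1.congr_ae ((ae_restrict_iff' measurableSet_uIoc).2 h1), ?_⟩
  rw [← intervalIntegral.integral_congr_ae h1, (hf a ha b hb).2, hfg ha, hfg hb]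

theorem HasPrim.const (c : ℂ) : HasPrim s (fun _ => c) (fun _ => 0) :=
  fun _ _ _ _ => ⟨intervalIntegrable_const, by simp⟩

theorem HasPrim.add (hf : HasPrim s f h) (hg : HasPrim s g e) :
    HasPrim s (fun x => f x + g x) (fun x => h x + e x) := by
  intro a ha b hb
  refine ⟨(hf a ha b hb).1.add (hg a ha b hb).1, ?_⟩
  rw [intervalIntegral.integral_add (hf a ha b hb).1 (hg a ha b hb).1, (hf a ha b hb).2,
    (hg a ha b hb).2]
  ring

theorem HasPrim.const_mul (c : ℂ) (hf : HasPrim s f h) :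
    HasPrim s (fun x => c * f x) (fun x => c * h x) := by
  intro a ha b hb
  refine ⟨(hf a ha b hb).1.const_mul c, ?_⟩
  rw [intervalIntegral.integral_const_mul, (hf a ha b hb).2]
  ring

theorem HasPrim.continuousOn_uIcc [hs : s.OrdConnected] (hf : HasPrim s f h) {a b : ℝ}
    (ha : a ∈ s) (hb : b ∈ s) : ContinuousOn f (uIcc a b) :=
  (hf.ac ha hb).continuousOn

theorem HasPrim.mul [hs : s.OrdConnected] (hf : HasPrim s f h) (hg : HasPrim s g e) :
    HasPrim s (fun x => f x * g x) (fun x => h x * g x + f x * e x) := by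
  refine .of_ac (fun a ha b hb => (hf.ac ha hb).fun_smul (hg.ac ha hb)) (fun a ha b hb => ?_) ?_
  · exact ((hf a ha b hb).1.mul_continuousOn (hg.continuousOn_uIcc ha hb)).add
      ((hg a ha b hb).1.continuousOn_mul (hf.continuousOn_uIcc ha hb))
  · filter_upwards [hf.ae_hasDerivAt, hg.ae_hasDerivAt] with x h1 h2 hx
    exact (h1 hx).mul (h2 hx)

theorem absolutelyContinuousOnInterval_inv {a b : ℝ} (hf : AbsolutelyContinuousOnInterval f a b)
    (h0 : ∀ x ∈ uIcc a b, f x ≠ 0) : AbsolutelyContinuousOnInterval (fun x => (f x)⁻¹) a b := by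
  obtain ⟨C, hC⟩ := isCompact_uIcc.exists_bound_of_continuousOn (hf.continuousOn.inv₀ h0)
  unfold AbsolutelyContinuousOnInterval at hf ⊢
  refine squeeze_zero' (.of_forall fun _ => Finset.sum_nonneg fun _ _ => dist_nonneg) ?_
    (by simpa using hf.const_mul (C * C))
  rw [eventually_inf_principal]
  filter_upwards with E hE
  rw [Finset.mul_sum]
  refine Finset.sum_le_sum fun i hi => ?_
  have h1 := (hE.1 i hi).1
  have h2 := (hE.1 i hi).2
  have hx := h0 _ h1
  have hy := h0 _ h2
  have h3 : (f (E.2 i).1)⁻¹ - (f (E.2 i).2)⁻¹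
      = -((f (E.2 i).1)⁻¹ * (f (E.2 i).2)⁻¹ * (f (E.2 i).1 - f (E.2 i).2)) := by
    field_simp; ring
  rw [dist_eq_norm, dist_eq_norm, h3, norm_neg, norm_mul, norm_mul]
  have h4 : ‖(f (E.2 i).1)⁻¹‖ ≤ C := hC _ h1
  have h5 : ‖(f (E.2 i).2)⁻¹‖ ≤ C := hC _ h2
  gcongr
  exact (norm_nonneg _).trans h4

theorem HasPrim.inv [hs : s.OrdConnected] (hf : HasPrim s f h) (h0 : ∀ x ∈ s, f x ≠ 0) :
    HasPrim s (fun x => (f x)⁻¹) (fun x => -h x / f x ^ 2) := by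
  refine .of_ac (fun a ha b hb => absolutelyContinuousOnInterval_inv (hf.ac ha hb)
    fun x hx => h0 x (hs.uIcc_subset ha hb hx)) (fun a ha b hb => ?_) ?_
  · simp only [div_eq_mul_inv]
    refine (hf a ha b hb).1.neg.mul_continuousOn ?_
    exact ((hf.continuousOn_uIcc ha hb).pow 2).inv₀ fun x hx =>
      pow_ne_zero 2 (h0 x (hs.uIcc_subset ha hb hx))
  · filter_upwards [hf.ae_hasDerivAt] with x h1 hx
    exact (h1 hx).fun_inv (h0 x hx)

theorem HasPrim.of_hasDerivAt (hd : ∀ x, HasDerivAt f (h x) x) (hh : Continuous h) :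
    HasPrim s f h := fun a _ b _ =>
  ⟨hh.intervalIntegrable a b, intervalIntegral.integral_eq_sub_of_hasDerivAt (fun x _ => hd x)
    (hh.intervalIntegrable a b)⟩

/-- A locally integrable function all of whose integrals vanish is zero almost everywhere. -/
theorem ae_eq_zero_of_integral_eq_zero [hs : s.OrdConnected]
    (hi : ∀ a ∈ s, ∀ b ∈ s, IntervalIntegrable h volume a b)
    (h0 : ∀ a ∈ s, ∀ b ∈ s, a ≤ b → ∫ x in a..b, h x = 0) : ∀ᵐ x, x ∈ s → h x = 0 := by
  have h1 : HasPrim s (fun _ => 0) h := fun a ha b hb => ⟨hi a ha b hb, by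
    rcases le_total a b with hab | hab
    · simp [h0 a ha b hb hab]
    · rw [intervalIntegral.integral_symm, h0 b hb a ha hab]; simp⟩
  filter_upwards [h1.ae_hasDerivAt] with x hx hxs
  exact (hx hxs).unique (hasDerivAt_const x 0)

theorem MemH1.hasPrim {L : ENNReal} {f : ℝ → ℂ} (hf : MemH1 L f) : HasPrim univ f (deriv f) :=
  fun a _ b _ => ⟨hf.intervalIntegrable_deriv a b, hf.integral_deriv a b⟩

theorem HasPrim.deriv_ae (hf : HasPrim univ f h) : ∀ᵐ x, deriv f x = h x := by
  filter_upwards [hf.ae_hasDerivAt] with x hx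
  exact (hx (mem_univ x)).deriv

theorem memH1_top_of_hasPrim (hf : HasPrim univ f h) (h2 : MemLp f 2) (h3 : MemLp h 2) :
    MemH1 ⊤ f := by
  have hr : (volume : Measure ℝ).restrict (cell ⊤) = volume := by
    rw [cell_top, Measure.restrict_univ]
  exact .of_primitive h (fun h => absurd rfl h) (by rwa [hr]) (by rwa [hr])
    (fun a b => (hf a (mem_univ a) b (mem_univ b)).1)
    fun a b => (hf a (mem_univ a) b (mem_univ b)).2

end Primitives

end DiagonalGreen

namespace DiagonalGreen

/-! ### Multiplier bounds for `w` and `w'` on the line -/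

section Bounds

variable {L : ENNReal} [Fact (1 ≤ L)]

theorem integrable_mul_of_memLp_two {α : Type} {m : MeasurableSpace α} {μ : Measure α}
    {f g : α → ℂ} (hf : MemLp f 2 μ) (hg : MemLp g 2 μ) : Integrable (fun x => f x * g x) μ :=
  hf.integrable_mul hg

theorem integral_norm_mul_le_of_sq_le {α : Type} {m : MeasurableSpace α} {μ : Measure α}
    {f g : α → ℂ} (hf : MemLp f 2 μ) (hg : MemLp g 2 μ) {A B : ℝ} (hA : 0 ≤ A) (hB : 0 ≤ B)
    (hfA : ∫ x, ‖f x‖ ^ 2 ∂μ ≤ A ^ 2) (hgB : ∫ x, ‖g x‖ ^ 2 ∂μ ≤ B ^ 2) :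
    ∫ x, ‖f x * g x‖ ∂μ ≤ A * B := by
  have h := integral_mul_norm_le_Lp_mul_Lq (μ := μ) (f := f) (g := g) Real.HolderConjugate.two_two
    (by simpa using hf) (by simpa using hg)
  simp only [norm_mul]
  refine h.trans ?_
  have h1 : ∀ f : α → ℂ, (∫ a, ‖f a‖ ^ (2 : ℝ) ∂μ) ^ (1 / (2 : ℝ))
      = Real.sqrt (∫ a, ‖f a‖ ^ 2 ∂μ) := fun f => by
    rw [Real.sqrt_eq_rpow]
    simp
  rw [h1, h1]
  have h2 := Real.sqrt_le_sqrt hfA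
  have h3 := Real.sqrt_le_sqrt hgB
  rw [Real.sqrt_sq hA] at h2
  rw [Real.sqrt_sq hB] at h3
  gcongr

theorem H1.memLp_line (u : H1 ℂ ⊤) : MemLp u 2 volume := by
  have := u.mem.memLp
  rwa [cell_top, Measure.restrict_univ] at this

theorem H1.memLp_deriv_line (u : H1 ℂ ⊤) : MemLp (deriv u) 2 volume := by
  have := u.mem.memLp_deriv
  rwa [cell_top, Measure.restrict_univ] at this

theorem H1.norm_sq_line (u : H1 ℂ ⊤) :
    ‖u‖ ^ 2 = (∫ x, ‖deriv u x‖ ^ 2) + 4 * ∫ x, ‖u x‖ ^ 2 := by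
  rw [H1.norm_sq, cell_top, Measure.restrict_univ, integral_add
    (u.memLp_deriv_line.integrable_norm_pow (by norm_num))
    ((u.memLp_line.integrable_norm_pow (by norm_num)).const_mul 4), integral_const_mul]

theorem H1.integral_sq_nonneg (u : ℝ → ℂ) : 0 ≤ ∫ x, ‖u x‖ ^ 2 :=
  integral_nonneg fun _ => by positivity

theorem H1.integral_deriv_sq_le (u : H1 ℂ ⊤) : ∫ x, ‖deriv u x‖ ^ 2 ≤ ‖u‖ ^ 2 := by
  have := H1.integral_sq_nonneg u
  rw [u.norm_sq_line]; linarith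

theorem H1.integral_sq_le (u : H1 ℂ ⊤) : ∫ x, ‖u x‖ ^ 2 ≤ (‖u‖ / 2) ^ 2 := by
  have := H1.integral_sq_nonneg (deriv u)
  rw [div_pow, u.norm_sq_line]; linarith

theorem HasPrim.conj {s : Set ℝ} {f h : ℝ → ℂ} (hf : HasPrim s f h) :
    HasPrim s (fun x => (starRingEnd ℂ) (f x)) (fun x => (starRingEnd ℂ) (h x)) := by
  intro a ha b hb
  have hi := (hf a ha b hb).1
  refine ⟨?_, ?_⟩
  · rw [intervalIntegrable_iff] at hi ⊢
    exact hi.norm.mono (Complex.continuous_conj.comp_aestronglyMeasurable hi.1)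
      (.of_forall fun x => by simp)
  · rw [← map_sub, ← (hf a ha b hb).2]
    simp only [intervalIntegral, integral_conj, map_sub]

/-- The derivative of `|u|²` is at most `2 |u| |u'| ≤ ε |u'|² + ε⁻¹ |u|²`; this is integrated from
`x` to `y` and then averaged over `y` in the unit interval. The small factor before `|u'|²` is what
gives relative bound zero for the potential. -/
theorem H1.norm_sq_apply_le (u : H1 ℂ L) {ε : ℝ} (hε : 0 < ε) (x : ℝ) :
    ‖u x‖ ^ 2 ≤ ∫ y in x..(x + 1), (ε * ‖deriv u y‖ ^ 2 + (1 + ε⁻¹) * ‖u y‖ ^ 2) := by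
  have hF := u.mem.hasPrim.mul u.mem.hasPrim.conj
  set F' : ℝ → ℂ := fun x => deriv u x * (starRingEnd ℂ) (u x)
    + u x * (starRingEnd ℂ) (deriv u x) with hF'
  have hn : ∀ y, ‖F' y‖ ≤ ε * ‖deriv u y‖ ^ 2 + ε⁻¹ * ‖u y‖ ^ 2 := by
    intro y
    have h1 : ‖F' y‖ ≤ 2 * (‖deriv u y‖ * ‖u y‖) := by
      refine (norm_add_le _ _).trans_eq ?_
      simp only [norm_mul, RCLike.norm_conj]; ring
    have h2 : 0 ≤ (ε * ‖deriv u y‖ - ‖u y‖) ^ 2 * ε⁻¹ := by positivity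
    have h3 : (ε * ‖deriv u y‖ - ‖u y‖) ^ 2 * ε⁻¹
        = ε * ‖deriv u y‖ ^ 2 + ε⁻¹ * ‖u y‖ ^ 2 - 2 * (‖deriv u y‖ * ‖u y‖) := by
      field_simp; ring
    linarith
  have hd2 := u.intervalIntegrable_deriv_sq x (x + 1)
  have hu2 : IntervalIntegrable (fun y => ‖u y‖ ^ 2) volume x (x + 1) :=
    (u.mem.continuous.norm.pow 2).intervalIntegrable _ _
  set D : ℝ := ∫ y in x..(x + 1), (ε * ‖deriv u y‖ ^ 2 + ε⁻¹ * ‖u y‖ ^ 2) with hD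
  have hpt : ∀ y ∈ Icc x (x + 1), ‖u x‖ ^ 2 ≤ ‖u y‖ ^ 2 + D := by
    intro y hy
    have h1 := (hF x (mem_univ x) y (mem_univ y)).2
    have h2 : ‖u x‖ ^ 2 = ‖u x * (starRingEnd ℂ) (u x)‖ := by
      rw [norm_mul, RCLike.norm_conj, sq]
    have h3 : ‖u y‖ ^ 2 = ‖u y * (starRingEnd ℂ) (u y)‖ := by
      rw [norm_mul, RCLike.norm_conj, sq]
    have h4 : ‖∫ t in x..y, F' t‖ ≤ D := by
      refine (intervalIntegral.norm_integral_le_integral_norm hy.1).trans ?_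
      refine (intervalIntegral.integral_mono_interval le_rfl hy.1 hy.2
        (.of_forall fun t => norm_nonneg _)
        (hF x (mem_univ _) (x + 1) (mem_univ _)).1.norm).trans ?_
      exact intervalIntegral.integral_mono_on (by linarith)
        (hF x (mem_univ _) (x + 1) (mem_univ _)).1.norm
        ((hd2.const_mul _).add (hu2.const_mul _)) fun t _ => hn t
    rw [h1] at h4
    have h5 := norm_sub_norm_le (u x * (starRingEnd ℂ) (u x)) (u y * (starRingEnd ℂ) (u y))
    rw [norm_sub_rev] at h5
    rw [h2, h3]
    linarith
  have hm : ∫ _ in x..(x + 1), ‖u x‖ ^ 2 ≤ ∫ y in x..(x + 1), (‖u y‖ ^ 2 + D) :=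
    intervalIntegral.integral_mono_on (by linarith) intervalIntegrable_const
      (hu2.add intervalIntegrable_const) hpt
  rw [intervalIntegral.integral_const, intervalIntegral.integral_add hu2 intervalIntegrable_const,
    intervalIntegral.integral_const, hD, intervalIntegral.integral_add (hd2.const_mul _)
    (hu2.const_mul _)] at hm
  rw [intervalIntegral.integral_add (hd2.const_mul _) (hu2.const_mul _)]
  simp only [intervalIntegral.integral_const_mul, add_sub_cancel_left, one_smul] at hm ⊢
  linarith

/-- A periodic `w` is not square integrable on the line, but its energy on unit intervals is
controlled. This uses `1 ≤ L`: a unit interval fits into a period. -/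
theorem H1.lintegral_deriv_unit_le (w : H1 ℝ L) (y : ℝ) :
    ∫⁻ x in Ioc y (y + 1), ENNReal.ofReal (‖deriv w x‖ ^ 2) ≤ ENNReal.ofReal (‖w‖ ^ 2) := by
  have h2 := w.intervalIntegrable_deriv_sq y (y + 1)
  have h1 : ∫ x in y..(y + 1), ‖deriv w x‖ ^ 2 ≤ ‖w‖ ^ 2 := by
    refine le_trans ?_ (w.integral_unit_le y)
    exact intervalIntegral.integral_mono_on (by linarith) h2 (w.intervalIntegrable_energy _ _)
      fun x _ => by have := sq_nonneg ‖w x‖; linarith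
  rw [intervalIntegrable_iff_integrableOn_Ioc_of_le (by linarith)] at h2
  rw [← ofReal_integral_eq_lintegral_ofReal h2 (.of_forall fun _ => by positivity),
    ← intervalIntegral.integral_of_le (by linarith)]
  exact ENNReal.ofReal_le_ofReal h1

/-- The derivative of a uniformly locally `H¹` function is form bounded with respect to `∂²`, with
relative bound zero. -/
theorem lintegral_deriv_mul_le (w : H1 ℝ L) (u : H1 ℂ ⊤) {ε : ℝ} (hε : 0 < ε) :
    ∫⁻ x, ENNReal.ofReal (‖((deriv w x : ℝ) : ℂ) * u x‖ ^ 2)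
      ≤ ENNReal.ofReal (‖w‖ ^ 2 * (ε * (∫ x, ‖deriv u x‖ ^ 2) + (1 + ε⁻¹) * ∫ x, ‖u x‖ ^ 2)) := by
  set K : ℝ → ℝ := fun y => ε * ‖deriv u y‖ ^ 2 + (1 + ε⁻¹) * ‖u y‖ ^ 2 with hK
  have hK0 : ∀ y, 0 ≤ K y := fun y => by positivity
  have hd2 : Integrable (fun y => ‖deriv u y‖ ^ 2) :=
    u.memLp_deriv_line.integrable_norm_pow (by norm_num)
  have hu2 : Integrable (fun y => ‖u y‖ ^ 2) := u.memLp_line.integrable_norm_pow (by norm_num)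
  have hKi : Integrable K := (hd2.const_mul _).add (hu2.const_mul _)
  have hKm : Measurable fun y => ENNReal.ofReal (K y) := by
    have h1 : Measurable (deriv u) := measurable_deriv _
    have h2 : Measurable u := u.mem.continuous.measurable
    fun_prop
  have hwm : Measurable fun x => ENNReal.ofReal (‖deriv w x‖ ^ 2) := by
    have h1 : Measurable (deriv w) := measurable_deriv _
    fun_prop
  have hpt : ∀ x, ENNReal.ofReal (‖u x‖ ^ 2) ≤ ∫⁻ y in Ioc x (x + 1), ENNReal.ofReal (K y) := by
    intro x
    rw [← ofReal_integral_eq_lintegral_ofReal hKi.integrableOn (.of_forall hK0),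
      ← intervalIntegral.integral_of_le (by linarith)]
    exact ENNReal.ofReal_le_ofReal (u.norm_sq_apply_le hε x)
  calc ∫⁻ x, ENNReal.ofReal (‖((deriv w x : ℝ) : ℂ) * u x‖ ^ 2)
      = ∫⁻ x, ENNReal.ofReal (‖deriv w x‖ ^ 2) * ENNReal.ofReal (‖u x‖ ^ 2) := by
        refine lintegral_congr fun x => ?_
        rw [norm_mul, mul_pow, ENNReal.ofReal_mul (by positivity), Complex.norm_real]
    _ ≤ ∫⁻ x, ENNReal.ofReal (‖deriv w x‖ ^ 2) *
          ∫⁻ y, (Ioc x (x + 1)).indicator (fun y => ENNReal.ofReal (K y)) y := by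
        refine lintegral_mono fun x => ?_
        rw [lintegral_indicator measurableSet_Ioc]
        gcongr
        exact hpt x
    -- The condition `y ∈ (x, x + 1]` is rewritten as `x ∈ [y - 1, y)`. After Tonelli the inner
    -- integral is the energy of `w` on a unit interval, and the norm of `w` factors out.
    _ = ∫⁻ x, ∫⁻ y, ENNReal.ofReal (K y) *
          (Ico (y - 1) y).indicator (fun x => ENNReal.ofReal (‖deriv w x‖ ^ 2)) x := by
        refine lintegral_congr fun x => ?_
        rw [← lintegral_const_mul _ (hKm.indicator measurableSet_Ioc)]
        refine lintegral_congr fun y => ?_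
        by_cases hxy : y ∈ Ioc x (x + 1)
        · have : x ∈ Ico (y - 1) y := ⟨by linarith [hxy.2], hxy.1⟩
          rw [indicator_of_mem hxy, indicator_of_mem this, mul_comm]
        · have : x ∉ Ico (y - 1) y := fun h => hxy ⟨h.2, by linarith [h.1]⟩
          rw [indicator_of_notMem hxy, indicator_of_notMem this, mul_zero, mul_zero]
    _ = ∫⁻ y, ∫⁻ x, ENNReal.ofReal (K y) *
          (Ico (y - 1) y).indicator (fun x => ENNReal.ofReal (‖deriv w x‖ ^ 2)) x := by
        refine lintegral_lintegral_swap (Measurable.aemeasurable ?_)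
        have hS : MeasurableSet {p : ℝ × ℝ | p.2 - 1 ≤ p.1 ∧ p.1 < p.2} :=
          MeasurableSet.inter (s₁ := {p : ℝ × ℝ | p.2 - 1 ≤ p.1})
            (measurableSet_le (measurable_snd.sub_const 1) measurable_fst)
            (measurableSet_lt measurable_fst measurable_snd)
        have := ((hKm.comp measurable_snd).mul (hwm.comp measurable_fst)).indicator hS
        convert this using 1
        ext ⟨x, y⟩
        by_cases hxy : x ∈ Ico (y - 1) y
        · have h2 : (x, y) ∈ {p : ℝ × ℝ | p.2 - 1 ≤ p.1 ∧ p.1 < p.2} := hxy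
          simp only [Function.uncurry, indicator_of_mem hxy, indicator_of_mem h2]; rfl
        · have h2 : (x, y) ∉ {p : ℝ × ℝ | p.2 - 1 ≤ p.1 ∧ p.1 < p.2} := hxy
          simp only [Function.uncurry, indicator_of_notMem hxy, indicator_of_notMem h2, mul_zero]
    _ ≤ ∫⁻ y, ENNReal.ofReal (K y) * ENNReal.ofReal (‖w‖ ^ 2) := by
        refine lintegral_mono fun y => ?_
        rw [lintegral_const_mul _ (hwm.indicator measurableSet_Ico),
          lintegral_indicator measurableSet_Ico]
        gcongr
        have := w.lintegral_deriv_unit_le (y - 1)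
        rw [sub_add_cancel] at this
        rwa [setLIntegral_congr Ico_ae_eq_Ioc]
    _ = _ := by
        rw [lintegral_mul_const _ hKm, ← ofReal_integral_eq_lintegral_ofReal hKi (.of_forall hK0),
          mul_comm, ← ENNReal.ofReal_mul (by positivity), integral_add (hd2.const_mul _)
          (hu2.const_mul _), integral_const_mul, integral_const_mul]

theorem memLp_deriv_mul (w : H1 ℝ L) (u : H1 ℂ ⊤) :
    MemLp (fun x => ((deriv w x : ℝ) : ℂ) * u x) 2 volume := by
  have hm : AEStronglyMeasurable (fun x => ((deriv w x : ℝ) : ℂ) * u x) volume := by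
    have h1 : Measurable (deriv w) := measurable_deriv _
    have h2 : Measurable u := u.mem.continuous.measurable
    exact (by fun_prop : Measurable fun x => ((deriv w x : ℝ) : ℂ) * u x).aestronglyMeasurable
  rw [memLp_two_iff_integrable_sq_norm hm]
  refine ⟨(hm.norm.pow 2), ?_⟩
  rw [hasFiniteIntegral_iff_ofReal (.of_forall fun _ => by positivity)]
  exact (lintegral_deriv_mul_le w u one_pos).trans_lt ENNReal.ofReal_lt_top

theorem integral_deriv_mul_sq_le (w : H1 ℝ L) (u : H1 ℂ ⊤) {ε : ℝ} (hε : 0 < ε) :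
    ∫ x, ‖((deriv w x : ℝ) : ℂ) * u x‖ ^ 2
      ≤ ‖w‖ ^ 2 * (ε * (∫ x, ‖deriv u x‖ ^ 2) + (1 + ε⁻¹) * ∫ x, ‖u x‖ ^ 2) := by
  have h1 := H1.integral_sq_nonneg u
  have h2 := H1.integral_sq_nonneg (deriv u)
  rw [← ENNReal.ofReal_le_ofReal_iff (by positivity), ofReal_integral_eq_lintegral_ofReal
    ((memLp_deriv_mul w u).integrable_norm_pow (by norm_num)) (.of_forall fun _ => by positivity)]
  exact lintegral_deriv_mul_le w u hε

theorem integral_deriv_mul_sq_le_norm (w : H1 ℝ L) (u : H1 ℂ ⊤) :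
    ∫ x, ‖((deriv w x : ℝ) : ℂ) * u x‖ ^ 2 ≤ (‖w‖ * ‖u‖) ^ 2 := by
  refine (integral_deriv_mul_sq_le w u one_pos).trans ?_
  have h1 := H1.integral_sq_nonneg u
  rw [mul_pow, u.norm_sq_line]
  gcongr
  · linarith
  · norm_num

theorem H1.memLp_ofReal_mul (w : H1 ℝ L) (u : H1 ℂ ⊤) :
    MemLp (fun x => ((w x : ℝ) : ℂ) * u x) 2 volume := by
  refine MemLp.of_le_mul (c := 2 * ‖w‖) u.memLp_line ?_ (.of_forall fun x => ?_)
  · exact ((Complex.continuous_ofReal.comp w.mem.continuous).mul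
      u.mem.continuous).aestronglyMeasurable
  · rw [norm_mul, Complex.norm_real]
    gcongr
    exact w.norm_apply_le x

end Bounds

end DiagonalGreen

namespace DiagonalGreen

/-- A shortcut, for the sake of instance search. -/
@[reducible] def H1.normedSpace {𝕜 : Type} [RCLike 𝕜] {L : ENNReal} [Fact (1 ≤ L)] :
    NormedSpace 𝕜 (H1 𝕜 L) := InnerProductSpace.toNormedSpace

/-! ### The form of `H_q + k²`, its coercivity and the resolvent -/

section Resolvent

attribute [local instance] H1.normedSpace

variable {L : ENNReal} [Fact (1 ≤ L)]

theorem H1.deriv_add_ae' (f g : H1 ℂ ⊤) :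
    ∀ᵐ x, deriv (f + g : H1 ℂ ⊤) x = deriv f x + deriv g x :=
  deriv_add_ae f.mem g.mem

theorem H1.deriv_smul_ae' (c : ℂ) (f : H1 ℂ ⊤) :
    ∀ᵐ x, deriv (c • f : H1 ℂ ⊤) x = c * deriv f x :=
  deriv_smul_ae c f.mem

/-- The integrand of the pairing of the potential `4 w - w''` with the product `u φ`. -/
def potentialDensity (w : H1 ℝ L) (u φ : H1 ℂ ⊤) (x : ℝ) : ℂ :=
  4 * ((w x : ℝ) : ℂ) * (u x * φ x)
    + ((deriv w x : ℝ) : ℂ) * (deriv u x * φ x + u x * deriv φ x)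

theorem potentialDensity_eq (w : H1 ℝ L) (u φ : H1 ℂ ⊤) (x : ℝ) :
    potentialDensity w u φ x = 4 * (((w x : ℝ) : ℂ) * u x * φ x)
      + (((deriv w x : ℝ) : ℂ) * φ x * deriv u x + ((deriv w x : ℝ) : ℂ) * u x * deriv φ x) := by
  rw [potentialDensity]; ring

theorem integrable_potentialDensity (w : H1 ℝ L) (u φ : H1 ℂ ⊤) :
    Integrable (potentialDensity w u φ) := by
  have h1 := integrable_mul_of_memLp_two (H1.memLp_ofReal_mul w u) φ.memLp_line
  have h2 := integrable_mul_of_memLp_two (memLp_deriv_mul w φ) u.memLp_deriv_line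
  have h3 := integrable_mul_of_memLp_two (memLp_deriv_mul w u) φ.memLp_deriv_line
  exact ((h1.const_mul 4).add (h2.add h3)).congr
    (.of_forall fun x => (potentialDensity_eq w u φ x).symm)

theorem H1.integral_norm_mul_le (u φ : H1 ℂ ⊤) :
    ∫ x, ‖u x * φ x‖ ≤ (‖u‖ / 2) * (‖φ‖ / 2) :=
  integral_norm_mul_le_of_sq_le u.memLp_line φ.memLp_line (by positivity) (by positivity)
    u.integral_sq_le φ.integral_sq_le

theorem H1.integral_norm_deriv_mul_le (u φ : H1 ℂ ⊤) :
    ∫ x, ‖deriv u x * deriv φ x‖ ≤ ‖u‖ * ‖φ‖ :=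
  integral_norm_mul_le_of_sq_le u.memLp_deriv_line φ.memLp_deriv_line (by positivity)
    (by positivity) u.integral_deriv_sq_le φ.integral_deriv_sq_le

theorem norm_integral_potentialDensity_le (w : H1 ℝ L) (u φ : H1 ℂ ⊤) :
    ‖∫ x, potentialDensity w u φ x‖ ≤ 4 * ‖w‖ * ‖u‖ * ‖φ‖ := by
  have i1 := integrable_mul_of_memLp_two u.memLp_line φ.memLp_line
  have i2 := integrable_mul_of_memLp_two (memLp_deriv_mul w φ) u.memLp_deriv_line
  have i3 := integrable_mul_of_memLp_two (memLp_deriv_mul w u) φ.memLp_deriv_line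
  have h2 := integral_norm_mul_le_of_sq_le (memLp_deriv_mul w φ) u.memLp_deriv_line
    (by positivity) (by positivity) (integral_deriv_mul_sq_le_norm w φ) u.integral_deriv_sq_le
  have h3 := integral_norm_mul_le_of_sq_le (memLp_deriv_mul w u) φ.memLp_deriv_line
    (by positivity) (by positivity) (integral_deriv_mul_sq_le_norm w u) φ.integral_deriv_sq_le
  have h1 := u.integral_norm_mul_le φ
  -- The factor `8 ‖w‖` is `4` times the supremum bound `2 ‖w‖`.
  calc ‖∫ x, potentialDensity w u φ x‖
      ≤ ∫ x, (8 * ‖w‖ * ‖u x * φ x‖ + (‖((deriv w x : ℝ) : ℂ) * φ x * deriv u x‖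
          + ‖((deriv w x : ℝ) : ℂ) * u x * deriv φ x‖)) := by
        refine norm_integral_le_of_norm_le ((i1.norm.const_mul _).add (i2.norm.add i3.norm))
          (.of_forall fun x => ?_)
        rw [potentialDensity_eq]
        refine (norm_add_le _ _).trans (add_le_add ?_ (norm_add_le _ _))
        have h4 := w.norm_apply_le x
        rw [mul_assoc, norm_mul, norm_mul, Complex.norm_real, Complex.norm_ofNat]
        have h5 := norm_nonneg (u x * φ x)
        nlinarith
    _ ≤ 8 * ‖w‖ * ((‖u‖ / 2) * (‖φ‖ / 2)) + ((‖w‖ * ‖φ‖) * ‖u‖ + (‖w‖ * ‖u‖) * ‖φ‖) := by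
        rw [integral_add (i1.norm.const_mul _) (by exact i2.norm.add i3.norm),
          integral_add i2.norm i3.norm, integral_const_mul]
        gcongr
    _ = 4 * ‖w‖ * ‖u‖ * ‖φ‖ := by ring

theorem potentialDensity_add_left_ae (w : H1 ℝ L) (u v φ : H1 ℂ ⊤) :
    ∀ᵐ x, potentialDensity w (u + v) φ x = potentialDensity w u φ x + potentialDensity w v φ x := by
  filter_upwards [u.deriv_add_ae' v] with x hx
  simp only [potentialDensity, H1.coe_add, Pi.add_apply] at hx ⊢
  rw [hx]; ring

theorem potentialDensity_smul_left_ae (w : H1 ℝ L) (c : ℂ) (u φ : H1 ℂ ⊤) :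
    ∀ᵐ x, potentialDensity w (c • u) φ x = c * potentialDensity w u φ x := by
  filter_upwards [u.deriv_smul_ae' c] with x hx
  simp only [potentialDensity, H1.coe_smul, Pi.smul_apply, smul_eq_mul] at hx ⊢
  rw [hx]; ring

theorem potentialDensity_comm (w : H1 ℝ L) (u φ : H1 ℂ ⊤) :
    potentialDensity w u φ = potentialDensity w φ u := by
  ext x; simp only [potentialDensity]; ring

/-- The form `∫ q u φ` for `q = 4 w - w''`. -/
def potentialForm (w : H1 ℝ L) : H1 ℂ ⊤ →L[ℂ] H1 ℂ ⊤ →L[ℂ] ℂ :=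
  LinearMap.mkContinuous₂ (LinearMap.mk₂ ℂ (fun u φ => ∫ x, potentialDensity w u φ x)
    (fun u v φ => by
      rw [integral_congr_ae (potentialDensity_add_left_ae w u v φ),
        integral_add (integrable_potentialDensity w u φ) (integrable_potentialDensity w v φ)])
    (fun c u φ => by
      rw [integral_congr_ae (potentialDensity_smul_left_ae w c u φ), integral_const_mul,
        smul_eq_mul])
    (fun φ u v => by
      simp only [potentialDensity_comm w φ]
      rw [integral_congr_ae (potentialDensity_add_left_ae w u v φ),
        integral_add (integrable_potentialDensity w u φ) (integrable_potentialDensity w v φ)])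
    (fun c φ u => by
      simp only [potentialDensity_comm w φ]
      rw [integral_congr_ae (potentialDensity_smul_left_ae w c u φ), integral_const_mul,
        smul_eq_mul])) (4 * ‖w‖) (norm_integral_potentialDensity_le w)

theorem potentialForm_apply (w : H1 ℝ L) (u φ : H1 ℂ ⊤) :
    potentialForm w u φ = ∫ x, potentialDensity w u φ x := rfl

/-- The potential form depends linearly and continuously on the potential. -/
def potentialFormL (L : ENNReal) [Fact (1 ≤ L)] :
    H1 ℝ L →L[ℝ] (H1 ℂ ⊤ →L[ℂ] StrongDual ℂ (H1 ℂ ⊤)) :=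
  LinearMap.mkContinuous
    { toFun := potentialForm
      map_add' := fun v w => by
        ext u φ
        simp only [add_apply, potentialForm_apply]
        rw [← integral_add (integrable_potentialDensity v u φ) (integrable_potentialDensity w u φ)]
        refine integral_congr_ae ?_
        filter_upwards [deriv_add_ae v.mem w.mem] with x hx
        simp only [potentialDensity, H1.coe_add, Pi.add_apply, hx]
        push_cast; ring
      map_smul' := fun c w => by
        ext u φ
        simp only [smul_apply, potentialForm_apply, RingHom.id_apply]
        rw [← integral_smul]
        refine integral_congr_ae ?_
        filter_upwards [deriv_smul_ae c w.mem] with x hx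
        simp only [potentialDensity, H1.coe_smul, Pi.smul_apply, hx, Complex.real_smul, smul_eq_mul]
        push_cast; ring } 4 fun w =>
    LinearMap.mkContinuous₂_norm_le _ (by positivity) (norm_integral_potentialDensity_le w)

/-- The form `∫ u' φ' + k² u φ`. -/
def freeForm (k : ℂ) : H1 ℂ ⊤ →L[ℂ] H1 ℂ ⊤ →L[ℂ] ℂ :=
  LinearMap.mkContinuous₂ (LinearMap.mk₂ ℂ
    (fun u φ => (∫ x, deriv u x * deriv φ x) + k ^ 2 * ∫ x, u x * φ x)
    (fun u v φ => by
      have h1 : ∫ x, deriv (u + v : H1 ℂ ⊤) x * deriv φ x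
          = ∫ x, (deriv u x * deriv φ x + deriv v x * deriv φ x) := by
        refine integral_congr_ae ?_
        filter_upwards [u.deriv_add_ae' v] with x hx
        rw [hx]; ring
      rw [h1, integral_add (integrable_mul_of_memLp_two u.memLp_deriv_line φ.memLp_deriv_line)
        (integrable_mul_of_memLp_two v.memLp_deriv_line φ.memLp_deriv_line)]
      simp only [H1.coe_add, Pi.add_apply, add_mul]
      rw [integral_add (integrable_mul_of_memLp_two u.memLp_line φ.memLp_line)
        (integrable_mul_of_memLp_two v.memLp_line φ.memLp_line)]
      ring)
    (fun c u φ => by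
      have h1 : ∫ x, deriv (c • u : H1 ℂ ⊤) x * deriv φ x
          = ∫ x, c * (deriv u x * deriv φ x) := by
        refine integral_congr_ae ?_
        filter_upwards [u.deriv_smul_ae' c] with x hx
        rw [hx]; ring
      rw [h1]
      simp only [H1.coe_smul, Pi.smul_apply, smul_eq_mul, mul_assoc, integral_const_mul]
      ring)
    (fun φ u v => by
      have h1 : ∫ x, deriv φ x * deriv (u + v : H1 ℂ ⊤) x
          = ∫ x, (deriv φ x * deriv u x + deriv φ x * deriv v x) := by
        refine integral_congr_ae ?_
        filter_upwards [u.deriv_add_ae' v] with x hx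
        rw [hx]; ring
      rw [h1, integral_add (integrable_mul_of_memLp_two φ.memLp_deriv_line u.memLp_deriv_line)
        (integrable_mul_of_memLp_two φ.memLp_deriv_line v.memLp_deriv_line)]
      simp only [H1.coe_add, Pi.add_apply, mul_add]
      rw [integral_add (integrable_mul_of_memLp_two φ.memLp_line u.memLp_line)
        (integrable_mul_of_memLp_two φ.memLp_line v.memLp_line)]
      ring)
    (fun c φ u => by
      have h1 : ∫ x, deriv φ x * deriv (c • u : H1 ℂ ⊤) x
          = ∫ x, c * (deriv φ x * deriv u x) := by
        refine integral_congr_ae ?_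
        filter_upwards [u.deriv_smul_ae' c] with x hx
        rw [hx]; ring
      rw [h1]
      simp only [H1.coe_smul, Pi.smul_apply, smul_eq_mul, mul_left_comm _ c, integral_const_mul]
      ring)) (1 + ‖k‖ ^ 2) fun u φ => by
    have h1 := (norm_integral_le_integral_norm _).trans (u.integral_norm_deriv_mul_le φ)
    have h2 := (norm_integral_le_integral_norm _).trans (u.integral_norm_mul_le φ)
    simp only [LinearMap.mk₂_apply]
    refine (norm_add_le _ _).trans ?_
    rw [norm_mul, norm_pow]
    have h3 : (‖u‖ / 2) * (‖φ‖ / 2) ≤ ‖u‖ * ‖φ‖ := by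
      have := mul_nonneg (norm_nonneg u) (norm_nonneg φ)
      linarith
    have h4 := mul_le_mul_of_nonneg_left (h2.trans h3) (sq_nonneg ‖k‖)
    nlinarith

theorem freeForm_apply (k : ℂ) (u φ : H1 ℂ ⊤) :
    freeForm k u φ = (∫ x, deriv u x * deriv φ x) + k ^ 2 * ∫ x, u x * φ x := rfl

/-- The operator `H_q + k² : H¹(ℝ; ℂ) → H⁻¹(ℝ; ℂ)` for `q = 4 w - w''`. -/
def schrodingerOp (k : ℂ) (w : H1 ℝ L) : H1 ℂ ⊤ →L[ℂ] StrongDual ℂ (H1 ℂ ⊤) :=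
  freeForm k + potentialFormL L w

theorem schrodingerOp_apply (k : ℂ) (w : H1 ℝ L) (u φ : H1 ℂ ⊤) :
    schrodingerOp k w u φ = (∫ x, deriv u x * deriv φ x) + k ^ 2 * (∫ x, u x * φ x)
      + ∫ x, potentialDensity w u φ x := rfl

theorem schrodingerOp_comm (k : ℂ) (w : H1 ℝ L) (u φ : H1 ℂ ⊤) :
    schrodingerOp k w u φ = schrodingerOp k w φ u := by
  rw [schrodingerOp_apply, schrodingerOp_apply, potentialDensity_comm w u φ]
  simp only [mul_comm (u _) (φ _), mul_comm (deriv u _)]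

theorem lineIntegral_mul (q : Hneg1 L) (u φ : H1 ℂ ⊤) :
    lineIntegral q (fun x => u x * φ x) = ∫ x, potentialDensity (rieszRep q) u φ x := by
  refine integral_congr_ae ?_
  filter_upwards [u.mem.ae_hasDerivAt, φ.mem.ae_hasDerivAt] with x h1 h2
  rw [(h1.fun_mul h2).deriv]
  rfl

theorem isResolventSolution_iff (q : Hneg1 L) (k : ℂ) (T : StrongDual ℂ (H1 ℂ ⊤)) (u : H1 ℂ ⊤) :
    IsResolventSolution q k T u ↔ schrodingerOp k (rieszRep q) u = T := by
  rw [IsResolventSolution, ContinuousLinearMap.ext_iff]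
  refine forall_congr' fun φ => ?_
  rw [schrodingerForm, lineIntegral_mul, schrodingerOp_apply]
  constructor <;> intro h <;> rw [← h] <;> ring

/-- Complex conjugation on `H¹(ℝ; ℂ)`. -/
def H1.conj (u : H1 ℂ ⊤) : H1 ℂ ⊤ :=
  ⟨fun x => (starRingEnd ℂ) (u x), memH1_top_of_hasPrim u.mem.hasPrim.conj
    (u.memLp_line.star) (u.memLp_deriv_line.star)⟩

theorem H1.conj_apply (u : H1 ℂ ⊤) (x : ℝ) : u.conj x = (starRingEnd ℂ) (u x) := rfl

theorem H1.deriv_conj (u : H1 ℂ ⊤) : ∀ᵐ x, deriv u.conj x = (starRingEnd ℂ) (deriv u x) :=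
  u.mem.hasPrim.conj.deriv_ae

theorem H1.conj_conj (u : H1 ℂ ⊤) : u.conj.conj = u :=
  H1.ext fun x => by rw [H1.conj_apply, H1.conj_apply, Complex.conj_conj]

theorem potentialDensity_conj (w : H1 ℝ L) (u : H1 ℂ ⊤) : ∀ᵐ x, potentialDensity w u u.conj x
    = ((4 * w x * ‖u x‖ ^ 2 + deriv w x * (2 * (deriv u x * (starRingEnd ℂ) (u x)).re) : ℝ) : ℂ) := by
  filter_upwards [u.deriv_conj] with x hx
  have h1 : u x * (starRingEnd ℂ) (u x) = ((‖u x‖ ^ 2 : ℝ) : ℂ) := by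
    rw [Complex.mul_conj, Complex.normSq_eq_norm_sq]
  have h2 : deriv u x * (starRingEnd ℂ) (u x) + u x * (starRingEnd ℂ) (deriv u x)
      = ((2 * (deriv u x * (starRingEnd ℂ) (u x)).re : ℝ) : ℂ) := by
    have := Complex.add_conj (deriv u x * (starRingEnd ℂ) (u x))
    rw [map_mul, Complex.conj_conj] at this
    rw [← this]; ring
  rw [potentialDensity, hx, H1.conj_apply, h1, h2]
  push_cast; ring

/-- On `(u, conj u)` a real potential contributes a real number, and the relative bound zero lets it
be absorbed by half of the kinetic energy. -/
theorem exists_potential_bound (w : H1 ℝ L) : ∃ C : ℝ, 0 ≤ C ∧ ∀ u : H1 ℂ ⊤,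
    ∃ p : ℝ, ∫ x, potentialDensity w u u.conj x = (p : ℂ) ∧
      |p| ≤ 2⁻¹ * (∫ x, ‖deriv u x‖ ^ 2) + C * ∫ x, ‖u x‖ ^ 2 := by
  -- Chosen so that `4 ‖w‖² ε ≤ 1/4`. Together with the `1/4` spent on Young's inequality for `w' u'
  -- u` this makes the coefficient `1/2` of the kinetic energy.
  set ε : ℝ := (16 * (‖w‖ ^ 2 + 1))⁻¹ with hε
  have hε0 : 0 < ε := by positivity
  refine ⟨8 * ‖w‖ + 4 * ‖w‖ ^ 2 * (1 + ε⁻¹), by positivity, fun u => ?_⟩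
  set ρ : ℝ → ℝ := fun x => 4 * w x * ‖u x‖ ^ 2
    + deriv w x * (2 * (deriv u x * (starRingEnd ℂ) (u x)).re) with hρ
  refine ⟨∫ x, ρ x, ?_, ?_⟩
  · rw [integral_congr_ae (potentialDensity_conj w u), integral_complex_ofReal]
  have i1 : Integrable fun x => ‖u x‖ ^ 2 := u.memLp_line.integrable_norm_pow (by norm_num)
  have i2 : Integrable fun x => ‖deriv u x‖ ^ 2 :=
    u.memLp_deriv_line.integrable_norm_pow (by norm_num)
  have i3 : Integrable fun x => ‖((deriv w x : ℝ) : ℂ) * u x‖ ^ 2 :=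
    (memLp_deriv_mul w u).integrable_norm_pow (by norm_num)
  have hb : ∀ x, ‖ρ x‖ ≤ 8 * ‖w‖ * ‖u x‖ ^ 2 + (4 * ‖((deriv w x : ℝ) : ℂ) * u x‖ ^ 2
      + 4⁻¹ * ‖deriv u x‖ ^ 2) := by
    intro x
    refine (norm_add_le _ _).trans (add_le_add ?_ ?_)
    · have h4 := w.norm_apply_le x
      rw [norm_mul, norm_mul, norm_pow, norm_norm, Real.norm_ofNat]
      nlinarith [sq_nonneg ‖u x‖]
    · have h1 : |(deriv u x * (starRingEnd ℂ) (u x)).re| ≤ ‖deriv u x‖ * ‖u x‖ := by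
        refine (Complex.abs_re_le_norm _).trans ?_
        rw [norm_mul, RCLike.norm_conj]
      rw [norm_mul, norm_mul, Real.norm_ofNat, norm_mul, Complex.norm_real, Real.norm_eq_abs,
        Real.norm_eq_abs]
      have h2 := mul_le_mul_of_nonneg_left h1 (abs_nonneg (deriv w x))
      nlinarith [sq_nonneg (4 * (|deriv w x| * ‖u x‖) - ‖deriv u x‖)]
  have h1 : |∫ x, ρ x| ≤ ∫ x, (8 * ‖w‖ * ‖u x‖ ^ 2 + (4 * ‖((deriv w x : ℝ) : ℂ) * u x‖ ^ 2
      + 4⁻¹ * ‖deriv u x‖ ^ 2)) :=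
    norm_integral_le_of_norm_le ((i1.const_mul _).add ((i3.const_mul _).add (i2.const_mul _)))
      (.of_forall hb)
  rw [integral_add (i1.const_mul _) (by exact (i3.const_mul _).add (i2.const_mul _)),
    integral_add (i3.const_mul _) (i2.const_mul _), integral_const_mul, integral_const_mul,
    integral_const_mul] at h1
  have h2 := integral_deriv_mul_sq_le w u hε0
  have h3 : ‖w‖ ^ 2 * ε ≤ 16⁻¹ := by
    rw [hε, mul_inv, ← mul_assoc, mul_comm (‖w‖ ^ 2), mul_assoc]
    have : ‖w‖ ^ 2 * (‖w‖ ^ 2 + 1)⁻¹ ≤ 1 := by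
      rw [← div_eq_mul_inv, div_le_one (by positivity)]; linarith
    linarith
  have h4 := mul_le_mul_of_nonneg_right h3 (H1.integral_sq_nonneg (deriv u))
  linarith

theorem freeForm_conj (k : ℂ) (u : H1 ℂ ⊤) : freeForm k u u.conj
    = ((∫ x, ‖deriv u x‖ ^ 2 : ℝ) : ℂ) + k ^ 2 * ((∫ x, ‖u x‖ ^ 2 : ℝ) : ℂ) := by
  have h1 : ∫ x, deriv u x * deriv u.conj x = ∫ x, ((‖deriv u x‖ ^ 2 : ℝ) : ℂ) := by
    refine integral_congr_ae ?_
    filter_upwards [u.deriv_conj] with x hx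
    rw [hx, Complex.mul_conj, Complex.normSq_eq_norm_sq]
  have h2 : ∫ x, u x * u.conj x = ∫ x, ((‖u x‖ ^ 2 : ℝ) : ℂ) :=
    integral_congr_ae (.of_forall fun x => by
      simp only [H1.conj_apply, Complex.mul_conj, Complex.normSq_eq_norm_sq])
  rw [freeForm_apply, h1, h2, integral_complex_ofReal, integral_complex_ofReal]

/-- For `Im k² > 0` and a real potential, the form of `H_q + k²` is coercive on `H¹`. -/
theorem exists_coercive {k : ℂ} (hk : 0 < (k ^ 2).im) (w : H1 ℝ L) :
    ∃ c : ℝ, 0 < c ∧ ∀ u : H1 ℂ ⊤, c * ‖u‖ ^ 2 ≤ ‖schrodingerOp k w u u.conj‖ := by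
  obtain ⟨C, hC, hp⟩ := exists_potential_bound w
  -- The imaginary part of the form gives `N₀ ≤ ‖Z‖ / Im k²`, the real part `N₁ ≤ 2 ‖Z‖ + 2 (C +
  -- ‖k²‖) N₀`; `K` is what results for `‖u‖² = N₁ + 4 N₀`.
  set K : ℝ := 2 + (2 * (C + ‖k ^ 2‖) + 4) / (k ^ 2).im with hK
  have hK0 : 0 < K := by positivity
  refine ⟨K⁻¹, inv_pos.2 hK0, fun u => ?_⟩
  obtain ⟨p, hp1, hp2⟩ := hp u
  set Z := schrodingerOp k w u u.conj with hZ
  set N₁ : ℝ := ∫ x, ‖deriv u x‖ ^ 2 with hN1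
  set N₀ : ℝ := ∫ x, ‖u x‖ ^ 2 with hN0
  have hN0' : 0 ≤ N₀ := H1.integral_sq_nonneg u
  have hZe : Z = (N₁ : ℂ) + k ^ 2 * (N₀ : ℂ) + (p : ℂ) := by
    rw [← hp1, hN1, hN0, ← freeForm_conj]; rfl
  have him : Z.im = (k ^ 2).im * N₀ := by rw [hZe]; simp
  have hre : Z.re = N₁ + (k ^ 2).re * N₀ + p := by rw [hZe]; simp
  have h1 : (k ^ 2).im * N₀ ≤ ‖Z‖ := him ▸ (le_abs_self _).trans (Complex.abs_im_le_norm Z)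
  have h2 : N₁ + (k ^ 2).re * N₀ + p ≤ ‖Z‖ := hre ▸ (le_abs_self _).trans (Complex.abs_re_le_norm Z)
  have h3 : -(‖k ^ 2‖ * N₀) ≤ (k ^ 2).re * N₀ := by
    have := mul_le_mul_of_nonneg_right (neg_le_of_abs_le (Complex.abs_re_le_norm (k ^ 2))) hN0'
    linarith
  have h4 := neg_le_of_abs_le hp2
  have h5 : N₀ ≤ ‖Z‖ / (k ^ 2).im := by
    rw [le_div_iff₀ hk]; linarith
  have h6 : N₁ ≤ 2 * ‖Z‖ + 2 * (C + ‖k ^ 2‖) * N₀ := by linarith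
  have h7 : ‖u‖ ^ 2 = N₁ + 4 * N₀ := u.norm_sq_line
  have h8 : ‖u‖ ^ 2 ≤ K * ‖Z‖ := by
    have h9 := mul_le_mul_of_nonneg_left h5 (by positivity : 0 ≤ 2 * (C + ‖k ^ 2‖) + 4)
    have h10 : K * ‖Z‖ = 2 * ‖Z‖ + (2 * (C + ‖k ^ 2‖) + 4) * (‖Z‖ / (k ^ 2).im) := by
      rw [hK]; ring
    rw [h7, h10]
    linarith
  rw [inv_mul_le_iff₀ hK0]
  exact h8

theorem H1.norm_conj (u : H1 ℂ ⊤) : ‖u.conj‖ = ‖u‖ := by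
  have h : ‖u.conj‖ ^ 2 = ‖u‖ ^ 2 := by
    rw [H1.norm_sq_line, H1.norm_sq_line]
    congr 1
    · refine integral_congr_ae ?_
      filter_upwards [u.deriv_conj] with x hx
      rw [hx, RCLike.norm_conj]
    · simp only [H1.conj_apply, RCLike.norm_conj]
  exact (sq_eq_sq₀ (norm_nonneg _) (norm_nonneg _)).1 h

/-- Lax–Milgram for a bilinear form that is coercive along `(u, conj u)`: the lower bound gives
injectivity and closed range, and the symmetric role of conjugation gives density of the range. -/
theorem schrodingerOp_bijective {k : ℂ} (hk : 0 < (k ^ 2).im) (w : H1 ℝ L) :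
    Function.Bijective (schrodingerOp k w) := by
  obtain ⟨c, hc, hco⟩ := exists_coercive hk w
  set A := schrodingerOp k w with hA
  have hlow : ∀ u, c * ‖u‖ ≤ ‖A u‖ := by
    intro u
    rcases eq_or_ne u 0 with rfl | hu
    · simp
    have h1 := (hco u).trans ((A u).le_opNorm u.conj)
    rw [u.norm_conj, sq, ← mul_assoc] at h1
    exact le_of_mul_le_mul_right h1 (norm_pos_iff.2 hu)
  have hanti : AntilipschitzWith (c⁻¹).toNNReal A := by
    refine AddMonoidHomClass.antilipschitz_of_bound A fun u => ?_
    rw [Real.coe_toNNReal _ (inv_pos.2 hc).le, inv_mul_eq_div, le_div_iff₀ hc, mul_comm]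
    exact hlow u
  refine ⟨hanti.injective, ?_⟩
  have hcl : IsClosed (range A) := hanti.isClosed_range A.uniformContinuous
  let e := InnerProductSpace.toDual ℂ (H1 ℂ ⊤)
  -- The range is carried from the dual back to `H¹` by the Riesz isomorphism, so that density can
  -- be tested with orthogonal complements.
  let M : Submodule ℂ (H1 ℂ ⊤) :=
    (LinearMap.range (A : H1 ℂ ⊤ →ₗ[ℂ] StrongDual ℂ (H1 ℂ ⊤))).comap
      (e.toLinearEquiv : H1 ℂ ⊤ →ₛₗ[starRingEnd ℂ] StrongDual ℂ (H1 ℂ ⊤))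
  have hMcl : IsClosed (M : Set (H1 ℂ ⊤)) := hcl.preimage e.continuous
  have : CompleteSpace M := hMcl.completeSpace_coe
  have hM : M = ⊤ := by
    rw [← Submodule.orthogonal_eq_bot_iff, Submodule.eq_bot_iff]
    intro z hz
    -- Orthogonality of `z` to the range is applied to the image of `conj z`; the resulting number
    -- is the coercive form at `conj z`.
    have h1 : A z.conj z = 0 := by
      have h2 : e.symm (A z.conj) ∈ M := ⟨z.conj, by simp⟩
      have h3 := (Submodule.mem_orthogonal M z).1 hz _ h2
      rwa [← InnerProductSpace.toDual_apply_apply, LinearIsometryEquiv.apply_symm_apply] at h3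
    have h2 := hco z.conj
    rw [z.conj_conj, h1, norm_zero] at h2
    have h3 : ‖z.conj‖ ^ 2 ≤ 0 := by
      by_contra h; push Not at h
      have := mul_pos hc h
      linarith
    rw [z.norm_conj] at h3
    exact norm_eq_zero.1 (pow_eq_zero_iff (two_ne_zero)|>.1 (le_antisymm h3 (sq_nonneg _)))
  intro T
  have h1 : e.symm T ∈ M := hM ▸ Submodule.mem_top
  obtain ⟨u, hu⟩ := h1
  exact ⟨u, by simpa using hu⟩

theorem schrodingerOp_isInvertible {k : ℂ} (hk : 0 < (k ^ 2).im) (w : H1 ℝ L) :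
    (schrodingerOp k w).IsInvertible := by
  have h := schrodingerOp_bijective hk w
  exact ⟨ContinuousLinearEquiv.ofBijective (schrodingerOp k w)
    (LinearMap.ker_eq_bot.2 h.1) (LinearMap.range_eq_top.2 h.2), rfl⟩

/-- The resolvent `(H_q + k²)⁻¹ : H⁻¹(ℝ; ℂ) → H¹(ℝ; ℂ)`, for `q = 4 w - w''`. -/
def resolventOp (k : ℂ) (w : H1 ℝ L) : StrongDual ℂ (H1 ℂ ⊤) →L[ℂ] H1 ℂ ⊤ :=
  ContinuousLinearMap.inverse (schrodingerOp k w)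

theorem schrodingerOp_resolventOp {k : ℂ} (hk : 0 < (k ^ 2).im) (w : H1 ℝ L)
    (T : StrongDual ℂ (H1 ℂ ⊤)) : schrodingerOp k w (resolventOp k w T) = T := by
  obtain ⟨e, he⟩ := schrodingerOp_isInvertible hk w
  rw [resolventOp, ← he, ContinuousLinearMap.inverse_equiv]
  simp

theorem existsUnique_isResolventSolution {k : ℂ} (hk : 0 < (k ^ 2).im) (q : Hneg1 L)
    (T : StrongDual ℂ (H1 ℂ ⊤)) : ∃! u : H1 ℂ ⊤, IsResolventSolution q k T u := by
  simp only [isResolventSolution_iff]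
  exact (schrodingerOp_bijective hk (rieszRep q)).existsUnique T

theorem greenResolvent_eq {k : ℂ} (hk : 0 < (k ^ 2).im) (q : Hneg1 L)
    (T : StrongDual ℂ (H1 ℂ ⊤)) : greenResolvent q k T = resolventOp k (rieszRep q) T := by
  have h1 : IsResolventSolution q k T (resolventOp k (rieszRep q) T) :=
    (isResolventSolution_iff q k T _).2 (schrodingerOp_resolventOp hk _ T)
  exact (existsUnique_isResolventSolution hk q T).unique (Classical.epsilon_spec ⟨_, h1⟩) h1

/-- The operator is affine and continuous in `w`, and inversion is smooth at invertible operators.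
-/
theorem contDiff_resolventOp {k : ℂ} (hk : 0 < (k ^ 2).im) :
    ContDiff ℝ ∞ (fun w : H1 ℝ L => resolventOp k w) := by
  rw [contDiff_iff_contDiffAt]
  intro w
  have h1 : ContDiffAt ℝ ∞ (ContinuousLinearMap.inverse :
      (H1 ℂ ⊤ →L[ℂ] StrongDual ℂ (H1 ℂ ⊤)) → _) (schrodingerOp k w) :=
    ((schrodingerOp_isInvertible hk w).contDiffAt_map_inverse (n := ∞)).restrict_scalars ℝ
  have h3 : ContDiff ℝ ∞ (fun w => potentialFormL L w) := by fun_prop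
  have h2 : ContDiffAt ℝ ∞ (fun w : H1 ℝ L => schrodingerOp k w) w :=
    contDiffAt_const.add h3.contDiffAt
  exact h1.comp w h2

end Resolvent

end DiagonalGreen

namespace DiagonalGreen

/-! ### Gluing of primitives, and boundary terms at infinity -/

section Limits

variable {f h F e : ℝ → ℂ} {s t : Set ℝ}

theorem HasPrim.union {c : ℝ} (hs : HasPrim s f h) (ht : HasPrim t f h) (hcs : c ∈ s)
    (hct : c ∈ t) : HasPrim (s ∪ t) f h := by
  have key : ∀ a ∈ s ∪ t, IntervalIntegrable h volume a c ∧ ∫ x in a..c, h x = f c - f a := by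
    rintro a (ha | ha)
    exacts [hs a ha c hcs, ht a ha c hct]
  intro a ha b hb
  obtain ⟨h1, h2⟩ := key a ha
  obtain ⟨h3, h4⟩ := key b hb
  refine ⟨h1.trans h3.symm, ?_⟩
  rw [← intervalIntegral.integral_add_adjacent_intervals h1 h3.symm, h2,
    intervalIntegral.integral_symm, h4]
  ring

/-- Two primitives which agree at a point may be glued there. -/
theorem HasPrim.glue {f₁ h₁ f₂ h₂ : ℝ → ℂ} {c : ℝ} (hl : HasPrim (Iic c) f₁ h₁)
    (hr : HasPrim (Ici c) f₂ h₂) (hc : f₁ c = f₂ c) :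
    HasPrim univ (fun x => if x ≤ c then f₁ x else f₂ x)
      (fun x => if x ≤ c then h₁ x else h₂ x) := by
  rw [← Iic_union_Ici (a := c)]
  refine HasPrim.union (c := c) ?_ ?_ (mem_Iic.2 le_rfl) (mem_Ici.2 le_rfl)
  · refine hl.congr (fun x hx => if_pos hx) (.of_forall fun x hx => if_pos hx)
  · refine hr.congr (fun x hx => ?_) ?_
    · rcases eq_or_lt_of_le (mem_Ici.1 hx) with rfl | h
      · simp [hc]
      · simp [not_le.2 h]
    · have : ∀ᵐ x : ℝ, x ≠ c := by simp [ae_iff]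
      filter_upwards [this] with x hx hxc
      simp [not_le.2 (lt_of_le_of_ne hxc hx.symm)]

/-- An integrable derivative forces a limit at infinity, and integrability of `F` forces this limit
to vanish. -/
theorem tendsto_zero_atTop_of_hasPrim {c : ℝ} (hF : HasPrim (Ici c) F f)
    (hFi : IntegrableOn F (Ioi c)) (hf : IntegrableOn f (Ioi c)) : Tendsto F atTop (𝓝 0) := by
  have h1 := intervalIntegral_tendsto_integral_Ioi c hf tendsto_id
  have h2 : Tendsto F atTop (𝓝 ((∫ x in Ioi c, f x) + F c)) := by
    refine (h1.add_const (F c)).congr' ?_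
    filter_upwards [eventually_ge_atTop c] with b hb
    rw [id, (hF c (mem_Ici.2 le_rfl) b hb).2]; ring
  have h3 : IntegrableAtFilter F atTop volume := ⟨Ioi c, Ioi_mem_atTop c, hFi⟩
  rwa [h3.eq_zero_of_tendsto (by
    intro s hs
    obtain ⟨b, hb⟩ := mem_atTop_sets.1 hs
    exact top_le_iff.1 (le_trans (by simp) (measure_mono (fun x hx => hb x hx : Ici b ⊆ s)))) h2]
    at h2

theorem integral_Ioi_of_hasPrim {c : ℝ} (hF : HasPrim (Ici c) F f)
    (hFi : IntegrableOn F (Ioi c)) (hf : IntegrableOn f (Ioi c)) :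
    ∫ x in Ioi c, f x = -F c := by
  have h1 := intervalIntegral_tendsto_integral_Ioi c hf tendsto_id
  have h2 := (tendsto_zero_atTop_of_hasPrim hF hFi hf).sub_const (F c)
  rw [zero_sub] at h2
  refine tendsto_nhds_unique h1 (h2.congr' ?_)
  filter_upwards [eventually_ge_atTop c] with b hb
  rw [id, (hF c (mem_Ici.2 le_rfl) b hb).2]

theorem HasPrim.comp_neg (hF : HasPrim s F f) :
    HasPrim (-s) (fun x => F (-x)) (fun x => -f (-x)) := by
  intro a ha b hb
  have h := hF (-a) ha (-b) hb
  refine ⟨?_, ?_⟩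
  · have h2 := (IntervalIntegrable.iff_comp_neg).1 h.1
    simp only [neg_neg] at h2
    exact h2.neg
  · rw [intervalIntegral.integral_neg, intervalIntegral.integral_comp_neg,
      intervalIntegral.integral_symm, h.2]
    ring

theorem integral_Iic_of_hasPrim {c : ℝ} (hF : HasPrim (Iic c) F f)
    (hFi : IntegrableOn F (Iic c)) (hf : IntegrableOn f (Iic c)) :
    ∫ x in Iic c, f x = F c := by
  have hp : HasPrim (Ici (-c)) (fun x => F (-x)) (fun x => -f (-x)) := by
    have := hF.comp_neg
    rwa [show -Iic c = Ici (-c) by simp] at this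
  have hneg : ∀ v : ℝ → ℂ, IntegrableOn v (Iic c) →
      IntegrableOn (fun x => v (-x)) (Ioi (-c)) := by
    intro v hv
    rw [← integrableOn_Ici_iff_integrableOn_Ioi]
    exact IntegrableOn.comp_neg_Ici (by rwa [neg_neg])
  have h1 := integral_Ioi_of_hasPrim hp (hneg F hFi) (hneg f hf).neg
  rw [neg_neg, integral_neg, integral_comp_neg_Ioi, neg_neg] at h1
  exact neg_injective h1

theorem integral_eq_zero_of_hasPrim (hF : HasPrim univ F f) (hFi : Integrable F)
    (hf : Integrable f) : ∫ x, f x = 0 := by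
  rw [← intervalIntegral.integral_Iic_add_Ioi (b := 0) hf.integrableOn hf.integrableOn,
    integral_Iic_of_hasPrim (hF.mono (subset_univ _)) hFi.integrableOn hf.integrableOn,
    integral_Ioi_of_hasPrim (hF.mono (subset_univ _)) hFi.integrableOn hf.integrableOn]
  ring

end Limits

/-! ### Test functions: ramps, cut-offs and exponentials -/

section TestFunctions

theorem H1.integrable_mul (u φ : H1 ℂ ⊤) : Integrable fun x => u x * φ x :=
  integrable_mul_of_memLp_two u.memLp_line φ.memLp_line

theorem H1.integrable_deriv_mul (u φ : H1 ℂ ⊤) :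
    Integrable fun x => deriv u x * φ x + u x * deriv φ x :=
  (integrable_mul_of_memLp_two u.memLp_deriv_line φ.memLp_line).add
    (integrable_mul_of_memLp_two u.memLp_line φ.memLp_deriv_line)

/-- The product of an `H¹` function with a bounded function whose derivative is bounded. -/
def H1.mulBounded {r r' : ℝ → ℂ} {C : ℝ} (hr : HasPrim univ r r') (hC : ∀ x, ‖r x‖ ≤ C)
    (hC' : ∀ x, ‖r' x‖ ≤ C) (u : H1 ℂ ⊤) : H1 ℂ ⊤ :=
  ⟨fun x => r x * u x, by
    have hrm : AEStronglyMeasurable r volume := by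
      refine Continuous.aestronglyMeasurable ?_
      refine continuous_iff_continuousAt.2 fun x => ?_
      exact (hr.continuousOn_uIcc (mem_univ (x - 1)) (mem_univ (x + 1))).continuousAt (by
        rw [uIcc_of_le (by linarith)]; exact Icc_mem_nhds (by linarith) (by linarith))
    have hrm' : AEStronglyMeasurable r' volume := by
      have h1 : ∀ᵐ x, deriv r x = r' x := hr.deriv_ae
      exact (measurable_deriv r).aestronglyMeasurable.congr h1
    refine memH1_top_of_hasPrim (hr.mul u.mem.hasPrim) ?_ (MemLp.add ?_ ?_)
    · exact MemLp.of_le_mul (c := C) u.memLp_line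
        (hrm.mul u.memLp_line.1) (.of_forall fun x => by rw [norm_mul]; gcongr; exact hC x)
    · exact MemLp.of_le_mul (c := C) u.memLp_line
        (hrm'.mul u.memLp_line.1) (.of_forall fun x => by rw [norm_mul]; gcongr; exact hC' x)
    · exact MemLp.of_le_mul (c := C) u.memLp_deriv_line
        (hrm.mul u.memLp_deriv_line.1) (.of_forall fun x => by rw [norm_mul]; gcongr; exact hC x)⟩

theorem H1.deriv_mulBounded {r r' : ℝ → ℂ} {C : ℝ} (hr : HasPrim univ r r') (hC : ∀ x, ‖r x‖ ≤ C)
    (hC' : ∀ x, ‖r' x‖ ≤ C) (u : H1 ℂ ⊤) :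
    ∀ᵐ x, deriv (u.mulBounded hr hC hC') x = r' x * u x + r x * deriv u x :=
  (hr.mul u.mem.hasPrim).deriv_ae

/-- The piecewise linear function which is `0` on the left of `c` and `1` on the right of `d`. -/
def ramp (c d x : ℝ) : ℂ := if x ≤ c then 0 else if x ≤ d then ((x - c) / (d - c) : ℝ) else 1

/-- The derivative of `ramp`. -/
def rampDeriv (c d x : ℝ) : ℂ := if x ≤ c then 0 else if x ≤ d then ((d - c)⁻¹ : ℝ) else 0

theorem ramp_hasPrim {c d : ℝ} (hcd : c < d) : HasPrim univ (ramp c d) (rampDeriv c d) := by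
  have h1 : HasPrim univ (fun x : ℝ => (((x - c) / (d - c) : ℝ) : ℂ))
      (fun _ => (((d - c)⁻¹ : ℝ) : ℂ)) := by
    refine .of_hasDerivAt (fun x => ?_) continuous_const
    have := (((hasDerivAt_id x).sub_const c).div_const (d - c)).ofReal_comp
    simpa using this
  have h2 : HasPrim univ (fun x : ℝ => if x ≤ d then (((x - c) / (d - c) : ℝ) : ℂ) else 1)
      (fun x => if x ≤ d then (((d - c)⁻¹ : ℝ) : ℂ) else 0) :=
    HasPrim.glue (h1.mono (subset_univ _)) (HasPrim.const 1)
      (by rw [div_self (by linarith)]; simp)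
  exact HasPrim.glue (HasPrim.const 0) (h2.mono (subset_univ _)) (by simp [hcd.le])

theorem ramp_of_le {c d x : ℝ} (h : x ≤ c) : ramp c d x = 0 := if_pos h

theorem ramp_of_ge {c d x : ℝ} (hcd : c < d) (h : d ≤ x) : ramp c d x = 1 := by
  rw [ramp, if_neg (by linarith)]
  split_ifs with h1
  · rw [le_antisymm h1 h, div_self (by linarith)]; simp
  · rfl

/-- The bound is deliberately generous: `H1.mulBounded` takes one constant for the ramp and its
derivative. -/
theorem norm_ramp_le {c d : ℝ} (hcd : c < d) (x : ℝ) : ‖ramp c d x‖ ≤ 1 + (d - c)⁻¹ := by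
  have h0 : 0 < (d - c)⁻¹ := inv_pos.2 (by linarith)
  rw [ramp]
  split_ifs with h1 h2
  · simp; linarith
  · rw [Complex.norm_real, Real.norm_of_nonneg (div_nonneg (by linarith) (by linarith))]
    have : (x - c) / (d - c) ≤ 1 := (div_le_one (by linarith)).2 (by linarith)
    linarith
  · simp; linarith

theorem norm_rampDeriv_le {c d : ℝ} (hcd : c < d) (x : ℝ) : ‖rampDeriv c d x‖ ≤ 1 + (d - c)⁻¹ := by
  have h0 : 0 < (d - c)⁻¹ := inv_pos.2 (by linarith)
  rw [rampDeriv]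
  split_ifs with h1 h2
  · simp; linarith
  · rw [Complex.norm_real, Real.norm_of_nonneg h0.le]; linarith
  · simp; linarith

theorem integral_rampDeriv_mul {c d : ℝ} (hcd : c < d) (A : ℝ → ℂ) :
    ∫ x, rampDeriv c d x * A x = (((d - c)⁻¹ : ℝ) : ℂ) * ∫ x in c..d, A x := by
  have h : (fun x => rampDeriv c d x * A x)
      = (Ioc c d).indicator fun x => (((d - c)⁻¹ : ℝ) : ℂ) * A x := by
    ext x
    rw [rampDeriv, indicator]
    simp only [mem_Ioc]
    split_ifs with h1 h2 h3 h4 h5 <;> first | rfl | (simp; done) | (exfalso; grind)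
  rw [h, integral_indicator measurableSet_Ioc, integral_const_mul,
    intervalIntegral.integral_of_le hcd.le]

/-- The product of an `H¹` function with a ramp. -/
def H1.ramp {c d : ℝ} (hcd : c < d) (u : H1 ℂ ⊤) : H1 ℂ ⊤ :=
  u.mulBounded (ramp_hasPrim hcd) (norm_ramp_le hcd) (norm_rampDeriv_le hcd)

theorem H1.ramp_apply {c d : ℝ} (hcd : c < d) (u : H1 ℂ ⊤) (x : ℝ) :
    u.ramp hcd x = DiagonalGreen.ramp c d x * u x := rfl

/-- The function which is `0` on the left of a zero `c` of `u`, and `u` on the right. -/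
def H1.cut (u : H1 ℂ ⊤) {c : ℝ} (hc : u c = 0) : H1 ℂ ⊤ :=
  ⟨fun x => if x ≤ c then 0 else u x, by
    have hs : MeasurableSet (Iic c)ᶜ := measurableSet_Iic.compl
    have h0 : ∀ v : ℝ → ℂ, (fun x => if x ≤ c then 0 else v x) = (Iic c)ᶜ.indicator v := by
      intro v; ext x
      by_cases h : x ≤ c <;> simp [h, not_le.1, indicator]
    refine memH1_top_of_hasPrim (HasPrim.glue (HasPrim.const 0)
      (u.mem.hasPrim.mono (subset_univ _)) hc.symm) ?_ ?_
    · rw [h0]; exact u.memLp_line.indicator hs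
    · rw [h0]; exact u.memLp_deriv_line.indicator hs⟩

theorem H1.cut_apply (u : H1 ℂ ⊤) {c : ℝ} (hc : u c = 0) (x : ℝ) :
    u.cut hc x = if x ≤ c then 0 else u x := rfl

theorem H1.deriv_cut (u : H1 ℂ ⊤) {c : ℝ} (hc : u c = 0) :
    ∀ᵐ x, deriv (u.cut hc) x = if x ≤ c then 0 else deriv u x :=
  (HasPrim.glue (HasPrim.const 0) (u.mem.hasPrim.mono (subset_univ _)) hc.symm).deriv_ae

/-- The derivative of `exp (-k |y - x|)`. -/
def expDeriv (k : ℂ) (x y : ℝ) : ℂ :=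
  if y ≤ x then k * Complex.exp (-k * |y - x|) else -k * Complex.exp (-k * |y - x|)

theorem exp_hasPrim (k : ℂ) (x : ℝ) :
    HasPrim univ (fun y => Complex.exp (-k * |y - x|)) (expDeriv k x) := by
  have hd : ∀ c : ℂ, HasPrim univ (fun y : ℝ => Complex.exp (c * (y - x)))
      (fun y => c * Complex.exp (c * (y - x))) := by
    intro c
    refine .of_hasDerivAt (fun y => ?_) (by fun_prop)
    have h := (((Complex.ofRealCLM.hasDerivAt (x := y)).sub_const (x : ℂ)).const_mul c).cexp
    simp only [Complex.ofRealCLM_apply, Complex.ofReal_one, mul_one] at h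
    rw [mul_comm]; exact h
  have h := HasPrim.glue (c := x) ((hd k).mono (subset_univ _)) ((hd (-k)).mono (subset_univ _))
    (by simp)
  refine h.congr (fun y _ => ?_) (.of_forall fun y _ => ?_)
  · dsimp only
    split_ifs with hy
    · rw [abs_of_nonpos (by linarith)]; push_cast; congr 1; ring
    · rw [abs_of_pos (by linarith)]; push_cast; rfl
  · rw [expDeriv]
    split_ifs with hy
    · rw [abs_of_nonpos (by linarith)]; push_cast; congr 2; ring
    · rw [abs_of_pos (by linarith)]; push_cast; rfl

theorem norm_exp_abs (k : ℂ) (t : ℝ) : ‖Complex.exp (-k * |t|)‖ = Real.exp (-k.re * |t|) := by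
  rw [Complex.norm_exp]; simp

theorem norm_expDeriv (k : ℂ) (x y : ℝ) :
    ‖expDeriv k x y‖ = ‖k‖ * Real.exp (-k.re * |y - x|) := by
  rw [expDeriv]
  split_ifs
  · rw [norm_mul, norm_exp_abs]
  · rw [norm_mul, norm_exp_abs, norm_neg]

theorem integrable_exp_abs {κ : ℝ} (hκ : 0 < κ) : Integrable fun t : ℝ => Real.exp (-κ * |t|) := by
  rw [← integrableOn_univ, ← Iic_union_Ioi (a := (0 : ℝ))]
  refine IntegrableOn.union ?_ ?_
  · refine (integrableOn_exp_mul_Iic hκ 0).congr_fun (fun t ht => ?_) measurableSet_Iic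
    dsimp only
    rw [abs_of_nonpos ht]; ring_nf
  · refine (integrableOn_exp_mul_Ioi (a := -κ) (by linarith) 0).congr_fun (fun t ht => ?_)
      measurableSet_Ioi
    dsimp only
    rw [abs_of_pos ht]

end TestFunctions

end DiagonalGreen

namespace DiagonalGreen

/-! ### The Green function: lower bound, factorization, nonvanishing -/

section Green

attribute [local instance] H1.normedSpace

variable {L : ENNReal} [Fact (1 ≤ L)] {k : ℂ}

theorem integral_exp_abs_sub_sq (k : ℂ) (x : ℝ) :
    ∫ y, ‖Complex.exp (-k * |y - x|)‖ ^ 2 = ∫ t : ℝ, Real.exp (-(2 * k.re) * |t|) := by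
  rw [← integral_sub_right_eq_self (fun t : ℝ => Real.exp (-(2 * k.re) * |t|)) x]
  refine integral_congr_ae (.of_forall fun y => ?_)
  simp only [norm_exp_abs, ← Real.exp_nat_mul]
  push_cast; ring_nf

/-- The function `exp (-k |y - x|)` of `y`. -/
def expTest (k : ℂ) (hre : 0 < k.re) (x : ℝ) : H1 ℂ ⊤ :=
  ⟨fun y => Complex.exp (-k * |y - x|), by
    have hc : Continuous fun y : ℝ => Complex.exp (-k * |y - x|) := by fun_prop
    have h1 : MemLp (fun y : ℝ => Complex.exp (-k * |y - x|)) 2 := by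
      rw [memLp_two_iff_integrable_sq_norm hc.aestronglyMeasurable]
      refine ((integrable_exp_abs (κ := 2 * k.re) (by linarith)).comp_sub_right x).congr
        (.of_forall fun y => ?_)
      simp only [norm_exp_abs, ← Real.exp_nat_mul]
      push_cast; ring_nf
    refine memH1_top_of_hasPrim (exp_hasPrim k x) h1 ?_
    refine MemLp.of_le_mul (c := ‖k‖) h1 ?_ (.of_forall fun y => ?_)
    · exact (measurable_deriv _).aestronglyMeasurable.congr (exp_hasPrim k x).deriv_ae
    · rw [norm_expDeriv, norm_exp_abs]⟩

theorem expTest_apply (hre : 0 < k.re) (x y : ℝ) :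
    expTest k hre x y = Complex.exp (-k * |y - x|) := rfl

theorem expTest_self (hre : 0 < k.re) (x : ℝ) : expTest k hre x x = 1 := by
  simp [expTest_apply]

theorem expTest_ne_zero (hre : 0 < k.re) (x y : ℝ) : expTest k hre x y ≠ 0 :=
  Complex.exp_ne_zero _

theorem deriv_expTest (hre : 0 < k.re) (x : ℝ) :
    ∀ᵐ y, deriv (expTest k hre x) y = expDeriv k x y :=
  (exp_hasPrim k x).deriv_ae

theorem deriv_expTest_right (hre : 0 < k.re) (x : ℝ) :
    ∀ᵐ y, x < y → deriv (expTest k hre x) y = -k * expTest k hre x y := by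
  filter_upwards [deriv_expTest hre x] with y hy hxy
  rw [hy, expDeriv, if_neg (not_le.2 hxy)]; rfl

theorem deriv_expTest_left (hre : 0 < k.re) (x : ℝ) :
    ∀ᵐ y, y ≤ x → deriv (expTest k hre x) y = k * expTest k hre x y := by
  filter_upwards [deriv_expTest hre x] with y hy hxy
  rw [hy, expDeriv, if_pos hxy]; rfl

/-- What matters is that the value does not depend on `x`; it makes the lower bound for the diagonal
uniform. -/
theorem norm_expTest_sq (hre : 0 < k.re) (x : ℝ) :
    ‖expTest k hre x‖ ^ 2 = (‖k‖ ^ 2 + 4) * ∫ t : ℝ, Real.exp (-(2 * k.re) * |t|) := by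
  have h : ∫ y, ‖deriv (expTest k hre x) y‖ ^ 2
      = ∫ y, ‖k‖ ^ 2 * ‖Complex.exp (-k * |y - x|)‖ ^ 2 := by
    refine integral_congr_ae ?_
    filter_upwards [deriv_expTest hre x] with y hy
    rw [hy, norm_expDeriv, norm_exp_abs, mul_pow]
  rw [H1.norm_sq_line, h, integral_const_mul, integral_exp_abs_sub_sq]
  simp only [expTest_apply]
  rw [integral_exp_abs_sub_sq]
  ring

/-- The integrand of the form of `H_q + k²`, for `q = 4 w - w''`. -/
def formDensity (k : ℂ) (w : H1 ℝ L) (u φ : H1 ℂ ⊤) (x : ℝ) : ℂ :=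
  (deriv u x * deriv φ x + k ^ 2 * (u x * φ x)) + potentialDensity w u φ x

theorem integrable_freeDensity (k : ℂ) (u φ : H1 ℂ ⊤) :
    Integrable fun x => deriv u x * deriv φ x + k ^ 2 * (u x * φ x) :=
  (integrable_mul_of_memLp_two u.memLp_deriv_line φ.memLp_deriv_line).add
    ((u.integrable_mul φ).const_mul _)

theorem integrable_formDensity (k : ℂ) (w : H1 ℝ L) (u φ : H1 ℂ ⊤) :
    Integrable (formDensity k w u φ) :=
  (integrable_freeDensity k u φ).add (integrable_potentialDensity w u φ)

theorem formDensity_comm (k : ℂ) (w : H1 ℝ L) (u φ : H1 ℂ ⊤) :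
    formDensity k w u φ = formDensity k w φ u := by
  ext x
  rw [formDensity, formDensity, potentialDensity_comm w u φ]
  ring

theorem freeForm_eq_integral (k : ℂ) (u φ : H1 ℂ ⊤) :
    freeForm k u φ = ∫ x, (deriv u x * deriv φ x + k ^ 2 * (u x * φ x)) := by
  rw [integral_add (integrable_mul_of_memLp_two u.memLp_deriv_line φ.memLp_deriv_line)
    ((u.integrable_mul φ).const_mul _), integral_const_mul, freeForm_apply]

theorem schrodingerOp_eq_integral (k : ℂ) (w : H1 ℝ L) (u φ : H1 ℂ ⊤) :
    schrodingerOp k w u φ = ∫ x, formDensity k w u φ x := by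
  simp only [formDensity]
  rw [integral_add (integrable_freeDensity k u φ) (integrable_potentialDensity w u φ),
    ← freeForm_eq_integral]
  rfl

theorem H1.hasPrim_mul (u φ : H1 ℂ ⊤) : HasPrim univ (fun x => u x * φ x)
    (fun x => deriv u x * φ x + u x * deriv φ x) :=
  u.mem.hasPrim.mul φ.mem.hasPrim

/-- On the right of `x` the exponential satisfies `φ' = -k φ`, so the density is the exact
derivative `-k (u φ)'`, whose primitive vanishes at infinity. -/
theorem integral_freeDensity_Ioi (hre : 0 < k.re) {x s : ℝ} (hxs : x ≤ s) (u : H1 ℂ ⊤) :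
    ∫ y in Ioi s, (deriv u y * deriv (expTest k hre x) y + k ^ 2 * (u y * expTest k hre x y))
      = k * (u s * expTest k hre x s) := by
  set φ := expTest k hre x with hφ
  have h := integral_Ioi_of_hasPrim ((u.hasPrim_mul φ).mono (subset_univ (Ici s)))
    (u.integrable_mul φ).integrableOn (u.integrable_deriv_mul φ).integrableOn
  have h2 : ∫ y in Ioi s, (deriv u y * deriv φ y + k ^ 2 * (u y * φ y))
      = ∫ y in Ioi s, -k * (deriv u y * φ y + u y * deriv φ y) := by
    refine setIntegral_congr_ae measurableSet_Ioi ?_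
    filter_upwards [deriv_expTest_right hre x] with y hy hys
    rw [hy (hxs.trans_lt hys)]; ring
  rw [h2, integral_const_mul, h]; ring

theorem integral_freeDensity_Iic (hre : 0 < k.re) {x s : ℝ} (hxs : s ≤ x) (u : H1 ℂ ⊤) :
    ∫ y in Iic s, (deriv u y * deriv (expTest k hre x) y + k ^ 2 * (u y * expTest k hre x y))
      = k * (u s * expTest k hre x s) := by
  set φ := expTest k hre x with hφ
  have h := integral_Iic_of_hasPrim ((u.hasPrim_mul φ).mono (subset_univ (Iic s)))
    (u.integrable_mul φ).integrableOn (u.integrable_deriv_mul φ).integrableOn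
  have h2 : ∫ y in Iic s, (deriv u y * deriv φ y + k ^ 2 * (u y * φ y))
      = ∫ y in Iic s, k * (deriv u y * φ y + u y * deriv φ y) := by
    refine setIntegral_congr_ae measurableSet_Iic ?_
    filter_upwards [deriv_expTest_left hre x] with y hy hys
    rw [hy ((mem_Iic.1 hys).trans hxs)]; ring
  rw [h2, integral_const_mul, h]

/-- Twice `k` times the point mass is the image of `exp (-k |y - x|)` under `-∂² + k²`. -/
theorem freeForm_expTest (hre : 0 < k.re) (u : H1 ℂ ⊤) (x : ℝ) :
    freeForm k u (expTest k hre x) = 2 * k * u x := by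
  have h := integrable_freeDensity k u (expTest k hre x)
  rw [freeForm_eq_integral, ← intervalIntegral.integral_Iic_add_Ioi (b := x) h.integrableOn
    h.integrableOn, integral_freeDensity_Iic hre le_rfl, integral_freeDensity_Ioi hre le_rfl,
    expTest_self]
  ring

/-- The Green function `G(x, y)`, as a function of `y`. -/
def greenFun (k : ℂ) (w : H1 ℝ L) (x : ℝ) : H1 ℂ ⊤ := resolventOp k w (pointMass x)

theorem pointMass_apply (x : ℝ) (u : H1 ℂ ⊤) : pointMass x u = u x := rfl

variable (hk : 0 < (k ^ 2).im) (w : H1 ℝ L)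
include hk

theorem schrodingerOp_greenFun (x : ℝ) (φ : H1 ℂ ⊤) :
    schrodingerOp k w (greenFun k w x) φ = φ x := by
  rw [greenFun, schrodingerOp_resolventOp hk, pointMass_apply]

theorem greenFun_symm (x y : ℝ) : greenFun k w x y = greenFun k w y x := by
  rw [← schrodingerOp_greenFun hk w y, schrodingerOp_comm, schrodingerOp_greenFun hk]

theorem eq_greenFun {x : ℝ} {u : H1 ℂ ⊤} (h : ∀ φ, schrodingerOp k w u φ = φ x) :
    u = greenFun k w x := by
  refine (schrodingerOp_bijective hk w).1 ?_
  ext φ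
  rw [h, schrodingerOp_greenFun hk]

theorem eq_zero_of_schrodingerOp_conj {u : H1 ℂ ⊤} (h : schrodingerOp k w u u.conj = 0) :
    u = 0 := by
  obtain ⟨c, hc, h1⟩ := exists_coercive hk w
  have h2 := h1 u
  rw [h, norm_zero] at h2
  by_contra hu
  have := mul_pos hc (pow_pos (norm_pos_iff.2 hu) 2)
  linarith

/-- The form at `G(x, ·)` and its conjugate is `conj g(x)`, so coercivity gives `|g(x)| ≥ c ‖G(x,
·)‖²`. The norm on the right is bounded below because the form pairs `G(x, ·)` with `exp(-k |· -
x|)` to `1`, and these exponentials all have the same norm. -/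
theorem exists_greenFun_lower_bound (hre : 0 < k.re) :
    ∃ c : ℝ, 0 < c ∧ ∀ x, c ≤ ‖greenFun k w x x‖ := by
  obtain ⟨c, hc, h1⟩ := exists_coercive hk w
  set M := ‖schrodingerOp k w‖ * Real.sqrt ((‖k‖ ^ 2 + 4) * ∫ t : ℝ, Real.exp (-(2 * k.re) * |t|))
    with hM
  have hb : ∀ x, 1 ≤ M * ‖greenFun k w x‖ := by
    intro x
    have h2 := schrodingerOp_greenFun hk w x (expTest k hre x)
    rw [expTest_self] at h2
    have h3 := (schrodingerOp k w).le_opNorm₂ (greenFun k w x) (expTest k hre x)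
    rw [h2, norm_one] at h3
    refine h3.trans_eq ?_
    rw [hM, ← norm_expTest_sq hre x, Real.sqrt_sq (norm_nonneg _)]
    ring
  have hM0 : 0 < M := by
    by_contra h
    push Not at h
    have := hb 0
    nlinarith [norm_nonneg (greenFun k w 0)]
  refine ⟨c * (M⁻¹) ^ 2, by positivity, fun x => ?_⟩
  have h2 := h1 (greenFun k w x)
  rw [schrodingerOp_greenFun hk, H1.conj_apply, RCLike.norm_conj] at h2
  refine le_trans ?_ h2
  have h3 : M⁻¹ ≤ ‖greenFun k w x‖ := by
    rw [inv_le_iff_one_le_mul₀ hM0, mul_comm]; exact hb x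
  gcongr

theorem greenFun_self_ne_zero (hre : 0 < k.re) (x : ℝ) : greenFun k w x x ≠ 0 := by
  obtain ⟨c, hc, h⟩ := exists_greenFun_lower_bound hk w hre
  exact norm_pos_iff.1 (hc.trans_le (h x))

/-- A solution of the homogeneous equation on the right of a zero vanishes there. -/
theorem eq_zero_of_schrodingerOp_cut {f : H1 ℂ ⊤} {x : ℝ} (hx : f x = 0)
    (h : ∀ φ : H1 ℂ ⊤, (∀ y ≤ x, φ y = 0) → schrodingerOp k w f φ = 0) {y : ℝ} (hy : x ≤ y) :
    f y = 0 := by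
  set v := f.cut hx with hv
  -- Left of `x` both integrands vanish and right of it `v = f`. As `conj v` vanishes on the left of
  -- `x`, it is an admissible test function for `f`, and coercivity gives `v = 0`.
  have h1 : schrodingerOp k w v v.conj = schrodingerOp k w f v.conj := by
    rw [schrodingerOp_eq_integral, schrodingerOp_eq_integral]
    refine integral_congr_ae ?_
    filter_upwards [f.deriv_cut hx, v.deriv_conj] with z h1 h2
    have h3 : deriv v z = if z ≤ x then 0 else deriv f z := h1
    have h4 : v z = if z ≤ x then 0 else f z := rfl
    rw [formDensity, formDensity, potentialDensity, potentialDensity, h2, h3, H1.conj_apply, h4]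
    split_ifs <;> simp
  have h2 : v = 0 := by
    refine eq_zero_of_schrodingerOp_conj hk w ?_
    rw [h1]
    refine h _ fun z hz => ?_
    rw [H1.conj_apply, hv, H1.cut_apply, if_pos hz, map_zero]
  rcases eq_or_lt_of_le hy with rfl | hy
  · exact hx
  · have h3 : v y = 0 := by rw [h2]; rfl
    rwa [hv, H1.cut_apply, if_neg (not_le.2 hy)] at h3

/-- Subtract from `G(a, ·)` the multiple of `G(x, ·)` with the same value at `x`. Both poles lie in
`(-∞, x]`, so the difference solves the homogeneous equation on the right of `x` and vanishes at
`x`; hence it vanishes from `x` on. -/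
theorem greenFun_mul_self (hre : 0 < k.re) {a x y : ℝ} (hax : a ≤ x) (hxy : x ≤ y) :
    greenFun k w a y * greenFun k w x x = greenFun k w a x * greenFun k w x y := by
  set c := greenFun k w a x / greenFun k w x x with hc
  have h0 := greenFun_self_ne_zero hk w hre x
  have h := eq_zero_of_schrodingerOp_cut hk w (f := greenFun k w a - c • greenFun k w x) (x := x)
    (by
      change greenFun k w a x - c * greenFun k w x x = 0
      rw [hc, div_mul_cancel₀ _ h0, sub_self]) (fun φ hφ => by
      rw [map_sub, map_smul, sub_apply, smul_apply, schrodingerOp_greenFun hk,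
        schrodingerOp_greenFun hk, hφ _ hax, hφ _ le_rfl]
      simp) hxy
  have h2 : greenFun k w a y = c * greenFun k w x y := sub_eq_zero.1 h
  rw [h2, hc]
  field_simp

/-- Let `m` be the first zero of `G(a, ·)` on the right of `a`. The factorization gives `G(a,x)
G(x,m) = 0` for `a < x < m`, where `G(a,x) ≠ 0`. So `G(m, ·)` vanishes on `(a, m)` and, by
continuity, at `m`, against the nonvanishing of the diagonal. -/
theorem greenFun_ne_zero (hre : 0 < k.re) {a b : ℝ} (hab : a ≤ b) : greenFun k w a b ≠ 0 := by
  intro hb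
  set G := greenFun k w with hG
  set Z : Set ℝ := {y | a ≤ y ∧ G a y = 0} with hZ
  have hcl : IsClosed Z :=
    (isClosed_Ici (a := a)).inter (isClosed_eq (G a).mem.continuous continuous_const)
  have hbd : BddBelow Z := ⟨a, fun y hy => hy.1⟩
  have hmem : sInf Z ∈ Z := hcl.csInf_mem ⟨b, hab, hb⟩ hbd
  set m := sInf Z with hm
  have ham : a < m := lt_of_le_of_ne hmem.1 fun h => greenFun_self_ne_zero hk w hre a (by
    have := hmem.2
    rwa [← h] at this)
  have h1 : ∀ x, a < x → x < m → G m x = 0 := by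
    intro x hax hxm
    have h2 := greenFun_mul_self hk w hre hax.le hxm.le
    rw [← hG, hmem.2, zero_mul] at h2
    have h3 : G a x ≠ 0 := fun h => not_lt.2 (csInf_le hbd ⟨hax.le, h⟩) hxm
    rw [hG, greenFun_symm hk w m x]
    exact (mul_eq_zero.1 h2.symm).resolve_left h3
  have h2 : Tendsto (G m) (𝓝[<] m) (𝓝 (G m m)) :=
    (G m).mem.continuous.continuousAt.continuousWithinAt
  have h3 : Tendsto (G m) (𝓝[<] m) (𝓝 0) := by
    refine tendsto_const_nhds.congr' ?_
    filter_upwards [Ioo_mem_nhdsLT ham] with x hx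
    exact (h1 x hx.1 hx.2).symm
  exact greenFun_self_ne_zero hk w hre m (tendsto_nhds_unique h2 h3)

omit hk

theorem hasPrim_tail {I : ℝ → ℂ} (hI : Integrable I) :
    HasPrim univ (fun s => ∫ y in Ioi s, I y) (fun s => -I s) := by
  intro a _ b _
  refine ⟨hI.neg.intervalIntegrable, ?_⟩
  rw [intervalIntegral.integral_neg, ← intervalIntegral.integral_Ioi_sub_Ioi' hI.integrableOn
    hI.integrableOn, neg_sub]

/-- Integration by parts of the ramp against the tail integral of `I`. -/
theorem integral_ramp_mul {c d : ℝ} (hcd : c < d) {I : ℝ → ℂ} (hI : Integrable I) :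
    ∫ x, ramp c d x * I x = ∫ x, rampDeriv c d x * ∫ y in Ioi x, I y := by
  have h1 := (((ramp_hasPrim hcd).mul (hasPrim_tail hI)) c (mem_univ c) d (mem_univ d)).2
  dsimp only at h1
  rw [ramp_of_ge hcd le_rfl, ramp_of_le le_rfl] at h1
  have hrm : AEStronglyMeasurable (ramp c d) volume := by
    unfold ramp
    refine (Measurable.ite measurableSet_Iic measurable_const (Measurable.ite measurableSet_Iic
      ?_ measurable_const)).aestronglyMeasurable
    fun_prop
  have hi : Integrable fun x => ramp c d x * I x :=
    hI.bdd_mul hrm (c := 1 + (d - c)⁻¹) (.of_forall fun x => norm_ramp_le hcd x)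
  have hT : Continuous fun x => ∫ y in Ioi x, I y :=
    continuous_iff_continuousAt.2 fun x => ((hasPrim_tail hI).continuousOn_uIcc
      (mem_univ (x - 1)) (mem_univ (x + 1))).continuousAt (by
        rw [uIcc_of_le (by linarith)]; exact Icc_mem_nhds (by linarith) (by linarith))
  have h2 : IntervalIntegrable (fun x => rampDeriv c d x * ∫ y in Ioi x, I y) volume c d :=
    ((ramp_hasPrim hcd c (mem_univ c) d (mem_univ d)).1).mul_continuousOn hT.continuousOn
  have h3 : ∫ x, ramp c d x * I x = (∫ x in c..d, ramp c d x * I x) + ∫ x in Ioi d, I x := by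
    rw [← intervalIntegral.integral_Iic_add_Ioi (b := d) hi.integrableOn hi.integrableOn,
      ← intervalIntegral.integral_Iic_sub_Iic (a := c) hi.integrableOn hi.integrableOn]
    have h4 : ∫ x in Iic c, ramp c d x * I x = 0 := by
      rw [setIntegral_congr_fun measurableSet_Iic (g := fun _ => 0) fun x hx => by
        simp [ramp_of_le (mem_Iic.1 hx)]]
      simp
    rw [h4, sub_zero, setIntegral_congr_fun (s := Ioi d) (g := I) measurableSet_Ioi fun x hx => by
        simp [ramp_of_ge hcd (mem_Ioi.1 hx).le]]
  have h5 : ∫ x, rampDeriv c d x * ∫ y in Ioi x, I y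
      = ∫ x in c..d, rampDeriv c d x * ∫ y in Ioi x, I y := by
    rw [integral_rampDeriv_mul hcd, ← intervalIntegral.integral_const_mul,
      intervalIntegral.integral_of_le hcd.le, intervalIntegral.integral_of_le hcd.le]
    refine setIntegral_congr_fun measurableSet_Ioc fun x hx => ?_
    rw [rampDeriv, if_neg (not_le.2 hx.1), if_pos hx.2]
  rw [h3, h5]
  have h6 := intervalIntegral.integral_add h2 (hi.neg.intervalIntegrable (a := c) (b := d))
  simp only [Pi.neg_apply, intervalIntegral.integral_neg] at h6
  simp only [mul_neg] at h1
  rw [h6] at h1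
  linear_combination -h1

theorem integrable_deriv_add_mul (w : H1 ℝ L) (u φ : H1 ℂ ⊤) :
    Integrable fun x => (deriv u x + ((deriv w x : ℝ) : ℂ) * u x) * φ x :=
  integrable_mul_of_memLp_two (u.memLp_deriv_line.add (memLp_deriv_mul w u)) φ.memLp_line

/-- The derivative of the ramp produces the mean over `[c, d]` of the quasi-derivative `u' + w' u`
times `φ`; the remaining term becomes the mean of the tail of the form. Averaging avoids pointwise
values of `u'` and `w'`, which are only square integrable locally. -/
theorem schrodingerOp_ramp (k : ℂ) (w : H1 ℝ L) (u φ : H1 ℂ ⊤) {c d : ℝ} (hcd : c < d) :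
    schrodingerOp k w u (φ.ramp hcd) = (((d - c)⁻¹ : ℝ) : ℂ) * ∫ x in c..d,
      ((deriv u x + ((deriv w x : ℝ) : ℂ) * u x) * φ x + ∫ y in Ioi x, formDensity k w u φ y) := by
  have hI := integrable_formDensity k w u φ
  have hrm : AEStronglyMeasurable (ramp c d) volume := by
    unfold ramp
    refine (Measurable.ite measurableSet_Iic measurable_const (Measurable.ite measurableSet_Iic
      ?_ measurable_const)).aestronglyMeasurable
    fun_prop
  have hi : Integrable fun x => ramp c d x * formDensity k w u φ x :=
    hI.bdd_mul hrm (c := 1 + (d - c)⁻¹) (.of_forall fun x => norm_ramp_le hcd x)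
  have hrm' : AEStronglyMeasurable (rampDeriv c d) volume := by
    unfold rampDeriv
    exact (Measurable.ite measurableSet_Iic measurable_const (Measurable.ite measurableSet_Iic
      measurable_const measurable_const)).aestronglyMeasurable
  have hA := integrable_deriv_add_mul w u φ
  have hj : Integrable fun x => rampDeriv c d x
      * ((deriv u x + ((deriv w x : ℝ) : ℂ) * u x) * φ x) :=
    hA.bdd_mul hrm' (c := 1 + (d - c)⁻¹) (.of_forall fun x => norm_rampDeriv_le hcd x)
  have hT : Continuous fun x => ∫ y in Ioi x, formDensity k w u φ y :=
    continuous_iff_continuousAt.2 fun x => ((hasPrim_tail hI).continuousOn_uIcc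
      (mem_univ (x - 1)) (mem_univ (x + 1))).continuousAt (by
        rw [uIcc_of_le (by linarith)]; exact Icc_mem_nhds (by linarith) (by linarith))
  have h1 : schrodingerOp k w u (φ.ramp hcd)
      = ∫ x, (ramp c d x * formDensity k w u φ x
        + rampDeriv c d x * ((deriv u x + ((deriv w x : ℝ) : ℂ) * u x) * φ x)) := by
    rw [schrodingerOp_eq_integral]
    refine integral_congr_ae ?_
    filter_upwards [φ.deriv_mulBounded (ramp_hasPrim hcd) (norm_ramp_le hcd)
      (norm_rampDeriv_le hcd)] with x hx
    have hx' : deriv (φ.ramp hcd) x = rampDeriv c d x * φ x + ramp c d x * deriv φ x := hx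
    rw [formDensity, formDensity, potentialDensity, potentialDensity, hx', H1.ramp_apply]
    ring
  rw [h1, integral_add hi hj, integral_ramp_mul hcd hI, integral_rampDeriv_mul hcd,
    integral_rampDeriv_mul hcd, intervalIntegral.integral_add hA.intervalIntegrable
      (hT.intervalIntegrable c d)]
  ring

/-- If the form of `H_q + k²` at `u` is constant along the products of `φ` with ramps, then this
is reflected in a first order identity. -/
theorem ae_of_schrodingerOp_ramp (k : ℂ) (w : H1 ℝ L) (u φ : H1 ℂ ⊤) {s : Set ℝ}
    [s.OrdConnected] (m : ℂ)
    (h : ∀ c ∈ s, ∀ d ∈ s, ∀ hcd : c < d, schrodingerOp k w u (φ.ramp hcd) = m) :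
    ∀ᵐ x, x ∈ s → (deriv u x + ((deriv w x : ℝ) : ℂ) * u x) * φ x
      + ∫ y in Ioi x, formDensity k w u φ y = m := by
  have hI := integrable_formDensity k w u φ
  have hT : Continuous fun x => ∫ y in Ioi x, formDensity k w u φ y :=
    continuous_iff_continuousAt.2 fun x => ((hasPrim_tail hI).continuousOn_uIcc
      (mem_univ (x - 1)) (mem_univ (x + 1))).continuousAt (by
        rw [uIcc_of_le (by linarith)]; exact Icc_mem_nhds (by linarith) (by linarith))
  have hint : ∀ a b : ℝ, IntervalIntegrable (fun x => (deriv u x + ((deriv w x : ℝ) : ℂ) * u x)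
      * φ x + ∫ y in Ioi x, formDensity k w u φ y) volume a b := fun a b =>
    ((integrable_deriv_add_mul w u φ).intervalIntegrable).add (hT.intervalIntegrable a b)
  have h1 := ae_eq_zero_of_integral_eq_zero (s := s)
    (h := fun x => ((deriv u x + ((deriv w x : ℝ) : ℂ) * u x) * φ x
      + ∫ y in Ioi x, formDensity k w u φ y) - m)
    (fun a _ b _ => (hint a b).sub intervalIntegrable_const) (fun a ha b hb hab => by
      rcases eq_or_lt_of_le hab with rfl | hab
      · simp
      have h2 := h a ha b hb hab
      rw [schrodingerOp_ramp] at h2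
      rw [intervalIntegral.integral_sub (hint a b) intervalIntegrable_const,
        intervalIntegral.integral_const, ← h2, Complex.real_smul, ← mul_assoc, ← Complex.ofReal_mul,
        mul_inv_cancel₀ (by linarith), Complex.ofReal_one, one_mul, sub_self])
  filter_upwards [h1] with x hx hxs
  exact sub_eq_zero.1 (hx hxs)

end Green

end DiagonalGreen

namespace DiagonalGreen

/-! ### The Weyl solution, its Riccati equation and the derivative of `g` -/

section Riccati

attribute [local instance] H1.normedSpace

variable {L : ENNReal} [Fact (1 ≤ L)] {k : ℂ}

/-- The pairing of the potential with the product of `G(x, ·)` and `exp (-k |· - x|)`. -/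
def greenTotal (k : ℂ) (hre : 0 < k.re) (w : H1 ℝ L) (x : ℝ) : ℂ :=
  ∫ y, potentialDensity w (greenFun k w x) (expTest k hre x) y

/-- The part on the right of `x` of the pairing of the potential with the product of `G(x, ·)` and
`exp (-k |· - x|)`. -/
def greenTail (k : ℂ) (hre : 0 < k.re) (w : H1 ℝ L) (x : ℝ) : ℂ :=
  ∫ y in Ioi x, potentialDensity w (greenFun k w x) (expTest k hre x) y

/-- The quasi-derivative `ψ' / ψ + w'` of the Weyl solution `ψ` at `+∞`. -/
def weylQuot (k : ℂ) (hre : 0 < k.re) (w : H1 ℝ L) (x : ℝ) : ℂ :=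
  -k - greenTail k hre w x / greenFun k w x x

variable (hk : 0 < (k ^ 2).im) (hre : 0 < k.re) (w : H1 ℝ L)
include hk

/-- The equation of `G(x, ·)` is tested with `exp(-k |· - x|)`, whose value at `x` is `1`; the free
part of the form contributes `2 k g(x)`. -/
theorem greenTotal_eq (x : ℝ) : 2 * k * greenFun k w x x + greenTotal k hre w x = 1 := by
  have h := schrodingerOp_greenFun hk w x (expTest k hre x)
  rw [expTest_self] at h
  rw [← h, greenTotal, ← freeForm_expTest hre]
  rfl

theorem greenFun_eq_of_le {a s y : ℝ} (has : a ≤ s) (hsy : s ≤ y) (hre : 0 < k.re) :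
    greenFun k w a y = greenFun k w a s / greenFun k w s s * greenFun k w s y := by
  have h := greenFun_mul_self hk w hre has hsy
  have h0 := greenFun_self_ne_zero hk w hre s
  rw [div_mul_eq_mul_div, eq_div_iff h0, h]

omit hk in
theorem expTest_eq_of_le {a s y : ℝ} (has : a ≤ s) (hsy : s ≤ y) :
    expTest k hre a y = expTest k hre a s * expTest k hre s y := by
  rw [expTest_apply, expTest_apply, expTest_apply, ← Complex.exp_add, abs_of_nonneg (by linarith),
    abs_of_nonneg (by linarith), abs_of_nonneg (by linarith)]
  push_cast; congr 1; ring

/-- On the right of `s` the functions `G(a, ·)` and `exp(-k |· - a|)` are constant multiples of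
those centred at `s`, so the tail rescales to `greenTail` at `s`. In this way `weylQuot` does not
depend on the pole `a`. -/
theorem integral_formDensity_Ioi {a s : ℝ} (has : a ≤ s) :
    ∫ y in Ioi s, formDensity k w (greenFun k w a) (expTest k hre a) y
      = -(weylQuot k hre w s * (greenFun k w a s * expTest k hre a s)) := by
  have h0 := greenFun_self_ne_zero hk w hre s
  have hG : ∀ y, s < y → deriv (greenFun k w a) y
      = greenFun k w a s / greenFun k w s s * deriv (greenFun k w s) y := by
    intro y hy
    have : (greenFun k w a : ℝ → ℂ) =ᶠ[𝓝 y]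
        fun z => greenFun k w a s / greenFun k w s s * greenFun k w s z := by
      filter_upwards [Ioi_mem_nhds hy] with z hz
      exact greenFun_eq_of_le hk w has (mem_Ioi.1 hz).le hre
    rw [this.deriv_eq, deriv_const_mul_field]
  have hE : ∀ y, s < y → deriv (expTest k hre a) y
      = expTest k hre a s * deriv (expTest k hre s) y := by
    intro y hy
    have : (expTest k hre a : ℝ → ℂ) =ᶠ[𝓝 y] fun z => expTest k hre a s * expTest k hre s z := by
      filter_upwards [Ioi_mem_nhds hy] with z hz
      exact expTest_eq_of_le hre has (mem_Ioi.1 hz).le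
    rw [this.deriv_eq, deriv_const_mul_field]
  have h1 : ∫ y in Ioi s, potentialDensity w (greenFun k w a) (expTest k hre a) y
      = greenFun k w a s / greenFun k w s s * expTest k hre a s * greenTail k hre w s := by
    rw [greenTail, ← integral_const_mul]
    refine setIntegral_congr_fun measurableSet_Ioi fun y hy => ?_
    have hy' := mem_Ioi.1 hy
    simp only [potentialDensity]
    rw [hG y hy', hE y hy', greenFun_eq_of_le hk w has hy'.le hre,
      expTest_eq_of_le hre has hy'.le]
    ring
  simp only [formDensity]
  rw [integral_add (integrable_freeDensity k _ _).integrableOn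
    (integrable_potentialDensity w _ _).integrableOn, integral_freeDensity_Ioi hre has, h1,
    weylQuot]
  field_simp
  ring

/-- Ramps that vanish up to a point `c ≥ a` do not see the pole, so the form against them is zero.
The first order identity then equates quasi-derivative and tail, and the exponential is divided out.
-/
theorem deriv_greenFun_ae (a : ℝ) : ∀ᵐ s, a ≤ s → deriv (greenFun k w a) s
      = (weylQuot k hre w s - ((deriv w s : ℝ) : ℂ)) * greenFun k w a s := by
  have h := ae_of_schrodingerOp_ramp k w (greenFun k w a) (expTest k hre a) (s := Ici a) 0
    fun c hc d _ hcd => by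
      rw [schrodingerOp_greenFun hk, H1.ramp_apply, ramp_of_le (mem_Ici.1 hc), zero_mul]
  filter_upwards [h] with s hs has
  have h1 := hs has
  rw [integral_formDensity_Ioi hk hre w has] at h1
  have h2 : (deriv (greenFun k w a) s
      - (weylQuot k hre w s - ((deriv w s : ℝ) : ℂ)) * greenFun k w a s)
      * expTest k hre a s = 0 := by linear_combination h1
  exact sub_eq_zero.1 ((mul_eq_zero.1 h2).resolve_right (expTest_ne_zero hre a s))

/-- Between the poles, a ramp vanishes at `a` and equals `1` at `b`. Testing `G(a, ·)` with the ramp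
times `G(b, ·)` gives `0`, testing `G(b, ·)` with the ramp times `G(a, ·)` gives `G(a,b)`. In the
difference the tails cancel by symmetry, and so do the terms with `w'`. -/
theorem wronskian_ae (a b : ℝ) : ∀ᵐ x, x ∈ Icc a b →
    greenFun k w a x * deriv (greenFun k w b) x - deriv (greenFun k w a) x * greenFun k w b x
      = greenFun k w a b := by
  have h1 := ae_of_schrodingerOp_ramp k w (greenFun k w a) (greenFun k w b) (s := Icc a b) 0
    fun c hc d _ hcd => by
      rw [schrodingerOp_greenFun hk, H1.ramp_apply, ramp_of_le hc.1, zero_mul]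
  have h2 := ae_of_schrodingerOp_ramp k w (greenFun k w b) (greenFun k w a) (s := Icc a b)
    (greenFun k w a b) fun c _ d hd hcd => by
      rw [schrodingerOp_greenFun hk, H1.ramp_apply, ramp_of_ge hcd hd.2, one_mul]
  filter_upwards [h1, h2] with x h1 h2 hx
  have h3 := h1 hx
  have h4 := h2 hx
  rw [formDensity_comm] at h4
  linear_combination h4 - h3

/-- The Riccati equation. -/
theorem hasPrim_weylQuot : HasPrim univ (weylQuot k hre w)
    (fun x => k ^ 2 + 4 * ((w x : ℝ) : ℂ) - (weylQuot k hre w x - ((deriv w x : ℝ) : ℂ)) ^ 2) := by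
  -- `G(a, ·)` is known to follow the Weyl solution only on the right of `a`; half lines suffice
  -- since `a` is arbitrary.
  suffices h : ∀ a, HasPrim (Ici a) (weylQuot k hre w) (fun x => k ^ 2 + 4 * ((w x : ℝ) : ℂ)
      - (weylQuot k hre w x - ((deriv w x : ℝ) : ℂ)) ^ 2) from
    fun x _ y _ => h (min x y) x (mem_Ici.2 (min_le_left _ _)) y (mem_Ici.2 (min_le_right _ _))
  intro a
  set G := greenFun k w a with hG
  set φ := expTest k hre a with hφ
  have hn : ∀ x ∈ Ici a, G x * φ x ≠ 0 := fun x hx =>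
    mul_ne_zero (greenFun_ne_zero hk w hre hx) (expTest_ne_zero hre a x)
  -- `P` is minus the tail of the form divided by `G φ`. Both are absolutely continuous, which is
  -- why `P` is, although `w'` and `G'` need not be; the quotient rule gives the Riccati equation.
  have h1 := ((hasPrim_tail (integrable_formDensity k w G φ)).mono (subset_univ (Ici a))).mul
    (((G.hasPrim_mul φ).mono (subset_univ (Ici a))).inv hn) |>.const_mul (-1)
  refine h1.congr (fun x hx => ?_) ?_
  · simp only
    rw [integral_formDensity_Ioi hk hre w hx, neg_one_mul, neg_mul, neg_neg, ← div_eq_mul_inv,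
      mul_div_cancel_right₀ _ (hn x hx)]
  · have hne : ∀ᵐ x : ℝ, x ≠ a := by simp [ae_iff]
    filter_upwards [deriv_greenFun_ae hk hre w a, deriv_expTest_right hre a, hne] with x h2 h3 h4 hx
    have hG0 : G x ≠ 0 := greenFun_ne_zero hk w hre hx
    have hφ0 : φ x ≠ 0 := expTest_ne_zero hre a x
    have h2' := h2 hx
    have h3' := h3 (lt_of_le_of_ne hx h4.symm)
    rw [← hG] at h2'
    rw [← hφ] at h3'
    rw [integral_formDensity_Ioi hk hre w hx, formDensity, potentialDensity, ← hG, ← hφ, h3', h2']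
    field_simp
    ring

/-- On `[a, b]` the factorization reads `g(x) = G(a,x) G(b,x) / G(a,b)`. The derivative of `G(b, ·)`
on the left of its pole is eliminated by the Wronskian, which contributes the summand `1`. -/
theorem hasPrim_diag : HasPrim univ (fun x => greenFun k w x x) (fun x =>
    2 * greenFun k w x x * (weylQuot k hre w x - ((deriv w x : ℝ) : ℂ)) + 1) := by
  suffices h : ∀ a b, a ≤ b → HasPrim (Icc a b) (fun x => greenFun k w x x) (fun x =>
      2 * greenFun k w x x * (weylQuot k hre w x - ((deriv w x : ℝ) : ℂ)) + 1) from
    fun x _ y _ => h (min x y) (max x y) (min_le_max) x ⟨min_le_left _ _, le_max_left _ _⟩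
      y ⟨min_le_right _ _, le_max_right _ _⟩
  intro a b hab
  have h0 := greenFun_ne_zero hk w hre hab
  have hg : ∀ x ∈ Icc a b, greenFun k w x x
      = (greenFun k w a b)⁻¹ * (greenFun k w a x * greenFun k w b x) := by
    intro x hx
    have h := greenFun_mul_self hk w hre hx.1 hx.2
    rw [greenFun_symm hk w b x, ← h]
    field_simp
  refine ((((greenFun k w a).hasPrim_mul (greenFun k w b)).mono (subset_univ _)).const_mul
    (greenFun k w a b)⁻¹).congr hg ?_
  filter_upwards [deriv_greenFun_ae hk hre w a, wronskian_ae hk w a b] with x h1 h2 hx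
  have h3 := h2 hx
  have h4 := h1 hx.1
  have h5 : greenFun k w a x * deriv (greenFun k w b) x
      = greenFun k w a b + deriv (greenFun k w a) x * greenFun k w b x := by
    linear_combination h3
  rw [h5, hg x hx, h4]
  field_simp
  ring

/-- The derivative of the diagonal Green function. -/
theorem hasPrim_diag' : HasPrim univ (fun x => greenFun k w x x) (fun x =>
    -2 * (((deriv w x : ℝ) : ℂ) * greenFun k w x x) - 2 * greenTail k hre w x
      + greenTotal k hre w x) := by
  refine (hasPrim_diag hk hre w).congr (fun _ _ => rfl) (.of_forall fun x _ => ?_)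
  have h0 := greenFun_self_ne_zero hk w hre x
  -- Replacing `1` by `2 k g + greenTotal` cancels the term `-2 k g` of `2 g P`; the terms that
  -- remain are square integrable over a period cell.
  rw [← greenTotal_eq hk hre w x, weylQuot]
  field_simp
  ring

theorem continuous_diag (hre : 0 < k.re) : Continuous fun x => greenFun k w x x :=
  continuous_iff_continuousAt.2 fun x => ((hasPrim_diag hk hre w).continuousOn_uIcc
    (mem_univ (x - 1)) (mem_univ (x + 1))).continuousAt (by
      rw [uIcc_of_le (by linarith)]; exact Icc_mem_nhds (by linarith) (by linarith))

theorem deriv_diag_ae : ∀ᵐ x, deriv (fun x => greenFun k w x x) x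
    = 2 * greenFun k w x x * (weylQuot k hre w x - ((deriv w x : ℝ) : ℂ)) + 1 :=
  (hasPrim_diag hk hre w).deriv_ae

end Riccati

/-! ### Periodicity -/

section Periodic

attribute [local instance] H1.normedSpace

variable {L : ENNReal} [Fact (1 ≤ L)] {k : ℂ}

/-- The translate `u (· - p)`. -/
def H1.translate (p : ℝ) (u : H1 ℂ ⊤) : H1 ℂ ⊤ :=
  ⟨fun y => u (y - p), by
    have h : ∀ {v : ℝ → ℂ}, MemLp v 2 → MemLp (fun y => v (y - p)) 2 := fun hv =>
      hv.comp_measurePreserving (measurePreserving_sub_right volume p)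
    refine memH1_top_of_hasPrim (h := fun y => deriv u (y - p)) (fun a _ b _ => ⟨?_, ?_⟩)
      (h u.memLp_line) (h u.memLp_deriv_line)
    · have := u.mem.intervalIntegrable_deriv (a - p) (b - p)
      simpa using this.comp_sub_right p
    · rw [intervalIntegral.integral_comp_sub_right (deriv u), u.mem.integral_deriv]⟩

theorem H1.translate_apply (p : ℝ) (u : H1 ℂ ⊤) (y : ℝ) : u.translate p y = u (y - p) := rfl

theorem H1.deriv_translate (p : ℝ) (u : H1 ℂ ⊤) (y : ℝ) :
    deriv (u.translate p) y = deriv u (y - p) :=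
  deriv_comp_sub_const (f := u) p y

theorem potentialDensity_translate (w : H1 ℝ L) (hL : L ≠ ⊤) (u φ : H1 ℂ ⊤) (y : ℝ) :
    potentialDensity w (u.translate (2 * L.toReal)) (φ.translate (2 * L.toReal)) y
      = potentialDensity w u φ (y - 2 * L.toReal) := by
  rw [potentialDensity, potentialDensity, H1.deriv_translate, H1.deriv_translate,
    H1.translate_apply, H1.translate_apply, (w.mem.periodic hL).sub_eq y,
    (w.deriv_periodic hL).sub_eq y]

theorem schrodingerOp_translate (k : ℂ) (w : H1 ℝ L) (hL : L ≠ ⊤) (u φ : H1 ℂ ⊤) :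
    schrodingerOp k w (u.translate (2 * L.toReal)) (φ.translate (2 * L.toReal))
      = schrodingerOp k w u φ := by
  rw [schrodingerOp_eq_integral, schrodingerOp_eq_integral,
    ← integral_sub_right_eq_self (formDensity k w u φ) (2 * L.toReal)]
  refine integral_congr_ae (.of_forall fun y => ?_)
  simp only [formDensity]
  rw [potentialDensity_translate w hL, H1.deriv_translate, H1.deriv_translate,
    H1.translate_apply, H1.translate_apply]

/-- Translation by a period preserves the form, so the translate solves the equation with the
translated pole; uniqueness identifies it. -/
theorem greenFun_translate (hk : 0 < (k ^ 2).im) (w : H1 ℝ L) (hL : L ≠ ⊤) (x : ℝ) :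
    (greenFun k w x).translate (2 * L.toReal) = greenFun k w (x + 2 * L.toReal) := by
  refine eq_greenFun hk w fun φ => ?_
  have h : φ = (φ.translate (-(2 * L.toReal))).translate (2 * L.toReal) :=
    H1.ext fun y => by rw [H1.translate_apply, H1.translate_apply]; ring_nf
  rw [h, schrodingerOp_translate k w hL, schrodingerOp_greenFun hk, H1.translate_apply,
    H1.translate_apply, H1.translate_apply]
  ring_nf

theorem expTest_translate (hre : 0 < k.re) (p x : ℝ) :
    (expTest k hre x).translate p = expTest k hre (x + p) :=
  H1.ext fun y => by
    rw [H1.translate_apply, expTest_apply, expTest_apply]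
    congr 4; ring

theorem diag_periodic (hk : 0 < (k ^ 2).im) (w : H1 ℝ L) (hL : L ≠ ⊤) :
    Function.Periodic (fun x => greenFun k w x x) (2 * L.toReal) := by
  intro x
  simp only
  rw [← greenFun_translate hk w hL, H1.translate_apply]
  ring_nf

theorem greenTail_periodic (hk : 0 < (k ^ 2).im) (hre : 0 < k.re) (w : H1 ℝ L) (hL : L ≠ ⊤) :
    Function.Periodic (greenTail k hre w) (2 * L.toReal) := by
  intro x
  rw [greenTail, greenTail, ← greenFun_translate hk w hL, ← expTest_translate hre]
  simp only [potentialDensity_translate w hL]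
  have h := (measurePreserving_sub_right volume (2 * L.toReal)).setIntegral_preimage_emb
    (MeasurableEquiv.subRight (2 * L.toReal)).measurableEmbedding
    (potentialDensity w (greenFun k w x) (expTest k hre x)) (Ioi x)
  rw [← h]
  simp

theorem weylQuot_periodic (hk : 0 < (k ^ 2).im) (hre : 0 < k.re) (w : H1 ℝ L) (hL : L ≠ ⊤) :
    Function.Periodic (weylQuot k hre w) (2 * L.toReal) := by
  intro x
  rw [weylQuot, weylQuot, greenTail_periodic hk hre w hL x]
  congr 2
  exact diag_periodic hk w hL x

end Periodic

end DiagonalGreen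

namespace DiagonalGreen

/-- The space of bounded operators `H⁻¹(ℝ; ℂ) → H¹(ℝ; ℂ)`. -/
abbrev ResolventSpace : Type :=
  @ContinuousLinearMap ℂ ℂ _ _ (RingHom.id ℂ) (StrongDual ℂ (H1 ℂ ⊤)) _ _ (H1 ℂ ⊤) _ _ _ _

/-! ### Kernels of bounded operators from `H⁻¹` to `H¹` -/

section PointMass

attribute [local instance] H1.normedSpace

theorem H1.norm_sub_apply_le (u : H1 ℂ ⊤) {x y : ℝ} (hxy : x ≤ y) :
    ‖u y - u x‖ ≤ Real.sqrt (y - x) * ‖u‖ := by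
  have h1 : MemLp (fun _ : ℝ => (1 : ℂ)) 2 (volume.restrict (Ioc x y)) := memLp_const 1
  have h2 : MemLp (deriv u) 2 (volume.restrict (Ioc x y)) := u.memLp_deriv_line.restrict _
  have h3 := integral_norm_mul_le_of_sq_le h1 h2 (Real.sqrt_nonneg (y - x)) (norm_nonneg u)
    (by rw [Real.sq_sqrt (by linarith)]; simp [hxy])
    (le_trans (setIntegral_le_integral (u.memLp_deriv_line.integrable_norm_pow (by norm_num))
      (.of_forall fun _ => by positivity)) u.integral_deriv_sq_le)
  rw [← u.mem.integral_deriv x y, intervalIntegral.integral_of_le hxy]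
  refine (norm_integral_le_integral_norm _).trans ?_
  simpa using h3

/-- Functions of class `H¹` are Hölder continuous of order `1/2` with constant at most their norm.
Norm continuity of `δ_x` makes kernels jointly continuous, hence their derivatives in `y` jointly
measurable. -/
theorem continuous_pointMass : Continuous pointMass := by
  have hb : ∀ x y, x ≤ y → ‖pointMass y - pointMass x‖ ≤ Real.sqrt (y - x) := fun x y hxy =>
    ContinuousLinearMap.opNorm_le_bound _ (Real.sqrt_nonneg _) fun u => u.norm_sub_apply_le hxy
  have hb' : ∀ x y, ‖pointMass y - pointMass x‖ ≤ Real.sqrt |y - x| := by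
    intro x y
    rcases le_total x y with h | h
    · rw [abs_of_nonneg (by linarith)]; exact hb x y h
    · rw [norm_sub_rev, abs_sub_comm, abs_of_nonneg (by linarith)]; exact hb y x h
  refine continuous_iff_continuousAt.2 fun x => tendsto_iff_norm_sub_tendsto_zero.2 ?_
  refine squeeze_zero (fun _ => norm_nonneg _) (fun y => hb' x y) ?_
  have : Continuous fun y : ℝ => Real.sqrt |y - x| := by fun_prop
  simpa using this.tendsto x

theorem norm_pointMass_le (x : ℝ) : ‖pointMass x‖ ≤ 2 :=
  ContinuousLinearMap.opNorm_le_bound _ (by norm_num) fun u => u.norm_apply_le x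

theorem continuous_resolvent_apply (R : ResolventSpace) :
    Continuous (Function.uncurry fun x y : ℝ => R (pointMass x) y) := by
  have h1 : Continuous fun x => R (pointMass x) := R.continuous.comp continuous_pointMass
  refine continuous_iff_continuousAt.2 fun ⟨x, y⟩ => ?_
  refine tendsto_iff_norm_sub_tendsto_zero.2 ?_
  refine squeeze_zero (fun _ => norm_nonneg _) (g := fun p : ℝ × ℝ =>
    2 * ‖R (pointMass p.1) - R (pointMass x)‖ + ‖R (pointMass x) p.2 - R (pointMass x) y‖) ?_ ?_
  · intro p
    have h2 := (R (pointMass p.1) - R (pointMass x)).norm_apply_le p.2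
    have h3 : Function.uncurry (fun x y : ℝ => R (pointMass x) y) p
        - Function.uncurry (fun x y : ℝ => R (pointMass x) y) (x, y)
        = (R (pointMass p.1) - R (pointMass x)) p.2
          + (R (pointMass x) p.2 - R (pointMass x) y) := by
      rw [H1.coe_sub, Pi.sub_apply]
      simp only [Function.uncurry]
      ring
    rw [h3]
    exact (norm_add_le _ _).trans (by gcongr)
  · have h4 : Continuous fun p : ℝ × ℝ => 2 * ‖R (pointMass p.1) - R (pointMass x)‖
        + ‖R (pointMass x) p.2 - R (pointMass x) y‖ := by
      have h5 := (R (pointMass x)).mem.continuous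
      have h6 := continuous_pointMass
      fun_prop
    simpa using h4.tendsto (x, y)

end PointMass

/-! ### Bounded bilinear maps into `L²` -/

section Bilinear

variable {E₁ E₂ : Type} [NormedAddCommGroup E₁] [NormedSpace ℝ E₁] [NormedAddCommGroup E₂]
  [NormedSpace ℝ E₂] {μ : Measure ℝ}

/-- A bilinear construction of square integrable functions with a norm bound defines a bounded
bilinear map into `L²`. -/
theorem isBoundedBilinearMap_toLp (f : E₁ → E₂ → ℝ → ℂ) (hf : ∀ u v, MemLp (f u v) 2 μ)
    (add_left : ∀ u u' v, ∀ᵐ x ∂μ, f (u + u') v x = f u v x + f u' v x)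
    (smul_left : ∀ (c : ℝ) u v, ∀ᵐ x ∂μ, f (c • u) v x = c * f u v x)
    (add_right : ∀ u v v', ∀ᵐ x ∂μ, f u (v + v') x = f u v x + f u v' x)
    (smul_right : ∀ (c : ℝ) u v, ∀ᵐ x ∂μ, f u (c • v) x = c * f u v x)
    {C : ℝ} (hC : 0 < C) (bound : ∀ u v, ∫ x, ‖f u v x‖ ^ 2 ∂μ ≤ (C * ‖u‖ * ‖v‖) ^ 2) :
    IsBoundedBilinearMap ℝ fun p : E₁ × E₂ => (hf p.1 p.2).toLp (f p.1 p.2) := by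
  have hadd : ∀ {a b c : ℝ → ℂ} (ha : MemLp a 2 μ) (hb : MemLp b 2 μ) (hc : MemLp c 2 μ),
      (∀ᵐ x ∂μ, a x = b x + c x) → ha.toLp a = hb.toLp b + hc.toLp c := by
    intro a b c ha hb hc h
    rw [← MemLp.toLp_add]
    exact MemLp.toLp_congr _ _ h
  have hsmul : ∀ {a b : ℝ → ℂ} (c : ℝ) (ha : MemLp a 2 μ) (hb : MemLp b 2 μ),
      (∀ᵐ x ∂μ, a x = c * b x) → ha.toLp a = c • hb.toLp b := by
    intro a b c ha hb h
    rw [← MemLp.toLp_const_smul]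
    refine MemLp.toLp_congr _ _ ?_
    filter_upwards [h] with x hx
    rw [hx, Pi.smul_apply, Complex.real_smul]
  exact
    { add_left := fun u u' v => hadd _ _ _ (add_left u u' v)
      smul_left := fun c u v => hsmul c _ _ (smul_left c u v)
      add_right := fun u v v' => hadd _ _ _ (add_right u v v')
      smul_right := fun c u v => hsmul c _ _ (smul_right c u v)
      bound := ⟨C, hC, fun u v => by
        refine le_of_sq_le_sq ?_ (by positivity)
        rw [norm_toLp_sq]
        exact bound u v⟩ }

end Bilinear

/-! ### Exponentially localized integrals in `L²` of a period cell -/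

section Convolution

attribute [local instance] H1.normedSpace

variable {L : ENNReal} [Fact (1 ≤ L)]

theorem integral_cell_energy_add (w : H1 ℝ L) (s : ℝ) :
    ∫⁻ x in cell L, ENNReal.ofReal (‖deriv w (x + s)‖ ^ 2 + 4 * ‖w (x + s)‖ ^ 2)
      = ENNReal.ofReal (‖w‖ ^ 2) := by
  set e : ℝ → ℝ := fun x => ‖deriv w x‖ ^ 2 + 4 * ‖w x‖ ^ 2 with he
  have he0 : ∀ x, 0 ≤ e x := fun x => by positivity
  by_cases hT : L = ⊤
  · subst hT
    have hi := w.integrable_energy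
    rw [H1.norm_sq]
    rw [cell_top, Measure.restrict_univ] at hi ⊢
    rw [ofReal_integral_eq_lintegral_ofReal hi (.of_forall he0)]
    exact lintegral_add_right_eq_self (fun x => ENNReal.ofReal (e x)) s
  · have hl := one_le_toReal (L := L) hT
    have h1 := (w.intervalIntegrable_energy (-L.toReal + s) (L.toReal + s)).comp_add_right s
    simp only [add_sub_cancel_right] at h1
    rw [intervalIntegrable_iff_integrableOn_Ioo_of_le (by linarith)] at h1
    rw [H1.norm_sq, cell_of_ne_top hT, ← ofReal_integral_eq_lintegral_ofReal h1
      (.of_forall fun x => he0 _), ← integral_Ioc_eq_integral_Ioo,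
      ← integral_Ioc_eq_integral_Ioo, ← intervalIntegral.integral_of_le (by linarith),
      ← intervalIntegral.integral_of_le (by linarith),
      intervalIntegral.integral_comp_add_right (fun x => e x) s]
    have h2 := (w.energy_periodic hT).intervalIntegral_add_eq (-L.toReal + s) (-L.toReal)
    rw [show -L.toReal + s + 2 * L.toReal = L.toReal + s by ring,
      show -L.toReal + 2 * L.toReal = L.toReal by ring] at h2
    rw [h2]

/-- The energy density of `w`, averaged with an exponential weight around `x`. -/
def weightedEnergy (κ : ℝ) (w : H1 ℝ L) (x : ℝ) : ℝ :=
  ∫ y, (‖deriv w y‖ ^ 2 + 4 * ‖w y‖ ^ 2) * Real.exp (-κ * |y - x|) ^ 2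

variable {κ : ℝ} (hκ : 0 < κ)
include hκ

theorem integrable_weightedEnergy (w : H1 ℝ L) (x : ℝ) : Integrable fun y =>
    (‖deriv w y‖ ^ 2 + 4 * ‖w y‖ ^ 2) * Real.exp (-κ * |y - x|) ^ 2 := by
  -- The weight is the exponential test function with real parameter `κ`, so the multiplier bounds
  -- for `H¹` functions apply.
  have hre : 0 < (κ : ℂ).re := by simpa using hκ
  have h1 := (memLp_deriv_mul w (expTest κ hre x)).integrable_norm_pow (by norm_num)
  have h2 := (H1.memLp_ofReal_mul w (expTest κ hre x)).integrable_norm_pow (by norm_num)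
  refine (h1.add (h2.const_mul 4)).congr (.of_forall fun y => ?_)
  simp only [Pi.add_apply, norm_mul, Complex.norm_real, expTest_apply, norm_exp_abs,
    Complex.ofReal_re]
  ring

/-- After the substitution `y = x + s` and Tonelli, the energy over the shifted cell is `‖w‖²` for
every `s`, and the exponential weight integrates separately. -/
theorem lintegral_weightedEnergy_le (w : H1 ℝ L) :
    ∫⁻ x in cell L, ENNReal.ofReal (weightedEnergy κ w x)
      ≤ ENNReal.ofReal (‖w‖ ^ 2 * ∫ s : ℝ, Real.exp (-(2 * κ) * |s|)) := by
  have hm : Measurable fun p : ℝ × ℝ => ENNReal.ofReal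
      ((‖deriv w (p.1 + p.2)‖ ^ 2 + 4 * ‖w (p.1 + p.2)‖ ^ 2) * Real.exp (-κ * |p.2|) ^ 2) := by
    have h1 : Measurable (deriv w) := measurable_deriv _
    have h2 : Measurable w := w.mem.continuous.measurable
    fun_prop
  calc ∫⁻ x in cell L, ENNReal.ofReal (weightedEnergy κ w x)
      = ∫⁻ x in cell L, ∫⁻ s, ENNReal.ofReal
          ((‖deriv w (x + s)‖ ^ 2 + 4 * ‖w (x + s)‖ ^ 2) * Real.exp (-κ * |s|) ^ 2) := by
        refine lintegral_congr fun x => ?_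
        rw [weightedEnergy, ofReal_integral_eq_lintegral_ofReal (integrable_weightedEnergy hκ w x)
          (.of_forall fun y => by positivity), ← lintegral_add_left_eq_self _ x]
        simp
    _ = ∫⁻ s, ∫⁻ x in cell L, ENNReal.ofReal
          ((‖deriv w (x + s)‖ ^ 2 + 4 * ‖w (x + s)‖ ^ 2) * Real.exp (-κ * |s|) ^ 2) :=
        lintegral_lintegral_swap hm.aemeasurable
    _ = ∫⁻ s, ENNReal.ofReal (‖w‖ ^ 2) * ENNReal.ofReal (Real.exp (-(2 * κ) * |s|)) := by
        refine lintegral_congr fun s => ?_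
        rw [← integral_cell_energy_add w s, ← lintegral_mul_const]
        · refine lintegral_congr fun x => ?_
          rw [← ENNReal.ofReal_mul (by positivity), ← Real.exp_nat_mul]
          push_cast; ring_nf
        · have h1 : Measurable (deriv w) := measurable_deriv _
          have h2 : Measurable w := w.mem.continuous.measurable
          fun_prop
    _ ≤ _ := by
        rw [lintegral_const_mul _ (by fun_prop), ← ofReal_integral_eq_lintegral_ofReal
          (integrable_exp_abs (by linarith)) (.of_forall fun _ => by positivity),
          ← ENNReal.ofReal_mul (by positivity)]

omit hκ

/-- The integrand of `potentialDensity`, with the test function and its derivative replaced by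
translates of given functions. -/
def kernelDensity (θ ϑ : ℝ → ℂ) (w : H1 ℝ L) (u : H1 ℂ ⊤) (x y : ℝ) : ℂ :=
  4 * ((w y : ℝ) : ℂ) * (u y * θ (y - x))
    + ((deriv w y : ℝ) : ℂ) * (deriv u y * θ (y - x) + u y * ϑ (y - x))

theorem kernelDensity_eq (θ ϑ : ℝ → ℂ) (w : H1 ℝ L) (u : H1 ℂ ⊤) (x y : ℝ) :
    kernelDensity θ ϑ w u x y = 4 * (((w y : ℝ) : ℂ) * θ (y - x) * u y)
      + (((deriv w y : ℝ) : ℂ) * θ (y - x) * deriv u y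
        + ((deriv w y : ℝ) : ℂ) * ϑ (y - x) * u y) := by
  rw [kernelDensity]; ring

/-- The integral of `kernelDensity` at `u = R δ_x`. -/
def kernelIntegral (θ ϑ : ℝ → ℂ) (w : H1 ℝ L) (R : ResolventSpace) (x : ℝ) : ℂ :=
  ∫ y, kernelDensity θ ϑ w (R (pointMass x)) x y

variable {θ ϑ : ℝ → ℂ} (hθ : Measurable θ) (hϑ : Measurable ϑ) {C : ℝ}
  (hθC : ∀ s, ‖θ s‖ ≤ C * Real.exp (-κ * |s|)) (hϑC : ∀ s, ‖ϑ s‖ ≤ C * Real.exp (-κ * |s|))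

include hκ hθ hθC in
theorem memLp_deriv_mul_kernel (w : H1 ℝ L) (x : ℝ) :
    MemLp (fun y => ((deriv w y : ℝ) : ℂ) * θ (y - x)) 2 := by
  have hre : 0 < (κ : ℂ).re := by simpa using hκ
  refine MemLp.of_le_mul (c := C) (memLp_deriv_mul w (expTest κ hre x)) ?_ (.of_forall fun y => ?_)
  · have h1 : Measurable (deriv w) := measurable_deriv _
    fun_prop
  · rw [norm_mul, norm_mul, expTest_apply, norm_exp_abs, mul_left_comm]
    gcongr
    exact hθC _

include hκ hθ hθC in
theorem memLp_mul_kernel (w : H1 ℝ L) (x : ℝ) :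
    MemLp (fun y => ((w y : ℝ) : ℂ) * θ (y - x)) 2 := by
  have hre : 0 < (κ : ℂ).re := by simpa using hκ
  refine MemLp.of_le_mul (c := C) (H1.memLp_ofReal_mul w (expTest κ hre x)) ?_
    (.of_forall fun y => ?_)
  · have h1 : Measurable w := w.mem.continuous.measurable
    fun_prop
  · rw [norm_mul, norm_mul, expTest_apply, norm_exp_abs, mul_left_comm]
    gcongr
    exact hθC _

include hκ hθC in
theorem integral_deriv_mul_kernel_le (w : H1 ℝ L) (x : ℝ) :
    ∫ y, ‖((deriv w y : ℝ) : ℂ) * θ (y - x)‖ ^ 2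
      ≤ (C * Real.sqrt (weightedEnergy κ w x)) ^ 2 := by
  have h0 : 0 ≤ weightedEnergy κ w x := integral_nonneg fun y => by positivity
  rw [mul_pow, Real.sq_sqrt h0, weightedEnergy, ← integral_const_mul]
  refine integral_mono_of_nonneg (.of_forall fun y => by positivity)
    ((integrable_weightedEnergy hκ w x).const_mul _) (.of_forall fun y => ?_)
  have h1 := pow_le_pow_left₀ (norm_nonneg _) (hθC (y - x)) 2
  simp only [norm_mul, mul_pow, Complex.norm_real]
  rw [mul_pow] at h1
  have h2 := mul_le_mul_of_nonneg_left h1 (sq_nonneg ‖deriv w y‖)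
  have h3 : 0 ≤ C ^ 2 * (4 * ‖w y‖ ^ 2 * Real.exp (-κ * |y - x|) ^ 2) := by positivity
  linarith

include hκ hθC in
theorem integral_mul_kernel_le (w : H1 ℝ L) (x : ℝ) :
    ∫ y, ‖((w y : ℝ) : ℂ) * θ (y - x)‖ ^ 2
      ≤ (C * Real.sqrt (weightedEnergy κ w x)) ^ 2 := by
  have h0 : 0 ≤ weightedEnergy κ w x := integral_nonneg fun y => by positivity
  rw [mul_pow, Real.sq_sqrt h0, weightedEnergy, ← integral_const_mul]
  refine integral_mono_of_nonneg (.of_forall fun y => by positivity)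
    ((integrable_weightedEnergy hκ w x).const_mul _) (.of_forall fun y => ?_)
  have h1 := pow_le_pow_left₀ (norm_nonneg _) (hθC (y - x)) 2
  simp only [norm_mul, mul_pow, Complex.norm_real]
  rw [mul_pow] at h1
  have h2 := mul_le_mul_of_nonneg_left h1 (sq_nonneg ‖w y‖)
  have h3 : 0 ≤ C ^ 2 * ((‖deriv w y‖ ^ 2 + 3 * ‖w y‖ ^ 2) * Real.exp (-κ * |y - x|) ^ 2) := by
    positivity
  linarith

include hκ hθ hϑ hθC hϑC

theorem integrable_kernelDensity (w : H1 ℝ L) (u : H1 ℂ ⊤) (x : ℝ) :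
    Integrable (kernelDensity θ ϑ w u x) := by
  have h1 := integrable_mul_of_memLp_two (memLp_mul_kernel hκ hθ hθC w x) u.memLp_line
  have h2 := integrable_mul_of_memLp_two (memLp_deriv_mul_kernel hκ hθ hθC w x) u.memLp_deriv_line
  have h3 := integrable_mul_of_memLp_two (memLp_deriv_mul_kernel hκ hϑ hϑC w x) u.memLp_line
  exact ((h1.const_mul 4).add (h2.add h3)).congr
    (.of_forall fun y => (kernelDensity_eq θ ϑ w u x y).symm)

/-- Cauchy–Schwarz in `y` with the exponential weight put on `w`. All dependence on `x` is then in
the weighted energy, as `u = R δ_x` is bounded uniformly in `x`. -/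
theorem norm_integral_kernelDensity_le (hC : 0 ≤ C) (w : H1 ℝ L) (u : H1 ℂ ⊤) (x : ℝ) :
    ‖∫ y, kernelDensity θ ϑ w u x y‖ ≤ 4 * C * Real.sqrt (weightedEnergy κ w x) * ‖u‖ := by
  have m1 := memLp_mul_kernel hκ hθ hθC w x
  have m2 := memLp_deriv_mul_kernel hκ hθ hθC w x
  have m3 := memLp_deriv_mul_kernel hκ hϑ hϑC w x
  have i1 := integrable_mul_of_memLp_two m1 u.memLp_line
  have i2 := integrable_mul_of_memLp_two m2 u.memLp_deriv_line
  have i3 := integrable_mul_of_memLp_two m3 u.memLp_line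
  have h1 := integral_norm_mul_le_of_sq_le m1 u.memLp_line (by positivity) (by positivity)
    (integral_mul_kernel_le hκ hθC w x) u.integral_sq_le
  have h2 := integral_norm_mul_le_of_sq_le m2 u.memLp_deriv_line (by positivity) (by positivity)
    (integral_deriv_mul_kernel_le hκ hθC w x) u.integral_deriv_sq_le
  have h3 := integral_norm_mul_le_of_sq_le m3 u.memLp_line (by positivity) (by positivity)
    (integral_deriv_mul_kernel_le hκ hϑC w x) u.integral_sq_le
  have h4 : ‖∫ y, kernelDensity θ ϑ w u x y‖
      ≤ ∫ y, (4 * ‖((w y : ℝ) : ℂ) * θ (y - x) * u y‖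
        + (‖((deriv w y : ℝ) : ℂ) * θ (y - x) * deriv u y‖
        + ‖((deriv w y : ℝ) : ℂ) * ϑ (y - x) * u y‖)) := by
    refine norm_integral_le_of_norm_le ((i1.norm.const_mul _).add (i2.norm.add i3.norm))
      (.of_forall fun y => ?_)
    rw [kernelDensity_eq]
    refine (norm_add_le _ _).trans (add_le_add ?_ (norm_add_le _ _))
    rw [norm_mul]; simp
  rw [integral_add (i1.norm.const_mul _) (by exact i2.norm.add i3.norm),
    integral_add i2.norm i3.norm, integral_const_mul] at h4
  refine h4.trans ?_
  have h5 : 0 ≤ C * Real.sqrt (weightedEnergy κ w x) * ‖u‖ := by positivity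
  linarith

omit hκ hθC hϑC in
theorem stronglyMeasurable_kernelIntegral (w : H1 ℝ L) (R : ResolventSpace) :
    StronglyMeasurable (kernelIntegral θ ϑ w R) := by
  have hU := continuous_resolvent_apply R
  have h1 : Measurable fun p : ℝ × ℝ => R (pointMass p.1) p.2 := hU.measurable
  have h2 : Measurable fun p : ℝ × ℝ => deriv (R (pointMass p.1)) p.2 :=
    measurable_deriv_with_param hU
  have h3 : Measurable (deriv w) := measurable_deriv _
  have h4 : Measurable w := w.mem.continuous.measurable
  have h5 : Measurable fun p : ℝ × ℝ => kernelDensity θ ϑ w (R (pointMass p.1)) p.1 p.2 := by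
    have h6 : Measurable fun p : ℝ × ℝ => ((w p.2 : ℝ) : ℂ) := by fun_prop
    have h7 : Measurable fun p : ℝ × ℝ => ((deriv w p.2 : ℝ) : ℂ) := by fun_prop
    have h8 : Measurable fun p : ℝ × ℝ => θ (p.2 - p.1) := by fun_prop
    have h9 : Measurable fun p : ℝ × ℝ => ϑ (p.2 - p.1) := by fun_prop
    exact ((h6.const_mul 4).mul (h1.mul h8)).add (h7.mul ((h2.mul h8).add (h1.mul h9)))
  exact h5.stronglyMeasurable.integral_prod_right'

theorem norm_kernelIntegral_sq_le (hC : 0 ≤ C) (w : H1 ℝ L) (R : ResolventSpace) (x : ℝ) :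
    ‖kernelIntegral θ ϑ w R x‖ ^ 2 ≤ (8 * C * ‖R‖) ^ 2 * weightedEnergy κ w x := by
  have h0 : 0 ≤ weightedEnergy κ w x := integral_nonneg fun y => by positivity
  have h1 := norm_integral_kernelDensity_le hκ hθ hϑ hθC hϑC hC w (R (pointMass x)) x
  have h2 : ‖R (pointMass x)‖ ≤ ‖R‖ * 2 :=
    R.le_opNorm_of_le (norm_pointMass_le x)
  have h3 : ‖kernelIntegral θ ϑ w R x‖ ≤ 8 * C * ‖R‖ * Real.sqrt (weightedEnergy κ w x) := by
    refine h1.trans ?_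
    have := mul_le_mul_of_nonneg_left h2
      (by positivity : 0 ≤ 4 * C * Real.sqrt (weightedEnergy κ w x))
    linarith
  refine (pow_le_pow_left₀ (norm_nonneg _) h3 2).trans_eq ?_
  rw [mul_pow, Real.sq_sqrt h0]

theorem lintegral_kernelIntegral_le (hC : 0 ≤ C) (w : H1 ℝ L) (R : ResolventSpace) :
    ∫⁻ x in cell L, ENNReal.ofReal (‖kernelIntegral θ ϑ w R x‖ ^ 2)
      ≤ ENNReal.ofReal ((8 * C * ‖R‖) ^ 2 * (‖w‖ ^ 2 * ∫ s : ℝ, Real.exp (-(2 * κ) * |s|))) := by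
  calc _ ≤ ∫⁻ x in cell L, ENNReal.ofReal ((8 * C * ‖R‖) ^ 2)
          * ENNReal.ofReal (weightedEnergy κ w x) := by
        refine lintegral_mono fun x => ?_
        rw [← ENNReal.ofReal_mul (by positivity)]
        exact ENNReal.ofReal_le_ofReal (norm_kernelIntegral_sq_le hκ hθ hϑ hθC hϑC hC w R x)
    _ ≤ _ := by
        rw [lintegral_const_mul' _ _ ENNReal.ofReal_ne_top, ENNReal.ofReal_mul (by positivity)]
        gcongr
        exact lintegral_weightedEnergy_le hκ w

theorem memLp_kernelIntegral (hC : 0 ≤ C) (w : H1 ℝ L) (R : ResolventSpace) :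
    MemLp (kernelIntegral θ ϑ w R) 2 (volume.restrict (cell L)) := by
  have hm : AEStronglyMeasurable (kernelIntegral θ ϑ w R) (volume.restrict (cell L)) :=
    (stronglyMeasurable_kernelIntegral hθ hϑ w R).aestronglyMeasurable
  rw [memLp_two_iff_integrable_sq_norm hm]
  refine ⟨(hm.norm.pow 2), ?_⟩
  rw [hasFiniteIntegral_iff_ofReal (.of_forall fun _ => by positivity)]
  exact (lintegral_kernelIntegral_le hκ hθ hϑ hθC hϑC hC w R).trans_lt ENNReal.ofReal_lt_top

theorem isBoundedBilinearMap_kernelIntegral (hC : 0 ≤ C) : IsBoundedBilinearMap ℝ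
    fun p : H1 ℝ L × ResolventSpace =>
      (memLp_kernelIntegral hκ hθ hϑ hθC hϑC hC p.1 p.2).toLp (kernelIntegral θ ϑ p.1 p.2) := by
  set J := ∫ s : ℝ, Real.exp (-(2 * κ) * |s|) with hJ
  have hJ0 : 0 ≤ J := integral_nonneg fun s => by positivity
  have hi : ∀ (w : H1 ℝ L) (u : H1 ℂ ⊤) (x : ℝ), Integrable (kernelDensity θ ϑ w u x) :=
    integrable_kernelDensity hκ hθ hϑ hθC hϑC
  refine isBoundedBilinearMap_toLp (kernelIntegral θ ϑ)
    (memLp_kernelIntegral hκ hθ hϑ hθC hϑC hC) ?_ ?_ ?_ ?_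
    -- The summand `1` only makes the constant positive.
    (C := 8 * C * Real.sqrt J + 1) (by positivity) fun w R => ?_
  · refine fun v w R => .of_forall fun x => ?_
    rw [kernelIntegral, kernelIntegral, kernelIntegral, ← integral_add (hi _ _ _) (hi _ _ _)]
    refine integral_congr_ae ?_
    filter_upwards [deriv_add_ae v.mem w.mem] with y hy
    simp only [kernelDensity, H1.coe_add, Pi.add_apply, hy]
    push_cast; ring
  · refine fun c w R => .of_forall fun x => ?_
    rw [kernelIntegral, kernelIntegral, ← integral_const_mul]
    refine integral_congr_ae ?_
    filter_upwards [deriv_smul_ae c w.mem] with y hy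
    simp only [kernelDensity, H1.coe_smul, Pi.smul_apply, hy, smul_eq_mul]
    push_cast; ring
  · refine fun w R R' => .of_forall fun x => ?_
    rw [kernelIntegral, kernelIntegral, kernelIntegral, ← integral_add (hi _ _ _) (hi _ _ _)]
    refine integral_congr_ae ?_
    filter_upwards [H1.deriv_add_ae' (R (pointMass x)) (R' (pointMass x))] with y hy
    simp only [kernelDensity, add_apply, hy]
    rw [H1.coe_add, Pi.add_apply]
    ring
  · refine fun c w R => .of_forall fun x => ?_
    rw [kernelIntegral, kernelIntegral, ← integral_const_mul]
    refine integral_congr_ae ?_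
    filter_upwards [H1.deriv_smul_ae' (c : ℂ) (R (pointMass x))] with y hy
    have h1 : (c • R) (pointMass x) = (c : ℂ) • R (pointMass x) := rfl
    simp only [kernelDensity, h1, hy]
    rw [H1.coe_smul, Pi.smul_apply, smul_eq_mul]
    ring
  · have h1 := lintegral_kernelIntegral_le hκ hθ hϑ hθC hϑC hC w R
    rw [← ofReal_integral_eq_lintegral_ofReal
      ((memLp_kernelIntegral hκ hθ hϑ hθC hϑC hC w R).integrable_norm_pow (by norm_num))
      (.of_forall fun _ => by positivity), ENNReal.ofReal_le_ofReal_iff (by positivity)] at h1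
    refine h1.trans ?_
    rw [← hJ]
    have h2 : (8 * C * ‖R‖) ^ 2 * (‖w‖ ^ 2 * J) = (8 * C * Real.sqrt J * ‖w‖ * ‖R‖) ^ 2 := by
      simp only [mul_pow, Real.sq_sqrt hJ0]; ring
    rw [h2]
    gcongr
    linarith

end Convolution

end DiagonalGreen

namespace DiagonalGreen

/-! ### `H¹` as a retract of `L² × L²` -/

section CellL2

variable {L : ENNReal} [Fact (1 ≤ L)]

/-- The space `L²` over a period cell. -/
abbrev CellL2 (L : ENNReal) : Type := Lp ℂ 2 (volume.restrict (cell L))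

/-- The inclusion of `H¹` into `L²`. -/
def H1.toL2 (L : ENNReal) [Fact (1 ≤ L)] : H1 ℂ L →L[ℂ] CellL2 L :=
  LinearMap.mkContinuous
    { toFun := fun f => f.mem.memLp.toLp f
      map_add' := fun f g => MemLp.toLp_add f.mem.memLp g.mem.memLp
      map_smul' := fun c f => MemLp.toLp_const_smul c f.mem.memLp } 1 fun f => by
    refine le_of_sq_le_sq ?_ (by positivity)
    change ‖f.mem.memLp.toLp f‖ ^ 2 ≤ _
    rw [norm_toLp_sq, one_mul, H1.norm_sq]
    refine integral_mono (f.mem.memLp.integrable_norm_pow (by norm_num)) f.integrable_energy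
      fun x => ?_
    have h1 := sq_nonneg ‖f x‖
    have h2 := sq_nonneg ‖deriv f x‖
    simp only
    linarith

/-- Differentiation, as a map from `H¹` to `L²`. -/
def H1.derivL2 (L : ENNReal) [Fact (1 ≤ L)] : H1 ℂ L →L[ℂ] CellL2 L :=
  LinearMap.mkContinuous
    { toFun := fun f => f.mem.memLp_deriv.toLp (deriv f)
      map_add' := fun f g => by
        rw [← MemLp.toLp_add]
        exact MemLp.toLp_congr _ _ (ae_restrict_of_ae (deriv_add_ae f.mem g.mem))
      map_smul' := fun c f => by
        rw [RingHom.id_apply, ← MemLp.toLp_const_smul]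
        exact MemLp.toLp_congr _ _ (ae_restrict_of_ae (deriv_smul_ae c f.mem)) } 1 fun f => by
    refine le_of_sq_le_sq ?_ (by positivity)
    change ‖f.mem.memLp_deriv.toLp (deriv f)‖ ^ 2 ≤ _
    rw [norm_toLp_sq, one_mul, H1.norm_sq]
    refine integral_mono (f.mem.memLp_deriv.integrable_norm_pow (by norm_num)) f.integrable_energy
      fun x => ?_
    have h1 := sq_nonneg ‖f x‖
    simp only
    linarith

theorem H1.coeFn_toL2 (f : H1 ℂ L) : H1.toL2 L f =ᵐ[volume.restrict (cell L)] f :=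
  f.mem.memLp.coeFn_toLp

theorem H1.coeFn_derivL2 (f : H1 ℂ L) : H1.derivL2 L f =ᵐ[volume.restrict (cell L)] deriv f :=
  f.mem.memLp_deriv.coeFn_toLp

/-- A bounded left inverse of `f ↦ (f', f)`. -/
def H1.ofL2 (L : ENNReal) [Fact (1 ≤ L)] : CellL2 L × CellL2 L →L[ℂ] H1 ℂ L :=
  (ContinuousLinearMap.adjoint (H1.derivL2 L)).comp (ContinuousLinearMap.fst ℂ _ _)
    + (4 : ℂ) • (ContinuousLinearMap.adjoint (H1.toL2 L)).comp (ContinuousLinearMap.snd ℂ _ _)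

/-- By the definition of the inner product, `D* D + 4 I* I = 1` for the differentiation `D` and the
inclusion `I`. -/
theorem H1.ofL2_eq (f : H1 ℂ L) : H1.ofL2 L (H1.derivL2 L f, H1.toL2 L f) = f := by
  refine ext_inner_left ℂ fun v => ?_
  have h1 : H1.ofL2 L (H1.derivL2 L f, H1.toL2 L f)
      = ContinuousLinearMap.adjoint (H1.derivL2 L) (H1.derivL2 L f)
        + (4 : ℂ) • ContinuousLinearMap.adjoint (H1.toL2 L) (H1.toL2 L f) := rfl
  rw [h1, inner_add_right, inner_smul_right, ContinuousLinearMap.adjoint_inner_right,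
    ContinuousLinearMap.adjoint_inner_right, H1.inner_def, L2.inner_def, L2.inner_def,
    ← integral_const_mul, ← integral_add (L2.integrable_inner _ _)
      ((L2.integrable_inner _ _).const_mul _)]
  refine integral_congr_ae ?_
  filter_upwards [H1.coeFn_derivL2 f, H1.coeFn_derivL2 v, H1.coeFn_toL2 f, H1.coeFn_toL2 v]
    with x h1 h2 h3 h4
  rw [h1, h2, h3, h4]

/-- With this, smoothness of a map into `H¹` follows from smoothness of the function and of its
derivative as elements of `L²`. -/
theorem H1.eq_ofL2 {f : H1 ℂ L} {a b : CellL2 L}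
    (ha : ∀ᵐ x ∂volume.restrict (cell L), a x = deriv f x)
    (hb : ∀ᵐ x ∂volume.restrict (cell L), b x = f x) : f = H1.ofL2 L (a, b) := by
  have h1 : a = H1.derivL2 L f := Lp.ext (EventuallyEq.trans ha (H1.coeFn_derivL2 f).symm)
  have h2 : b = H1.toL2 L f := Lp.ext (EventuallyEq.trans hb (H1.coeFn_toL2 f).symm)
  rw [h1, h2, H1.ofL2_eq]

end CellL2

/-! ### The map `w ↦ g - 1 / (2 k)` and its smoothness -/

section DiagMap

attribute [local instance] H1.normedSpace

variable {L : ENNReal} [Fact (1 ≤ L)] {k : ℂ}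

/-- The kernel `exp (-k |s|)`, restricted to a set. -/
def expKernel (S : Set ℝ) (k : ℂ) (s : ℝ) : ℂ := S.indicator (fun s => Complex.exp (-k * |s|)) s

/-- The derivative of the kernel `exp (-k |s|)`, restricted to a set. -/
def expDerivKernel (S : Set ℝ) (k : ℂ) (s : ℝ) : ℂ := S.indicator (expDeriv k 0) s

theorem measurable_expKernel {S : Set ℝ} (hS : MeasurableSet S) (k : ℂ) :
    Measurable (expKernel S k) :=
  Measurable.indicator (by fun_prop) hS

theorem measurable_expDerivKernel {S : Set ℝ} (hS : MeasurableSet S) (k : ℂ) :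
    Measurable (expDerivKernel S k) := by
  refine Measurable.indicator ?_ hS
  unfold expDeriv
  exact Measurable.ite measurableSet_Iic (by fun_prop) (by fun_prop)

theorem norm_expKernel_le (S : Set ℝ) (k : ℂ) (s : ℝ) :
    ‖expKernel S k s‖ ≤ (1 + ‖k‖) * Real.exp (-k.re * |s|) := by
  refine (norm_indicator_le_norm_self _ _).trans ?_
  rw [norm_exp_abs]
  have := mul_nonneg (norm_nonneg k) (Real.exp_pos (-k.re * |s|)).le
  linarith

theorem norm_expDerivKernel_le (S : Set ℝ) (k : ℂ) (s : ℝ) :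
    ‖expDerivKernel S k s‖ ≤ (1 + ‖k‖) * Real.exp (-k.re * |s|) := by
  refine (norm_indicator_le_norm_self _ _).trans ?_
  rw [norm_expDeriv, sub_zero]
  have := (Real.exp_pos (-k.re * |s|)).le
  linarith

theorem expDeriv_eq (k : ℂ) (x y : ℝ) : expDeriv k x y = expDeriv k 0 (y - x) := by
  simp only [expDeriv, sub_nonpos, sub_zero]

/-- With the indicator of `S` absorbed into the kernel, `greenTotal` and `greenTail` become
instances of one construction that is bilinear in `w` and an arbitrary bounded operator `R`. -/
theorem setIntegral_potentialDensity_eq (hre : 0 < k.re) {S : Set ℝ} (hS : MeasurableSet S)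
    (w : H1 ℝ L) (x : ℝ) :
    ∫ y in (fun y => y - x) ⁻¹' S, potentialDensity w (greenFun k w x) (expTest k hre x) y
      = kernelIntegral (expKernel S k) (expDerivKernel S k) w (resolventOp k w) x := by
  have hS' : MeasurableSet ((fun y => y - x) ⁻¹' S) := hS.preimage (by fun_prop)
  rw [← integral_indicator hS', kernelIntegral]
  refine integral_congr_ae ?_
  filter_upwards [deriv_expTest hre x] with y hy
  simp only [kernelDensity, expKernel, expDerivKernel]
  by_cases h : y - x ∈ S
  · rw [indicator_of_mem (show y ∈ (fun y => y - x) ⁻¹' S from h), indicator_of_mem h,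
      indicator_of_mem h, potentialDensity, hy, expDeriv_eq k x y]
    rfl
  · rw [indicator_of_notMem (show y ∉ (fun y => y - x) ⁻¹' S from h), indicator_of_notMem h,
      indicator_of_notMem h]
    simp

theorem greenTotal_eq_kernelIntegral (hre : 0 < k.re) (w : H1 ℝ L) (x : ℝ) : greenTotal k hre w x
    = kernelIntegral (expKernel univ k) (expDerivKernel univ k) w (resolventOp k w) x := by
  rw [← setIntegral_potentialDensity_eq hre MeasurableSet.univ, preimage_univ, setIntegral_univ]
  rfl

theorem greenTail_eq_kernelIntegral (hre : 0 < k.re) (w : H1 ℝ L) (x : ℝ) : greenTail k hre w x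
    = kernelIntegral (expKernel (Ioi 0) k) (expDerivKernel (Ioi 0) k) w (resolventOp k w) x := by
  rw [← setIntegral_potentialDensity_eq hre measurableSet_Ioi, greenTail]
  congr 2
  ext y; simp

theorem memLp_exp_kernelIntegral (hre : 0 < k.re) {S : Set ℝ} (hS : MeasurableSet S) (w : H1 ℝ L)
    (R : ResolventSpace) : MemLp (kernelIntegral (expKernel S k) (expDerivKernel S k) w R) 2
      (volume.restrict (cell L)) :=
  memLp_kernelIntegral hre (measurable_expKernel hS k) (measurable_expDerivKernel hS k)
    (norm_expKernel_le S k) (norm_expDerivKernel_le S k) (by positivity) w R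

theorem norm_resolvent_diag_le (R : ResolventSpace) (x : ℝ) :
    ‖R (pointMass x) x‖ ≤ 4 * ‖R‖ := by
  have h1 := (R (pointMass x)).norm_apply_le x
  have h2 : ‖R (pointMass x)‖ ≤ ‖R‖ * 2 := R.le_opNorm_of_le (norm_pointMass_le x)
  linarith

theorem continuous_resolvent_diag (R : ResolventSpace) : Continuous fun x => R (pointMass x) x :=
  (continuous_resolvent_apply R).comp (by fun_prop : Continuous fun x : ℝ => (x, x))

theorem memLp_deriv_mul_diag (w : H1 ℝ L) (R : ResolventSpace) :
    MemLp (fun x => ((deriv w x : ℝ) : ℂ) * R (pointMass x) x) 2 (volume.restrict (cell L)) := by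
  refine MemLp.of_le_mul (c := 4 * ‖R‖) w.mem.memLp_deriv ?_ (.of_forall fun x => ?_)
  · have h1 : Measurable (deriv w) := measurable_deriv _
    have h2 := (continuous_resolvent_diag R).measurable
    exact ((Complex.measurable_ofReal.comp h1).mul h2).aestronglyMeasurable
  · rw [norm_mul, Complex.norm_real, mul_comm]
    gcongr
    exact norm_resolvent_diag_le R x

theorem isBoundedBilinearMap_deriv_mul_diag : IsBoundedBilinearMap ℝ
    fun p : H1 ℝ L × ResolventSpace => (memLp_deriv_mul_diag p.1 p.2).toLp
      (fun x => ((deriv p.1 x : ℝ) : ℂ) * p.2 (pointMass x) x) := by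
  refine isBoundedBilinearMap_toLp (fun (w : H1 ℝ L) (R : ResolventSpace) x =>
    ((deriv w x : ℝ) : ℂ) * R (pointMass x) x) memLp_deriv_mul_diag ?_ ?_ ?_ ?_
    (C := 4) (by norm_num) fun w R => ?_
  · intro v w R
    filter_upwards [ae_restrict_of_ae (deriv_add_ae v.mem w.mem)] with x hx
    simp only [H1.coe_add, hx]
    push_cast; ring
  · intro c w R
    filter_upwards [ae_restrict_of_ae (deriv_smul_ae c w.mem)] with x hx
    simp only [H1.coe_smul, hx, smul_eq_mul]
    push_cast; ring
  · refine fun w R R' => .of_forall fun x => ?_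
    simp only [add_apply]
    rw [H1.coe_add, Pi.add_apply]
    ring
  · refine fun c w R => .of_forall fun x => ?_
    have h1 : (c • R) (pointMass x) = (c : ℂ) • R (pointMass x) := rfl
    simp only [h1]
    rw [H1.coe_smul, Pi.smul_apply, smul_eq_mul]
    ring
  · rw [mul_right_comm, mul_pow, H1.norm_sq, ← integral_const_mul]
    refine integral_mono ((memLp_deriv_mul_diag w R).integrable_norm_pow (by norm_num))
      (w.integrable_energy.const_mul _) fun x => ?_
    have h1 := pow_le_pow_left₀ (norm_nonneg _) (norm_resolvent_diag_le R x) 2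
    have h2 := mul_le_mul_of_nonneg_left h1 (sq_nonneg ‖deriv w x‖)
    have h3 : 0 ≤ (4 * ‖R‖) ^ 2 * (4 * ‖w x‖ ^ 2) := by positivity
    simp only [norm_mul, mul_pow, Complex.norm_real]
    linarith

/-- The integrals against the exponential kernels, as a function of class `L²`. -/
def expKernelL2 (hre : 0 < k.re) {S : Set ℝ} (hS : MeasurableSet S) (p : H1 ℝ L × ResolventSpace) :
    CellL2 L :=
  (memLp_exp_kernelIntegral hre hS p.1 p.2).toLp
    (kernelIntegral (expKernel S k) (expDerivKernel S k) p.1 p.2)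

/-- The product of `w'` with the diagonal of the kernel of `R`, as a function of class `L²`. -/
def derivMulDiagL2 (p : H1 ℝ L × ResolventSpace) : CellL2 L :=
  (memLp_deriv_mul_diag p.1 p.2).toLp (fun x => ((deriv p.1 x : ℝ) : ℂ) * p.2 (pointMass x) x)

theorem coeFn_expKernelL2 (hre : 0 < k.re) {S : Set ℝ} (hS : MeasurableSet S) (w : H1 ℝ L)
    (R : ResolventSpace) : expKernelL2 hre hS (w, R) =ᵐ[volume.restrict (cell L)]
      kernelIntegral (expKernel S k) (expDerivKernel S k) w R :=
  MemLp.coeFn_toLp _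

theorem coeFn_derivMulDiagL2 (w : H1 ℝ L) (R : ResolventSpace) :
    derivMulDiagL2 (w, R) =ᵐ[volume.restrict (cell L)]
      fun x => ((deriv w x : ℝ) : ℂ) * R (pointMass x) x :=
  MemLp.coeFn_toLp _

theorem contDiff_expKernelL2 (hre : 0 < k.re) {S : Set ℝ} (hS : MeasurableSet S) :
    ContDiff ℝ ∞ fun p : H1 ℝ L × ResolventSpace => expKernelL2 hre hS p :=
  IsBoundedBilinearMap.contDiff (𝕜 := ℝ) (E := H1 ℝ L) (F := ResolventSpace)
    (G := CellL2 L) (n := ∞) (isBoundedBilinearMap_kernelIntegral (L := L) hre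
    (measurable_expKernel hS k) (measurable_expDerivKernel hS k) (norm_expKernel_le S k)
    (norm_expDerivKernel_le S k) (by positivity))

theorem contDiff_derivMulDiagL2 :
    ContDiff ℝ ∞ fun p : H1 ℝ L × ResolventSpace => derivMulDiagL2 p :=
  IsBoundedBilinearMap.contDiff (𝕜 := ℝ) (E := H1 ℝ L) (F := ResolventSpace)
    (G := CellL2 L) (n := ∞) (isBoundedBilinearMap_deriv_mul_diag (L := L))

theorem contDiff_prod_resolventOp (hk : 0 < (k ^ 2).im) : ContDiff ℝ ∞
    (fun w : H1 ℝ L => ((w, resolventOp k w) : H1 ℝ L × ResolventSpace)) :=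
  contDiff_id.prodMk (contDiff_resolventOp hk)

variable (hk : 0 < (k ^ 2).im) (hre : 0 < k.re)

/-- The derivative of the diagonal Green function. -/
def diagDeriv (k : ℂ) (hre : 0 < k.re) (w : H1 ℝ L) (x : ℝ) : ℂ :=
  -2 * (((deriv w x : ℝ) : ℂ) * greenFun k w x x) - 2 * greenTail k hre w x + greenTotal k hre w x

theorem memLp_greenTotal (w : H1 ℝ L) :
    MemLp (greenTotal k hre w) 2 (volume.restrict (cell L)) := by
  rw [funext (greenTotal_eq_kernelIntegral hre w)]
  exact memLp_exp_kernelIntegral hre MeasurableSet.univ w (resolventOp k w)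

theorem memLp_greenTail (w : H1 ℝ L) :
    MemLp (greenTail k hre w) 2 (volume.restrict (cell L)) := by
  rw [funext (greenTail_eq_kernelIntegral hre w)]
  exact memLp_exp_kernelIntegral hre measurableSet_Ioi w (resolventOp k w)

theorem memLp_diagDeriv (w : H1 ℝ L) : MemLp (diagDeriv k hre w) 2 (volume.restrict (cell L)) :=
  (((memLp_deriv_mul_diag w (resolventOp k w)).const_mul (-2)).sub
    ((memLp_greenTail hre w).const_mul 2)).add (memLp_greenTotal hre w)

include hk in
theorem diag_sub_eq (w : H1 ℝ L) (x : ℝ) :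
    greenFun k w x x - 1 / (2 * k) = -(1 / (2 * k)) * greenTotal k hre w x := by
  have h0 : k ≠ 0 := by rintro rfl; simp at hre
  have h := greenTotal_eq hk hre w x
  field_simp
  linear_combination h

/-- The function `g - 1 / (2 k)` of class `H¹`. -/
def diagShift (hk : 0 < (k ^ 2).im) (hre : 0 < k.re) (w : H1 ℝ L) : H1 ℂ L :=
  ⟨fun x => greenFun k w x x - 1 / (2 * k), by
    have h := (hasPrim_diag' hk hre w).add (HasPrim.const (-(1 / (2 * k))))
    refine .of_primitive (diagDeriv k hre w) (fun hL x => ?_) ?_ (memLp_diagDeriv hre w)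
      (fun a b => ?_) fun a b => ?_
    · have := diag_periodic hk w hL x
      simp only at this ⊢
      rw [this]
    · simp only [diag_sub_eq hk hre]
      exact (memLp_greenTotal hre w).const_mul _
    · exact ((hasPrim_diag' hk hre w) a (mem_univ a) b (mem_univ b)).1
    · rw [sub_sub_sub_cancel_right]
      exact ((hasPrim_diag' hk hre w) a (mem_univ a) b (mem_univ b)).2⟩

theorem diagShift_apply (w : H1 ℝ L) (x : ℝ) :
    diagShift hk hre w x = greenFun k w x x - 1 / (2 * k) := rfl

theorem deriv_diagShift (w : H1 ℝ L) (x : ℝ) :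
    deriv (diagShift hk hre w) x = deriv (fun x => greenFun k w x x) x :=
  deriv_sub_const (f := fun x => greenFun k w x x) _

theorem deriv_diagShift_ae (w : H1 ℝ L) :
    ∀ᵐ x, deriv (diagShift hk hre w) x = diagDeriv k hre w x := by
  filter_upwards [(hasPrim_diag' hk hre w).deriv_ae] with x hx
  rw [deriv_diagShift, hx, diagDeriv]

/-- By `diag_sub_eq` and `hasPrim_diag'` the function and its derivative are linear combinations of
bounded bilinear expressions in `(w, R)`, evaluated at the resolvent `R`, which depends smoothly on
`w`. -/
theorem contDiff_diagShift : ContDiff ℝ ∞ (fun w : H1 ℝ L => diagShift hk hre w) := by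
  have hR := contDiff_prod_resolventOp (L := L) hk
  have hT := (contDiff_expKernelL2 (L := L) hre MeasurableSet.univ).comp hR
  have hS := (contDiff_expKernelL2 (L := L) hre (measurableSet_Ioi (a := (0 : ℝ)))).comp hR
  have hD := (contDiff_derivMulDiagL2 (L := L)).comp hR
  have h1 := ((hD.const_smul (-2 : ℂ)).sub (hS.const_smul (2 : ℂ))).add hT
  have h2 := hT.const_smul (-(1 / (2 * k)))
  have h3 : ContDiff ℝ ∞ fun p : CellL2 L × CellL2 L => (H1.ofL2 L).restrictScalars ℝ p := by
    fun_prop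
  have h4 := h3.comp (h1.prodMk h2)
  suffices h5 : ∀ w : H1 ℝ L, diagShift hk hre w = H1.ofL2 L
      ((-2 : ℂ) • derivMulDiagL2 (w, resolventOp k w) - (2 : ℂ) •
          expKernelL2 hre (measurableSet_Ioi (a := (0 : ℝ))) (w, resolventOp k w)
          + expKernelL2 hre MeasurableSet.univ (w, resolventOp k w),
        -(1 / (2 * k)) • expKernelL2 hre MeasurableSet.univ (w, resolventOp k w)) by
    rw [funext h5]; exact h4
  refine fun w => H1.eq_ofL2 ?_ ?_
  · set R := resolventOp k w with hR'
    set a := derivMulDiagL2 (w, R)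
    set b := expKernelL2 hre (measurableSet_Ioi (a := (0 : ℝ))) (w, R)
    set c := expKernelL2 hre MeasurableSet.univ (w, R)
    filter_upwards [ae_restrict_of_ae (deriv_diagShift_ae hk hre w),
      Lp.coeFn_add ((-2 : ℂ) • a - (2 : ℂ) • b) c, Lp.coeFn_sub ((-2 : ℂ) • a) ((2 : ℂ) • b),
      Lp.coeFn_smul (-2 : ℂ) a, Lp.coeFn_smul (2 : ℂ) b, coeFn_derivMulDiagL2 w R,
      coeFn_expKernelL2 hre (measurableSet_Ioi (a := (0 : ℝ))) w R,
      coeFn_expKernelL2 hre MeasurableSet.univ w R] with x e1 e2 e3 e4 e5 e6 e7 e8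
    rw [e1, diagDeriv, greenTail_eq_kernelIntegral, greenTotal_eq_kernelIntegral]
    refine e2.trans ?_
    rw [Pi.add_apply, e3, Pi.sub_apply, e4, e5, Pi.smul_apply, Pi.smul_apply, e6, e7, e8]
    rfl
  · set R := resolventOp k w with hR'
    filter_upwards [Lp.coeFn_smul (-(1 / (2 * k))) (expKernelL2 hre MeasurableSet.univ (w, R)),
      coeFn_expKernelL2 hre MeasurableSet.univ w R] with x e1 e2
    rw [diagShift_apply, diag_sub_eq hk hre, greenTotal_eq_kernelIntegral]
    refine e1.trans ?_
    rw [Pi.smul_apply, e2]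
    rfl

end DiagMap

end DiagonalGreen

namespace DiagonalGreen

/-! ### Recovery of the potential from `g` -/

section Recovery

attribute [local instance] H1.normedSpace

variable {L : ENNReal} [Fact (1 ≤ L)] {k : ℂ}

theorem H1.hasPrim_ofReal (φ : H1 ℝ L) :
    HasPrim univ (fun x => ((φ x : ℝ) : ℂ)) (fun x => ((deriv φ x : ℝ) : ℂ)) := by
  intro a _ b _
  refine ⟨?_, ?_⟩
  · have h := φ.mem.intervalIntegrable_deriv a b
    exact ⟨h.1.ofReal, h.2.ofReal⟩
  · rw [intervalIntegral.integral_ofReal, φ.mem.integral_deriv]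
    push_cast; rfl

theorem H1.memLp_ofReal (φ : H1 ℝ L) :
    MemLp (fun x => ((φ x : ℝ) : ℂ)) 2 (volume.restrict (cell L)) :=
  φ.mem.memLp.ofReal

theorem H1.memLp_deriv_ofReal (φ : H1 ℝ L) :
    MemLp (fun x => ((deriv φ x : ℝ) : ℂ)) 2 (volume.restrict (cell L)) :=
  φ.mem.memLp_deriv.ofReal

/-- Integration by parts without boundary terms: by periodicity on the circle, by integrability on
the line. -/
theorem integral_cell_eq_zero_of_hasPrim {F f : ℝ → ℂ} (hF : HasPrim univ F f)
    (hp : L ≠ ⊤ → Function.Periodic F (2 * L.toReal)) (hFi : IntegrableOn F (cell L))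
    (hf : IntegrableOn f (cell L)) : ∫ x in cell L, f x = 0 := by
  by_cases hT : L = ⊤
  · subst hT
    rw [cell_top] at hFi hf ⊢
    rw [integrableOn_univ] at hFi hf
    rw [setIntegral_univ]
    exact integral_eq_zero_of_hasPrim hF hFi hf
  · have hl := one_le_toReal (L := L) hT
    rw [cell_of_ne_top hT, ← integral_Ioc_eq_integral_Ioo,
      ← intervalIntegral.integral_of_le (by linarith), (hF _ (mem_univ _) _ (mem_univ _)).2]
    have := hp hT (-L.toReal)
    rw [show -L.toReal + 2 * L.toReal = L.toReal by ring] at this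
    rw [this, sub_self]

variable (hk : 0 < (k ^ 2).im) (hre : 0 < k.re) (w : H1 ℝ L)
include hk hre

theorem exists_norm_inv_diag_le : ∃ C : ℝ, ∀ x, ‖(greenFun k w x x)⁻¹‖ ≤ C := by
  obtain ⟨c, hc, h⟩ := exists_greenFun_lower_bound hk w hre
  refine ⟨c⁻¹, fun x => ?_⟩
  rw [norm_inv]
  exact inv_anti₀ hc (h x)

theorem memLp_logDeriv_diag : MemLp (fun x => deriv (fun x => greenFun k w x x) x
    / (2 * greenFun k w x x)) 2 (volume.restrict (cell L)) := by
  obtain ⟨C, hC⟩ := exists_norm_inv_diag_le hk hre w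
  have h1 := (diagShift hk hre w).mem.memLp_deriv
  rw [funext (deriv_diagShift hk hre w)] at h1
  have hm := ((continuous_diag hk w hre).inv₀ (greenFun_self_ne_zero hk w hre)).aestronglyMeasurable
    (μ := volume.restrict (cell L))
  refine MemLp.of_le_mul (c := C / 2) h1 ?_ (.of_forall fun x => ?_)
  · have := (h1.1.mul hm).const_mul 2⁻¹
    refine this.congr (.of_forall fun x => ?_)
    simp only [Pi.mul_apply, Pi.inv_apply]
    field_simp
  · rw [div_eq_mul_inv, mul_inv, norm_mul, norm_mul, mul_comm]
    have h2 := hC x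
    have h3 : ‖(2 : ℂ)⁻¹‖ = 2⁻¹ := by simp
    rw [h3]
    have h4 := mul_le_mul_of_nonneg_right h2
      (norm_nonneg (deriv (fun x => greenFun k w x x) x))
    linarith

theorem memLp_inv_diag_sq_sub : MemLp (fun x => 1 / (4 * greenFun k w x x ^ 2) - k ^ 2) 2
    (volume.restrict (cell L)) := by
  obtain ⟨C, hC⟩ := exists_norm_inv_diag_le hk hre w
  have h0 := greenFun_self_ne_zero hk w hre
  have hk0 : k ≠ 0 := by rintro rfl; simp at hre
  have hc := continuous_diag hk w hre
  have hcont : Continuous fun x => 1 / (4 * greenFun k w x x ^ 2) - k ^ 2 :=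
    (continuous_const.div ((hc.pow 2).const_mul 4) fun x =>
      mul_ne_zero (by norm_num) (pow_ne_zero 2 (h0 x))).sub continuous_const
  refine MemLp.of_le_mul (c := 2 * ‖k‖ * (‖k‖ * C + C ^ 2)) (diagShift hk hre w).mem.memLp
    hcont.aestronglyMeasurable (.of_forall fun x => ?_)
  -- The expression vanishes for `g = 1/(2 k)`; the factor `g - 1/(2 k)` is square integrable over
  -- the cell and the cofactor is bounded.
  have h1 : 1 / (4 * greenFun k w x x ^ 2) - k ^ 2 = -(2 * k * (k * (2⁻¹ * (greenFun k w x x)⁻¹)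
      + 4⁻¹ * (greenFun k w x x)⁻¹ ^ 2)) * diagShift hk hre w x := by
    rw [diagShift_apply]
    have := h0 x
    field_simp
    ring
  have hC0 : 0 ≤ C := (norm_nonneg _).trans (hC x)
  have h2 := hC x
  rw [h1, norm_mul, norm_neg, norm_mul, norm_mul]
  have h3 : ‖(2 : ℂ)‖ = 2 := by simp
  rw [h3]
  gcongr
  refine (norm_add_le _ _).trans ?_
  have h4 : ‖(2 : ℂ)⁻¹‖ = 2⁻¹ := by simp
  have h5 : ‖(4 : ℂ)⁻¹‖ = 4⁻¹ := by simp
  rw [norm_mul, norm_mul, norm_mul, norm_pow, h4, h5]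
  have h6 : 2⁻¹ * ‖(greenFun k w x x)⁻¹‖ ≤ C := by
    have := norm_nonneg (greenFun k w x x)⁻¹
    linarith
  have h7 : 4⁻¹ * ‖(greenFun k w x x)⁻¹‖ ^ 2 ≤ C ^ 2 := by
    have := pow_le_pow_left₀ (norm_nonneg _) h2 2
    have := sq_nonneg ‖(greenFun k w x x)⁻¹‖
    linarith
  gcongr

/-- The potential is recovered from the diagonal Green function. -/
theorem inner_eq_of_diag (φ : H1 ℝ L) : ((inner ℝ w φ : ℝ) : ℂ) =
    distDeriv L (fun x => deriv (fun x => greenFun k w x x) x / (2 * greenFun k w x x)) φ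
      + funDist L (fun x => (deriv (fun x => greenFun k w x x) x / (2 * greenFun k w x x)) ^ 2) φ
      + funDist L (fun x => 1 / (4 * greenFun k w x x ^ 2) - k ^ 2) φ := by
  have h0 := greenFun_self_ne_zero hk w hre
  set g : ℝ → ℂ := fun x => greenFun k w x x with hg
  set A : ℝ → ℂ := fun x => deriv g x / (2 * g x) with hA
  set B : ℝ → ℂ := fun x => 1 / (4 * g x ^ 2) - k ^ 2 with hB
  set P := weylQuot k hre w with hP
  have mA : MemLp A 2 (volume.restrict (cell L)) := memLp_logDeriv_diag hk hre w
  have mB : MemLp B 2 (volume.restrict (cell L)) := memLp_inv_diag_sq_sub hk hre w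
  have mAφ : MemLp (fun x => A x * ((φ x : ℝ) : ℂ)) 2 (volume.restrict (cell L)) := by
    refine MemLp.of_le_mul (c := 2 * ‖φ‖) mA (mA.1.mul φ.memLp_ofReal.1) (.of_forall fun x => ?_)
    rw [norm_mul, mul_comm, Complex.norm_real]
    gcongr
    exact φ.norm_apply_le x
  have i1 := integrable_mul_of_memLp_two mA φ.memLp_deriv_ofReal
  have i2 := integrable_mul_of_memLp_two mA mAφ
  have i3 := integrable_mul_of_memLp_two mB φ.memLp_ofReal
  have i4 := integrable_mul_of_memLp_two w.memLp_deriv_ofReal φ.memLp_deriv_ofReal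
  have i5 := integrable_mul_of_memLp_two w.memLp_ofReal φ.memLp_ofReal
  have i45 := i4.add (i5.const_mul 4)
  -- The sum `P + 1/(2 g)` equals `g'/(2 g) + w'` almost everywhere. It is absolutely continuous, so
  -- its product with a test function may be integrated by parts.
  have hF := φ.hasPrim_ofReal.mul ((hasPrim_weylQuot hk hre w).add
    (((hasPrim_diag hk hre w).inv fun x _ => h0 x).const_mul 2⁻¹))
  have hA' : ∀ᵐ x, A x = P x - ((deriv w x : ℝ) : ℂ) + 2⁻¹ * (g x)⁻¹ := by
    filter_upwards [deriv_diag_ae hk hre w] with x hx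
    have h1 : g x ≠ 0 := h0 x
    simp only [hA]
    rw [hx]
    change (2 * g x * (P x - _) + 1) / (2 * g x) = _
    field_simp
  set f : ℝ → ℂ := fun x => ((((deriv w x : ℝ) : ℂ) * ((deriv φ x : ℝ) : ℂ)
      + 4 * (((w x : ℝ) : ℂ) * ((φ x : ℝ) : ℂ))) + A x * ((deriv φ x : ℝ) : ℂ))
      - (A x * (A x * ((φ x : ℝ) : ℂ)) + B x * ((φ x : ℝ) : ℂ)) with hf
  -- With `P - w' = A - 1/(2 g)` the square in the Riccati equation and the derivative of `1/(2 g)`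
  -- combine to `A² + 1/(4 g²)`: the cross terms cancel.
  have hF' : HasPrim univ (fun x => ((φ x : ℝ) : ℂ) * (P x + 2⁻¹ * (g x)⁻¹)) f := by
    refine hF.congr (fun _ _ => rfl) ?_
    filter_upwards [hA'] with x hx _
    have h1 : g x ≠ 0 := h0 x
    have h2 : P x = A x + ((deriv w x : ℝ) : ℂ) - 2⁻¹ * (g x)⁻¹ := by rw [hx]; ring
    simp only [hf, hB]
    change _ = _ * (P x + 2⁻¹ * (g x)⁻¹) + _ * (k ^ 2 + 4 * _ - (P x - _) ^ 2
      + 2⁻¹ * (-(2 * g x * (P x - _) + 1) / g x ^ 2))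
    rw [h2]
    field_simp
    ring
  have hfi : IntegrableOn f (cell L) := (i45.add i1).sub (i2.add i3)
  have hFi : IntegrableOn (fun x => ((φ x : ℝ) : ℂ) * (P x + 2⁻¹ * (g x)⁻¹)) (cell L) := by
    refine (integrable_mul_of_memLp_two φ.memLp_ofReal (mA.add w.memLp_deriv_ofReal)).congr ?_
    filter_upwards [ae_restrict_of_ae hA'] with x hx
    rw [Pi.add_apply, hx]; ring
  have hz := integral_cell_eq_zero_of_hasPrim hF' (fun hL x => by
    have h1 := φ.mem.periodic hL x
    have h2 : P (x + 2 * L.toReal) = P x := weylQuot_periodic hk hre w hL x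
    have h3 : g (x + 2 * L.toReal) = g x := diag_periodic hk w hL x
    change ((φ (x + 2 * L.toReal) : ℝ) : ℂ) * (P (x + 2 * L.toReal)
      + 2⁻¹ * (g (x + 2 * L.toReal))⁻¹) = _
    rw [h1, h2, h3]) hFi hfi
  have hw : ((inner ℝ w φ : ℝ) : ℂ) = ∫ x in cell L, (((deriv w x : ℝ) : ℂ) * ((deriv φ x : ℝ) : ℂ)
      + 4 * (((w x : ℝ) : ℂ) * ((φ x : ℝ) : ℂ))) := by
    rw [H1.inner_def, ← integral_complex_ofReal]
    refine integral_congr_ae (.of_forall fun x => ?_)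
    simp only [RCLike.inner_apply, conj_trivial]
    push_cast; ring
  simp only [hf] at hz
  rw [integral_sub (by exact i45.add i1) (by exact i2.add i3), integral_add (by exact i45) i1,
    integral_add i2 i3, ← hw] at hz
  simp only [distDeriv, funDist]
  have h2 : ∫ x in cell L, A x ^ 2 * ((φ x : ℝ) : ℂ)
      = ∫ x in cell L, A x * (A x * ((φ x : ℝ) : ℂ)) :=
    integral_congr_ae (.of_forall fun x => by simp only; ring)
  rw [h2]
  linear_combination hz

end Recovery

end DiagonalGreen

namespace DiagonalGreen

open scoped BoundedContinuousFunction

/-! ### Reciprocals and Möbius maps on `H¹` -/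

section Multiplication

variable {L : ENNReal} [Fact (1 ≤ L)]

theorem integral_norm_sq_eq (F : CellL2 L) : ∫ x in cell L, ‖F x‖ ^ 2 = ‖F‖ ^ 2 := by
  rw [← norm_toLp_sq (Lp.memLp F), Lp.toLp_coeFn]

/-- The inclusion of `H¹` into the bounded continuous functions. -/
def H1.toBCF (L : ENNReal) [Fact (1 ≤ L)] : H1 ℂ L →L[ℂ] (ℝ →ᵇ ℂ) :=
  LinearMap.mkContinuous
    { toFun := fun f => BoundedContinuousFunction.ofNormedAddCommGroup f f.mem.continuous (2 * ‖f‖)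
        f.norm_apply_le
      map_add' := fun _ _ => rfl
      map_smul' := fun _ _ => rfl } 2 fun f =>
    BoundedContinuousFunction.norm_ofNormedAddCommGroup_le f.mem.continuous (by positivity)
      f.norm_apply_le

theorem H1.toBCF_apply (f : H1 ℂ L) (x : ℝ) : H1.toBCF L f x = f x := rfl

theorem memLp_bcf_mul (ρ : ℝ →ᵇ ℂ) (F : CellL2 L) :
    MemLp (fun x => ρ x * F x) 2 (volume.restrict (cell L)) := by
  refine MemLp.of_le_mul (c := ‖ρ‖) (Lp.memLp F)
    (ρ.continuous.aestronglyMeasurable.mul (Lp.memLp F).1) (.of_forall fun x => ?_)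
  rw [norm_mul]
  gcongr
  exact ρ.norm_coe_le_norm x

/-- The product of a bounded continuous function and a square integrable function. -/
def bcfMul (p : (ℝ →ᵇ ℂ) × CellL2 L) : CellL2 L :=
  (memLp_bcf_mul p.1 p.2).toLp (fun x => p.1 x * p.2 x)

theorem coeFn_bcfMul (ρ : ℝ →ᵇ ℂ) (F : CellL2 L) :
    bcfMul (ρ, F) =ᵐ[volume.restrict (cell L)] fun x => ρ x * F x :=
  MemLp.coeFn_toLp _

theorem isBoundedBilinearMap_bcfMul :
    IsBoundedBilinearMap ℝ fun p : (ℝ →ᵇ ℂ) × CellL2 L => bcfMul p := by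
  refine isBoundedBilinearMap_toLp (fun (ρ : ℝ →ᵇ ℂ) (F : CellL2 L) x => ρ x * F x) memLp_bcf_mul
    ?_ ?_ ?_ ?_ (C := 1) one_pos fun ρ F => ?_
  · exact fun ρ ρ' F => .of_forall fun x => by
      rw [BoundedContinuousFunction.add_apply]; ring
  · exact fun c ρ F => .of_forall fun x => by
      simp only [BoundedContinuousFunction.coe_smul, Complex.real_smul]; ring
  · intro ρ F F'
    filter_upwards [Lp.coeFn_add F F'] with x hx
    rw [hx, Pi.add_apply]; ring
  · intro c ρ F
    filter_upwards [Lp.coeFn_smul c F] with x hx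
    rw [hx, Pi.smul_apply, Complex.real_smul]; ring
  · rw [one_mul, mul_pow, ← integral_norm_sq_eq, ← integral_const_mul]
    refine integral_mono ((memLp_bcf_mul ρ F).integrable_norm_pow (by norm_num))
      (((Lp.memLp F).integrable_norm_pow (by norm_num)).const_mul _) fun x => ?_
    have h2 := pow_le_pow_left₀ (norm_nonneg _) (ρ.norm_coe_le_norm x) 2
    simp only [norm_mul, mul_pow]
    gcongr

theorem contDiff_bcfMul : ContDiff ℝ ∞ fun p : (ℝ →ᵇ ℂ) × CellL2 L => bcfMul p :=
  IsBoundedBilinearMap.contDiff (𝕜 := ℝ) (E := ℝ →ᵇ ℂ) (F := CellL2 L) (G := CellL2 L) (n := ∞)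
    isBoundedBilinearMap_bcfMul

/-- The shift `β + h` of a function of class `H¹` by a constant. -/
def shiftBCF (β : ℂ) (h : H1 ℂ L) : ℝ →ᵇ ℂ := BoundedContinuousFunction.const ℝ β + H1.toBCF L h

/-- The set of functions `h` of class `H¹` such that `β + h` is bounded away from zero. -/
def shiftUnits (L : ENNReal) [Fact (1 ≤ L)] (β : ℂ) : Set (H1 ℂ L) :=
  {h | IsUnit (shiftBCF β h)}

/-- The reciprocal of `β + h`. -/
def shiftInv (β : ℂ) (h : H1 ℂ L) : ℝ →ᵇ ℂ := Ring.inverse (shiftBCF β h)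

variable {β : ℂ}

theorem contDiff_shiftBCF (β : ℂ) : ContDiff ℝ ∞ fun h : H1 ℂ L => shiftBCF β h := by
  have h1 : ContDiff ℝ ∞ fun h : H1 ℂ L => (H1.toBCF L).restrictScalars ℝ h := by fun_prop
  exact contDiff_const.add h1

/-- Bounded continuous functions form a Banach algebra: its units are open, and inversion is smooth
on them. -/
theorem isOpen_shiftUnits (L : ENNReal) [Fact (1 ≤ L)] (β : ℂ) : IsOpen (shiftUnits L β) :=
  Units.isOpen.preimage (contDiff_shiftBCF β).continuous

theorem contDiffOn_shiftInv (β : ℂ) :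
    ContDiffOn ℝ ∞ (fun h : H1 ℂ L => shiftInv β h) (shiftUnits L β) := by
  intro h hh
  obtain ⟨u, hu⟩ := hh
  have h1 := contDiffAt_ringInverse (n := ∞) ℝ u
  rw [hu] at h1
  exact (h1.comp h (contDiff_shiftBCF β).contDiffAt).contDiffWithinAt

theorem shiftInv_mul {h : H1 ℂ L} (hh : h ∈ shiftUnits L β) (x : ℝ) :
    shiftInv β h x * (β + h x) = 1 := by
  have h1 := Ring.inverse_mul_cancel (shiftBCF β h) hh
  exact congrArg (fun f : ℝ →ᵇ ℂ => f x) h1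

theorem shift_ne_zero {h : H1 ℂ L} (hh : h ∈ shiftUnits L β) (x : ℝ) : β + h x ≠ 0 :=
  right_ne_zero_of_mul (by rw [shiftInv_mul hh x]; exact one_ne_zero)

theorem shiftInv_apply {h : H1 ℂ L} (hh : h ∈ shiftUnits L β) (x : ℝ) :
    shiftInv β h x = (β + h x)⁻¹ :=
  eq_inv_of_mul_eq_one_left (shiftInv_mul hh x)

theorem mem_shiftUnits {h : H1 ℂ L} {C : ℝ} (h0 : ∀ x, β + h x ≠ 0)
    (hC : ∀ x, ‖(β + h x)⁻¹‖ ≤ C) : h ∈ shiftUnits L β := by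
  let i : ℝ →ᵇ ℂ := BoundedContinuousFunction.ofNormedAddCommGroup (fun x => (β + h x)⁻¹)
    ((continuous_const.add h.mem.continuous).inv₀ h0) C hC
  refine IsUnit.of_mul_eq_one i ?_
  ext x
  exact mul_inv_cancel₀ (h0 x)

theorem norm_inv_shift_le {h : H1 ℂ L} (hh : h ∈ shiftUnits L β) (x : ℝ) :
    ‖(β + h x)⁻¹‖ ≤ ‖shiftInv β h‖ := by
  rw [← shiftInv_apply hh]
  exact (shiftInv β h).norm_coe_le_norm x

/-- The function `h / (β + h)`, for `h` of class `H¹`. -/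
def moebiusAux (h : H1 ℂ L) (hh : h ∈ shiftUnits L β) : H1 ℂ L :=
  ⟨fun x => h x * (β + h x)⁻¹, by
    have hi : HasPrim univ (fun x => β + h x) (deriv h) :=
      ((HasPrim.const β).add h.mem.hasPrim).congr (fun _ _ => rfl)
        (.of_forall fun x _ => by simp)
    have hp := (h.mem.hasPrim.mul (hi.inv fun x _ => shift_ne_zero hh x)).congr
      (e := fun x => β * (shiftInv β h x * (shiftInv β h x * deriv h x))) (fun _ _ => rfl)
      (.of_forall fun x _ => by
        have := shift_ne_zero hh x
        rw [shiftInv_apply hh]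
        field_simp
        ring)
    have hc : Continuous fun x => (β + h x)⁻¹ :=
      (continuous_const.add h.mem.continuous).inv₀ (shift_ne_zero hh)
    refine .of_primitive (fun x => β * (shiftInv β h x * (shiftInv β h x * deriv h x)))
      (fun hL x => ?_) ?_ ?_ (fun a b => (hp a (mem_univ a) b (mem_univ b)).1)
      fun a b => (hp a (mem_univ a) b (mem_univ b)).2
    · rw [h.mem.periodic hL x]
    · refine MemLp.of_le_mul (c := ‖shiftInv β h‖) h.mem.memLp
        (h.mem.continuous.mul hc).aestronglyMeasurable (.of_forall fun x => ?_)
      rw [norm_mul, mul_comm]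
      gcongr
      exact norm_inv_shift_le hh x
    · have hm : ∀ {v : ℝ → ℂ}, MemLp v 2 (volume.restrict (cell L)) →
          MemLp (fun x => shiftInv β h x * v x) 2 (volume.restrict (cell L)) := fun {v} hv =>
        MemLp.of_le_mul (c := ‖shiftInv β h‖) hv
          ((shiftInv β h).continuous.aestronglyMeasurable.mul hv.1) (.of_forall fun x => by
            rw [norm_mul]
            gcongr
            exact (shiftInv β h).norm_coe_le_norm x)
      exact (hm (hm h.mem.memLp_deriv)).const_mul β⟩

/-- The map `h ↦ h / (β + h)`. -/
def moebius (β : ℂ) (h : H1 ℂ L) : H1 ℂ L :=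
  H1.ofL2 L (β • bcfMul (shiftInv β h, bcfMul (shiftInv β h, H1.derivL2 L h)),
    bcfMul (shiftInv β h, H1.toL2 L h))

theorem deriv_moebiusAux (h : H1 ℂ L) (hh : h ∈ shiftUnits L β) :
    ∀ᵐ x, deriv (moebiusAux h hh) x = β * (shiftInv β h x * (shiftInv β h x * deriv h x)) := by
  have hi : HasPrim univ (fun x => β + h x) (deriv h) :=
    ((HasPrim.const β).add h.mem.hasPrim).congr (fun _ _ => rfl)
      (.of_forall fun x _ => by simp)
  have hp := h.mem.hasPrim.mul (hi.inv fun x _ => shift_ne_zero hh x)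
  filter_upwards [hp.deriv_ae] with x hx
  refine (show deriv (moebiusAux h hh) x = _ from hx).trans ?_
  have := shift_ne_zero hh x
  rw [shiftInv_apply hh]
  field_simp
  ring

/-- The definition through `H1.ofL2` is total and smooth by inspection, but describes a quotient
only where `β + h` is invertible. There the derivative of `h / (β + h)` is `β h' / (β + h)²`. -/
theorem moebius_eq (h : H1 ℂ L) (hh : h ∈ shiftUnits L β) : moebius β h = moebiusAux h hh := by
  refine (H1.eq_ofL2 ?_ ?_).symm
  · filter_upwards [ae_restrict_of_ae (deriv_moebiusAux h hh),
      Lp.coeFn_smul β (bcfMul (shiftInv β h, bcfMul (shiftInv β h, H1.derivL2 L h))),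
      coeFn_bcfMul (shiftInv β h) (bcfMul (shiftInv β h, H1.derivL2 L h)),
      coeFn_bcfMul (shiftInv β h) (H1.derivL2 L h), H1.coeFn_derivL2 h] with x e1 e2 e3 e4 e5
    rw [e1]
    refine e2.trans ?_
    rw [Pi.smul_apply, e3, e4, e5, smul_eq_mul]
  · filter_upwards [coeFn_bcfMul (shiftInv β h) (H1.toL2 L h), H1.coeFn_toL2 h] with x e1 e2
    rw [e1, e2, shiftInv_apply hh]
    exact mul_comm _ _

theorem moebius_apply {h : H1 ℂ L} (hh : h ∈ shiftUnits L β) (x : ℝ) :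
    moebius β h x = h x * (β + h x)⁻¹ := by
  rw [moebius_eq h hh]; rfl

theorem contDiff_derivL2 : ContDiff ℝ ∞ fun h : H1 ℂ L => H1.derivL2 L h := by
  have h1 : ContDiff ℝ ∞ fun h : H1 ℂ L => (H1.derivL2 L).restrictScalars ℝ h := by fun_prop
  exact h1

theorem contDiff_toL2 : ContDiff ℝ ∞ fun h : H1 ℂ L => H1.toL2 L h := by
  have h1 : ContDiff ℝ ∞ fun h : H1 ℂ L => (H1.toL2 L).restrictScalars ℝ h := by fun_prop
  exact h1

theorem contDiffOn_moebius (β : ℂ) :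
    ContDiffOn ℝ ∞ (fun h : H1 ℂ L => moebius β h) (shiftUnits L β) := by
  have hi := contDiffOn_shiftInv (L := L) β
  have hm : ∀ {F : H1 ℂ L → CellL2 L}, ContDiffOn ℝ ∞ F (shiftUnits L β) →
      ContDiffOn ℝ ∞ (fun h => bcfMul (shiftInv β h, F h)) (shiftUnits L β) := fun {F} hF =>
    contDiff_bcfMul.comp_contDiffOn (hi.prodMk hF)
  have h1 := (hm (hm contDiff_derivL2.contDiffOn)).const_smul β
  have h2 := hm contDiff_toL2.contDiffOn
  have h3 : ContDiff ℝ ∞ fun p : CellL2 L × CellL2 L => (H1.ofL2 L).restrictScalars ℝ p := by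
    fun_prop
  exact h3.comp_contDiffOn (h1.prodMk h2)

end Multiplication

end DiagonalGreen

namespace DiagonalGreen

open scoped BoundedContinuousFunction

/-! ### The recovery formula as a smooth map on an open set of `H¹` -/

section Recover

variable {L : ENNReal} [Fact (1 ≤ L)] {k : ℂ}

/-- The inclusion of the real functions of class `H¹` into the complex ones. -/
def H1.ofReal (L : ENNReal) [Fact (1 ≤ L)] : H1 ℝ L →L[ℝ] H1 ℂ L :=
  LinearMap.mkContinuous
    { toFun := fun φ => ⟨fun x => ((φ x : ℝ) : ℂ), .of_primitive (fun x => ((deriv φ x : ℝ) : ℂ))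
        (fun hL x => congrArg Complex.ofReal (φ.mem.periodic hL x)) φ.memLp_ofReal
        φ.memLp_deriv_ofReal (fun a b => (φ.hasPrim_ofReal a (mem_univ a) b (mem_univ b)).1)
        fun a b => (φ.hasPrim_ofReal a (mem_univ a) b (mem_univ b)).2⟩
      map_add' := fun φ ψ => H1.ext fun x => Complex.ofReal_add _ _
      map_smul' := fun c φ => H1.ext fun x => Complex.ofReal_mul _ _ } 1 fun φ => by
    refine le_of_sq_le_sq (le_of_eq ?_) (by positivity)
    rw [one_mul, H1.norm_sq, H1.norm_sq]
    refine integral_congr_ae (ae_restrict_of_ae ?_)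
    filter_upwards [φ.hasPrim_ofReal.deriv_ae] with x hx
    refine (congrArg (fun z : ℂ => ‖z‖ ^ 2 + 4 * ‖((φ x : ℝ) : ℂ)‖ ^ 2) hx).trans ?_
    simp only [Complex.norm_real]

theorem H1.ofReal_apply (φ : H1 ℝ L) (x : ℝ) : H1.ofReal L φ x = ((φ x : ℝ) : ℂ) := rfl

theorem H1.deriv_ofReal (φ : H1 ℝ L) : ∀ᵐ x, deriv (H1.ofReal L φ) x = ((deriv φ x : ℝ) : ℂ) :=
  φ.hasPrim_ofReal.deriv_ae

theorem integrable_mul_cellL2 (F G : CellL2 L) :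
    Integrable (fun x => F x * G x) (volume.restrict (cell L)) :=
  integrable_mul_of_memLp_two (Lp.memLp F) (Lp.memLp G)

/-- The real part of the bilinear pairing of `L²`. -/
def rePairing (L : ENNReal) [Fact (1 ≤ L)] : CellL2 L →L[ℝ] StrongDual ℝ (CellL2 L) :=
  LinearMap.mkContinuous₂ (LinearMap.mk₂ ℝ (fun F G => (∫ x in cell L, F x * G x).re)
    (fun F F' G => by
      rw [← Complex.add_re, ← integral_add (integrable_mul_cellL2 F G) (integrable_mul_cellL2 F' G)]
      congr 1
      refine integral_congr_ae ?_
      filter_upwards [Lp.coeFn_add F F'] with x hx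
      rw [hx, Pi.add_apply]; ring)
    (fun c F G => by
      rw [smul_eq_mul, ← Complex.re_ofReal_mul, ← integral_const_mul]
      congr 1
      refine integral_congr_ae ?_
      filter_upwards [Lp.coeFn_smul c F] with x hx
      rw [hx, Pi.smul_apply, Complex.real_smul]; ring)
    (fun F G G' => by
      rw [← Complex.add_re, ← integral_add (integrable_mul_cellL2 F G) (integrable_mul_cellL2 F G')]
      congr 1
      refine integral_congr_ae ?_
      filter_upwards [Lp.coeFn_add G G'] with x hx
      rw [hx, Pi.add_apply]; ring)
    (fun c F G => by
      rw [smul_eq_mul, ← Complex.re_ofReal_mul, ← integral_const_mul]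
      congr 1
      refine integral_congr_ae ?_
      filter_upwards [Lp.coeFn_smul c G] with x hx
      rw [hx, Pi.smul_apply, Complex.real_smul]; ring)) 1 fun F G => by
    rw [one_mul]
    refine (Complex.abs_re_le_norm _).trans ((norm_integral_le_integral_norm _).trans ?_)
    exact integral_norm_mul_le_of_sq_le (Lp.memLp F) (Lp.memLp G) (norm_nonneg _) (norm_nonneg _)
      (integral_norm_sq_eq F).le (integral_norm_sq_eq G).le

/-- Multiplication of a test function and a square integrable function. -/
def testMul (L : ENNReal) [Fact (1 ≤ L)] : CellL2 L →L[ℝ] (H1 ℝ L →L[ℝ] CellL2 L) :=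
  (((isBoundedBilinearMap_bcfMul (L := L)).toContinuousLinearMap).comp
    (((H1.toBCF L).restrictScalars ℝ).comp (H1.ofReal L))).flip

/-- The half of the logarithmic derivative of `1 / (2 k) + h`. -/
def halfLogDeriv (k : ℂ) (h : H1 ℂ L) : CellL2 L :=
  (2⁻¹ : ℂ) • bcfMul (shiftInv (1 / (2 * k)) h, H1.derivL2 L h)

/-- The function `1 / (4 g ^ 2) - k ^ 2`, for `g = 1 / (2 k) + h`. -/
def recoverPotential (k : ℂ) (h : H1 ℂ L) : CellL2 L :=
  (-k) • bcfMul ((2⁻¹ : ℂ) • shiftInv (1 / (2 * k)) h + BoundedContinuousFunction.const ℝ k,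
    bcfMul (shiftInv (1 / (2 * k)) h, H1.toL2 L h))

/-- The potential `(g' / (2 g))' + (g' / (2 g)) ^ 2 + (1 / (4 g ^ 2) - k ^ 2)`, or rather its real
part, for `g = 1 / (2 k) + h`. -/
def recover (k : ℂ) (h : H1 ℂ L) : Hneg1 L :=
  -(rePairing L (halfLogDeriv k h)).comp
      (((H1.derivL2 L).restrictScalars ℝ).comp (H1.ofReal L))
    + (rePairing L (halfLogDeriv k h)).comp (testMul L (halfLogDeriv k h))
    + (rePairing L (recoverPotential k h)).comp
      (((H1.toL2 L).restrictScalars ℝ).comp (H1.ofReal L))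

theorem coeFn_halfLogDeriv {h : H1 ℂ L} (hh : h ∈ shiftUnits L (1 / (2 * k))) :
    ∀ᵐ x ∂volume.restrict (cell L),
      halfLogDeriv k h x = deriv h x / (2 * (1 / (2 * k) + h x)) := by
  filter_upwards [Lp.coeFn_smul (2⁻¹ : ℂ) (bcfMul (shiftInv (1 / (2 * k)) h, H1.derivL2 L h)),
    coeFn_bcfMul (shiftInv (1 / (2 * k)) h) (H1.derivL2 L h), H1.coeFn_derivL2 h] with x e1 e2 e3
  refine e1.trans ?_
  rw [Pi.smul_apply, e2, e3, shiftInv_apply hh, smul_eq_mul]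
  generalize 1 / (2 * k) + h x = g
  rw [div_eq_mul_inv, mul_inv]
  ring

theorem coeFn_recoverPotential (hk0 : k ≠ 0) {h : H1 ℂ L} (hh : h ∈ shiftUnits L (1 / (2 * k))) :
    ∀ᵐ x ∂volume.restrict (cell L),
      recoverPotential k h x = 1 / (4 * (1 / (2 * k) + h x) ^ 2) - k ^ 2 := by
  set i := shiftInv (1 / (2 * k)) h with hi
  set ρ : ℝ →ᵇ ℂ := (2⁻¹ : ℂ) • i + BoundedContinuousFunction.const ℝ k with hρ
  filter_upwards [Lp.coeFn_smul (-k) (bcfMul (ρ, bcfMul (i, H1.toL2 L h))),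
    coeFn_bcfMul ρ (bcfMul (i, H1.toL2 L h)), coeFn_bcfMul i (H1.toL2 L h), H1.coeFn_toL2 h]
    with x e1 e2 e3 e4
  refine e1.trans ?_
  -- With `g = 1/(2 k) + h` one has `1/(4 g²) - k² = -k (1/(2 g) + k) (h/g)`: the factor `h` makes
  -- the function square integrable.
  have h1 : ρ x = 2⁻¹ * i x + k := rfl
  rw [Pi.smul_apply, e2, e3, e4, h1, hi, shiftInv_apply hh, smul_eq_mul]
  obtain ⟨g, hg⟩ : ∃ g, g = 1 / (2 * k) + h x := ⟨_, rfl⟩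
  have hg0 : g ≠ 0 := hg ▸ shift_ne_zero hh x
  have h2 : h x = g - 1 / (2 * k) := by rw [hg]; ring
  rw [← hg, h2]
  field_simp
  ring

/-- For a general `h` the distribution on the right is complex. Its real part extends the inverse
from the range, where the distribution is the real `q`, to a full open set. -/
theorem recover_apply (hk0 : k ≠ 0) {h : H1 ℂ L} (hh : h ∈ shiftUnits L (1 / (2 * k)))
    (φ : H1 ℝ L) : recover k h φ =
      (distDeriv L (fun x => deriv h x / (2 * (1 / (2 * k) + h x))) φ
        + funDist L (fun x => (deriv h x / (2 * (1 / (2 * k) + h x))) ^ 2) φ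
        + funDist L (fun x => 1 / (4 * (1 / (2 * k) + h x) ^ 2) - k ^ 2) φ).re := by
  have h1 : recover k h φ
      = -(∫ x in cell L, halfLogDeriv k h x * H1.derivL2 L (H1.ofReal L φ) x).re
        + (∫ x in cell L, halfLogDeriv k h x
          * bcfMul (H1.toBCF L (H1.ofReal L φ), halfLogDeriv k h) x).re
        + (∫ x in cell L, recoverPotential k h x * H1.toL2 L (H1.ofReal L φ) x).re := rfl
  rw [h1, distDeriv, funDist, funDist, Complex.add_re, Complex.add_re, Complex.neg_re]
  have hA := coeFn_halfLogDeriv hh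
  congr 2
  · congr 2
    refine integral_congr_ae ?_
    filter_upwards [hA, H1.coeFn_derivL2 (H1.ofReal L φ), ae_restrict_of_ae φ.deriv_ofReal]
      with x e1 e2 e3
    rw [e1, e2, e3]
  · congr 1
    refine integral_congr_ae ?_
    filter_upwards [hA, coeFn_bcfMul (H1.toBCF L (H1.ofReal L φ)) (halfLogDeriv k h)]
      with x e1 e2
    rw [e2, e1, H1.toBCF_apply, H1.ofReal_apply]
    ring
  · refine integral_congr_ae ?_
    filter_upwards [coeFn_recoverPotential hk0 hh, H1.coeFn_toL2 (H1.ofReal L φ)] with x e1 e2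
    rw [e1, e2, H1.ofReal_apply]

theorem contDiffOn_halfLogDeriv (k : ℂ) :
    ContDiffOn ℝ ∞ (fun h : H1 ℂ L => halfLogDeriv k h) (shiftUnits L (1 / (2 * k))) :=
  (contDiff_bcfMul.comp_contDiffOn ((contDiffOn_shiftInv (L := L) (1 / (2 * k))).prodMk
    contDiff_derivL2.contDiffOn)).const_smul (2⁻¹ : ℂ)

theorem contDiffOn_recoverPotential (k : ℂ) :
    ContDiffOn ℝ ∞ (fun h : H1 ℂ L => recoverPotential k h) (shiftUnits L (1 / (2 * k))) := by
  have hi := contDiffOn_shiftInv (L := L) (1 / (2 * k))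
  exact (contDiff_bcfMul.comp_contDiffOn (((hi.const_smul (2⁻¹ : ℂ)).add contDiffOn_const).prodMk
    (contDiff_bcfMul.comp_contDiffOn (hi.prodMk contDiff_toL2.contDiffOn)))).const_smul (-k)

/-- The pairing and the multiplication by test functions are continuous and linear, so everything
reduces to the two `L²`-valued maps, which are built from the reciprocal by bounded bilinear
operations. -/
theorem contDiffOn_recover (k : ℂ) :
    ContDiffOn ℝ ∞ (fun h : H1 ℂ L => recover k h) (shiftUnits L (1 / (2 * k))) := by
  have hP : ContDiff ℝ ∞ fun F : CellL2 L => rePairing L F := by fun_prop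
  have hM : ContDiff ℝ ∞ fun F : CellL2 L => testMul L F := by fun_prop
  have hA := contDiffOn_halfLogDeriv (L := L) k
  have h1 := hP.comp_contDiffOn hA
  have h2 := hM.comp_contDiffOn hA
  have h3 := hP.comp_contDiffOn (contDiffOn_recoverPotential (L := L) k)
  exact ((h1.clm_comp contDiffOn_const).neg.add (h1.clm_comp h2)).add (h3.clm_comp contDiffOn_const)

end Recover

/-! ### The two embeddings -/

section Embedding

attribute [local instance] H1.normedSpace

variable {L : ENNReal} [Fact (1 ≤ L)] {k : ℂ}

theorem contDiff_rieszRep : ContDiff ℝ ∞ fun q : Hneg1 L => rieszRep q := by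
  have h : IsBoundedLinearMap ℝ fun q : Hneg1 L => rieszRep q :=
    { map_add := fun p q => map_add _ p q
      map_smul := fun c q => by
        rw [rieszRep, map_smulₛₗ]; rfl
      bound := ⟨1, one_pos, fun q => by
        rw [rieszRep, LinearIsometryEquiv.norm_map, one_mul]⟩ }
  exact h.contDiff

theorem inner_rieszRep (q : Hneg1 L) (φ : H1 ℝ L) : inner ℝ (rieszRep q) φ = q φ :=
  InnerProductSpace.toDual_symm_apply

theorem diagGreen_eq (hk : 0 < (k ^ 2).im) (q : Hneg1 L) (x : ℝ) :
    diagGreen q k x = greenFun k (rieszRep q) x x := by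
  rw [diagGreen, greenResolvent_eq hk, pointMass_apply, greenFun]

variable (hk : 0 < (k ^ 2).im) (hre : 0 < k.re)

theorem shift_diagShift (w : H1 ℝ L) (x : ℝ) :
    1 / (2 * k) + diagShift hk hre w x = greenFun k w x x := by
  rw [diagShift_apply]; ring

theorem diagShift_mem (w : H1 ℝ L) : diagShift hk hre w ∈ shiftUnits L (1 / (2 * k)) := by
  obtain ⟨C, hC⟩ := exists_norm_inv_diag_le hk hre w
  refine mem_shiftUnits (C := C) (fun x => ?_) fun x => ?_
  · rw [shift_diagShift]; exact greenFun_self_ne_zero hk w hre x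
  · rw [shift_diagShift]; exact hC x

include hk hre in
theorem recover_diagShift (q : Hneg1 L) : recover k (diagShift hk hre (rieszRep q)) = q := by
  have hk0 : k ≠ 0 := by rintro rfl; simp at hre
  refine ContinuousLinearMap.ext fun φ => ?_
  rw [recover_apply hk0 (diagShift_mem hk hre _)]
  simp only [shift_diagShift, deriv_diagShift]
  rw [← inner_eq_of_diag hk hre (rieszRep q) φ, inner_rieszRep, Complex.ofReal_re]

theorem isDiffeoOntoSubmanifold_diagShift :
    IsDiffeoOntoSubmanifold fun q : Hneg1 L => diagShift hk hre (rieszRep q) :=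
  isDiffeoOntoSubmanifold_of_leftInverse ((contDiff_diagShift hk hre).comp contDiff_rieszRep)
    (isOpen_shiftUnits L (1 / (2 * k))) (contDiffOn_recover k) (fun _ => diagShift_mem hk hre _)
    (recover_diagShift hk hre)

/-- The function `k - 1 / (2 g)` of class `H¹`. -/
def recipShift (hk : 0 < (k ^ 2).im) (hre : 0 < k.re) (w : H1 ℝ L) : H1 ℂ L :=
  k • moebius (1 / (2 * k)) (diagShift hk hre w)

theorem recipShift_apply (w : H1 ℝ L) (x : ℝ) :
    recipShift hk hre w x = k - 1 / (2 * greenFun k w x x) := by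
  have hk0 : k ≠ 0 := by rintro rfl; simp at hre
  have h0 := greenFun_self_ne_zero hk w hre x
  have h1 : recipShift hk hre w x = k * moebius (1 / (2 * k)) (diagShift hk hre w) x := rfl
  rw [h1, moebius_apply (diagShift_mem hk hre w), shift_diagShift, diagShift_apply]
  field_simp

/-- The shift by `-k` turns `k - 1/(2 g)` into `-1/(2 g)`, whose reciprocal is bounded because `g`
is. -/
theorem shift_recipShift (w : H1 ℝ L) (x : ℝ) :
    (-k + recipShift hk hre w x)⁻¹ = -2 * greenFun k w x x := by
  rw [recipShift_apply]
  have h0 := greenFun_self_ne_zero hk w hre x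
  rw [inv_eq_iff_eq_inv, mul_inv]
  field_simp
  ring

theorem recipShift_mem (w : H1 ℝ L) : recipShift hk hre w ∈ shiftUnits L (-k) := by
  refine mem_shiftUnits (C := 2 * (2 * ‖diagShift hk hre w‖ + ‖1 / (2 * k)‖)) (fun x h => ?_)
    fun x => ?_
  · have h1 := shift_recipShift hk hre w x
    rw [h, inv_zero] at h1
    exact mul_ne_zero (by norm_num) (greenFun_self_ne_zero hk w hre x) h1.symm
  · rw [shift_recipShift, norm_mul, norm_neg, ← shift_diagShift hk hre]
    have h1 := norm_add_le (1 / (2 * k)) (diagShift hk hre w x)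
    have h2 := (diagShift hk hre w).norm_apply_le x
    have h3 : ‖(2 : ℂ)‖ = 2 := by simp
    rw [h3]
    linarith

/-- For `p = k - 1/(2 g)` one has `p / (p - k) = 1 - 2 k g`, which is `-2 k` times `g - 1/(2 k)`. -/
theorem moebius_recipShift (w : H1 ℝ L) :
    (-(1 / (2 * k))) • moebius (-k) (recipShift hk hre w) = diagShift hk hre w := by
  have hk0 : k ≠ 0 := by rintro rfl; simp at hre
  refine H1.ext fun x => ?_
  have h0 := greenFun_self_ne_zero hk w hre x
  change -(1 / (2 * k)) * moebius (-k) (recipShift hk hre w) x = _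
  rw [moebius_apply (recipShift_mem hk hre w), shift_recipShift, recipShift_apply, diagShift_apply]
  field_simp

theorem isDiffeoOntoSubmanifold_recipShift :
    IsDiffeoOntoSubmanifold fun q : Hneg1 L => recipShift hk hre (rieszRep q) := by
  have h1 : ContDiff ℝ ∞ fun q : Hneg1 L => diagShift hk hre (rieszRep q) :=
    (contDiff_diagShift hk hre).comp contDiff_rieszRep
  have h2 : ContDiff ℝ ∞ fun q : Hneg1 L => recipShift hk hre (rieszRep q) := by
    rw [← contDiffOn_univ] at h1 ⊢
    exact ((contDiffOn_moebius (1 / (2 * k))).comp h1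
      fun q _ => diagShift_mem hk hre _).const_smul k
  have h3 : ContDiffOn ℝ ∞ (fun p : H1 ℂ L => (-(1 / (2 * k))) • moebius (-k) p)
      (shiftUnits L (-k)) := (contDiffOn_moebius (-k)).const_smul _
  -- The left inverse is `recover` after the inverse Möbius map, on the open set where the latter is
  -- defined and takes values in the domain of the former.
  refine isDiffeoOntoSubmanifold_of_leftInverse h2
    (h3.continuousOn.isOpen_inter_preimage (isOpen_shiftUnits L (-k))
      (isOpen_shiftUnits L (1 / (2 * k))))
    ((contDiffOn_recover k).comp (h3.mono inter_subset_left) fun p hp => hp.2) (fun q => ?_)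
    fun q => ?_
  · refine ⟨recipShift_mem hk hre _, ?_⟩
    rw [mem_preimage, moebius_recipShift]
    exact diagShift_mem hk hre _
  · simp only [Function.comp]
    rw [moebius_recipShift, recover_diagShift]

end Embedding

end DiagonalGreen

end

theorem lemma2p12 (C : ℝ) (hC : 1 ≤ C) (k : ℂ) (hk : StrictlyAdmissible C k)
    (L : ENNReal) [Fact (1 ≤ L)] :
    -- the resolvent exists, and the diagonal Green function vanishes nowhere
    (∀ (q : Hneg1 L) (T : StrongDual ℂ (H1 ℂ ⊤)), ∃! u : H1 ℂ ⊤, IsResolventSolution q k T u) ∧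
    (∀ (q : Hneg1 L) (x : ℝ), diagGreen q k x ≠ 0) ∧
    -- both maps take values in H¹ and are diffeomorphisms onto embedded submanifolds
    (∃ Φ : Hneg1 L → H1 ℂ L,
      (∀ q x, Φ q x = diagGreen q k x - 1 / (2 * k)) ∧ IsDiffeoOntoSubmanifold Φ) ∧
    (∃ Ψ : Hneg1 L → H1 ℂ L,
      (∀ q x, Ψ q x = k - 1 / (2 * diagGreen q k x)) ∧ IsDiffeoOntoSubmanifold Ψ) ∧
    -- recovery of the potential, as an identity of distributions
    (∀ (q : Hneg1 L) (φ : H1 ℝ L),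
      ((q φ : ℝ) : ℂ) =
        distDeriv L (fun x => deriv (diagGreen q k) x / (2 * diagGreen q k x)) φ
        + funDist L (fun x => (deriv (diagGreen q k) x / (2 * diagGreen q k x)) ^ 2) φ
        + funDist L (fun x => 1 / (4 * diagGreen q k x ^ 2) - k ^ 2) φ) := by
  obtain ⟨⟨hk0, harg0, harg⟩, him, -⟩ := hk
  have hk : 0 < (k ^ 2).im := by linarith
  -- `0 ≤ arg k < π/4` places `k ≠ 0` in the open right half plane, so `exp(-k |x|)` decays.
  have hre : 0 < k.re := by
    refine (Complex.abs_arg_lt_pi_div_two_iff.1 ?_).resolve_right hk0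
    rw [abs_of_nonneg harg0]
    linarith [Real.pi_pos]
  refine ⟨existsUnique_isResolventSolution hk, fun q x => ?_,
    ⟨_, fun q x => ?_, isDiffeoOntoSubmanifold_diagShift hk hre⟩,
    ⟨_, fun q x => ?_, isDiffeoOntoSubmanifold_recipShift hk hre⟩, fun q φ => ?_⟩
  · rw [diagGreen_eq hk]
    exact greenFun_self_ne_zero hk _ hre x
  · rw [diagGreen_eq hk]
    exact diagShift_apply hk hre _ x
  · rw [diagGreen_eq hk]
    exact recipShift_apply hk hre _ x
  · rw [funext (diagGreen_eq hk q), ← inner_rieszRep]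
    exact inner_eq_of_diag hk hre (rieszRep q) φ
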